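/- Let $\{\eta,\rho\}=\{1,2\}$, let $\delta_{a,b}$ be the Kronecker delta, and let $q\equiv 3\pmod 4$ and $r\equiv s\equiv 5\pmod 8$ be prime numbers with $\left(\frac{q}{r}\right)=\left(\frac{q}{s}\right)=(-1)^{\delta_{\eta,2}}$ and $\left(\frac{r}{s}\right)=1$. For a squarefree integer $d>1$ let $\varepsilon_d>1$ be the fundamental unit of $\mathbb{Q}(\sqrt d)$ and $N(\varepsilon_d)$ its norm to $\mathbb{Q}$. Write $\varepsilon_{\eta qrs}=\gamma+\gamma'\sqrt{\eta qrs}$ with $\gamma,\gamma'\in\mathbb{Z}$, and assume that $2^{\delta_{\eta,1}}q(\gamma-1)$ is not a square in $\mathbb{N}$. Put $K_1=\mathbb{Q}(\sqrt2,\sqrt q,\sqrt{rs})\subset\mathbb{R}$ and let $E_{K_1}$ be the unit group of its ring of integers. Then: 1. If $N(\varepsilon_{rs})=1$, then $$E_{K_1}=\langle -1,\varepsilon_2,\varepsilon_{2rs},\varepsilon_{\eta qrs},\sqrt{\varepsilon_q},\sqrt{\varepsilon_{2q}},\sqrt{\varepsilon_{\rho qrs}},\sqrt{\varepsilon_{rs}\varepsilon_{\eta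 qrs}}\rangle.$$ 2. If $N(\varepsilon_{rs})=-1$ and $\sqrt{\varepsilon_2\varepsilon_{rs}\varepsilon_{2rs}}\in\mathbb{Q}(\sqrt2,\sqrt{rs})$, then $$E_{K_1}=\langle -1,\varepsilon_2,\varepsilon_{rs},\varepsilon_{\eta qrs},\sqrt{\varepsilon_q},\sqrt{\varepsilon_{2q}},\sqrt{\varepsilon_{\rho qrs}},\sqrt{\varepsilon_2\varepsilon_{rs}\varepsilon_{2rs}}\rangle.$$ 3. If $N(\varepsilon_{rs})=-1$ and $\sqrt{\varepsilon_2\varepsilon_{rs}\varepsilon_{2rs}}\notin\mathbb{Q}(\sqrt2,\sqrt{rs})$, then $$E_{K_1}=\langle -1,\varepsilon_2,\varepsilon_{rs},\varepsilon_{\eta qrs},\sqrt{\varepsilon_q},\sqrt{\varepsilon_{2q}},\sqrt{\varepsilon_{\rho qrs}},\sqrt{\varepsilon_2\varepsilon_{rs}\varepsilon_{2rs}\varepsilon_{\eta qrs}}\rangle.$$ In each case the seven generators other than $-1$ are multiplicatively independent, i.e. they form a fundamental system of units of $K_1$. In every case the unit index $q(K_1)=[E_{K_1}:\prod_k E_k]$,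 where $k$ runs through the quadratic subfields of $K_1$ and $E_k$ is the unit group of the ring of integers of $k$, equals $2^4$. -/

import Mathlib

open scoped NumberField

noncomputable section

/-- The Kronecker delta `δ_{a,b}`. -/
def kroneckerDelta (a b : ℕ) : ℕ := if a = b then 1 else 0

/-- The real field `ℚ(√d₁, √d₂, …)`, where `d₁, d₂, …` run through `S`,
as a subfield of `ℝ`. -/
def sqrtField (S : Set ℕ) : IntermediateField ℚ ℝ :=
  IntermediateField.adjoin ℚ ((fun d : ℕ => √(d : ℝ)) '' S)

/-- The real number underlying a unit of the ring of integers of a subfield of `ℝ`. -/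
def unitVal {K : IntermediateField ℚ ℝ} (u : (𝓞 K)ˣ) : ℝ := (((u : 𝓞 K) : K) : ℝ)

/-- `E_K`: the group of units of the ring of integers of `K`, as a subgroup of `ℝˣ`. -/
def unitGroup (K : IntermediateField ℚ ℝ) : Subgroup ℝˣ :=
  (Units.map ((algebraMap K ℝ).comp (algebraMap (𝓞 K) K) : 𝓞 K →* ℝ)).range

/-- `u` is the fundamental unit of the real quadratic field `ℚ(√d)`: it exceeds `1`, and every
unit is, up to sign, a power of `u`. -/
def IsFundamentalUnit (d : ℕ) (u : (𝓞 (sqrtField {d}))ˣ) : Prop :=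
  1 < unitVal u ∧ ∀ v : (𝓞 (sqrtField {d}))ˣ, ∃ n : ℤ, v = u ^ n ∨ v = -u ^ n

/-- The fundamental unit of `ℚ(√d)` as an element of the unit group of the ring of integers
(for `d > 1` squarefree it exists and is unique). -/
def fundUnit (d : ℕ) : (𝓞 (sqrtField {d}))ˣ :=
  Classical.epsilon (IsFundamentalUnit d)

/-- `ε_d > 1`, the fundamental unit of `ℚ(√d)` as a real number. -/
def eps (d : ℕ) : ℝ := unitVal (fundUnit d)

/-- `N(ε_d)`: the norm of the fundamental unit from `ℚ(√d)` to `ℚ`. -/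
def normEps (d : ℕ) : ℚ :=
  Algebra.norm ℚ ((fundUnit d : 𝓞 (sqrtField {d})) : sqrtField {d})

/-- The subgroup of `ℝˣ` generated by the nonzero elements of a set `S` of real numbers. -/
def generatedBy (S : Set ℝ) : Subgroup ℝˣ :=
  Subgroup.closure {u : ℝˣ | (u : ℝ) ∈ S}

/-- `e₁, …, eₙ` is a fundamental system of units of `K`: together with `-1` they generate `E_K`,
and they are multiplicatively independent. -/
def IsFundamentalSystem (K : IntermediateField ℚ ℝ) {n : ℕ} (e : Fin n → ℝ) : Prop :=
  unitGroup K = generatedBy ({-1} ∪ Set.range e) ∧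
    ∀ k : Fin n → ℤ, ∏ i, e i ^ k i = 1 → k = 0

/-- The product of the unit groups `E_k` of all quadratic subfields `k` of `K`. -/
def quadraticUnits (K : IntermediateField ℚ ℝ) : Subgroup ℝˣ :=
  ⨆ k ∈ {k : IntermediateField ℚ ℝ | k ≤ K ∧ Module.finrank ℚ k = 2}, unitGroup k

/-- The unit index `q(K) = [E_K : ∏ E_k]`, with `k` running through the quadratic subfields
of the multiquadratic field `K`. -/
def unitIndex (K : IntermediateField ℚ ℝ) : ℕ :=
  (quadraticUnits K).relIndex (unitGroup K)

end

/-! ### Automorphisms of real multiquadratic fields -/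

open scoped NumberField

noncomputable section

/-! Every unit of `K₁` has its fourth power in the group generated by the units of the seven
quadratic subfields (`pow_four_mem`): the product of its seven relative norms is its fourth power
times the cube of its full norm. So it is enough to know which products of fundamental units are
squares in `K₁`.

For a unit `ε_d` of norm 1 and trace `T`, the identity `(ε_d + 1)² = ε_d (T + 2)` shows that `√(t
ε_d)` lies in `ℚ(√d)`, where `t` is the squarefree part of `T + 2` (`exists_isSquareClass`). The odd
primes of `t` divide `d`, and reducing `T² - 4 = dY²` modulo the primes of `d` restricts `t` by
Legendre symbols. Since `(2/r) = (2/s) = -1`, the assumptions say `(ηq/r) = (ηq/s) = 1` and `(ρq/r)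
= (ρq/s) = -1`. It follows that `√ε_q`, `√ε_{2q}` and `√ε_{ρqrs}` lie in `K₁`, that `N(ε_{2rs}) =
-1`, and that `√(r ε_{ηqrs})` lies in `K₁` while `√r` does not. The last claim needs the class `t =
rs` excluded, which is the purpose of the assumption on `γ`.

If `N(ε_{rs}) = 1`, then `√(r ε_{rs})` also lies in `K₁`, hence so does `√(ε_{rs} ε_{ηqrs})`. If
`N(ε_{rs}) = -1`, put `ω = ε_2 ε_{rs} ε_{2rs}`, a product of three units of norm -1. A Hilbert 90
argument (`exists_class_of_norms_neg`) gives `√(tω)` in `ℚ(√2, √rs)` with `t` dividing `2rs`, so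
either `√ω` is in that field or `√(rω)` is in `K₁`, and then `√(ω ε_{ηqrs})` is in `K₁`. These facts
are collected in `UnitData` and proved in `PrimeData.unitData`.

The rest is a parity statement: if a product of powers of the seven proposed generators is a square
in `K₁`, all exponents are even. It is proved one exponent at a time by applying well-chosen
automorphisms and comparing signs or relative norms (`UnitData.even_theta_of_sqrt_notMem`,
`UnitData.even_theta_of_mem`, `UnitData.even_exponents`). Parity yields independence by infinite
descent, and generation by extracting two square roots from `u⁴` (`unitGroup_eq_expGroup`). The
units of the quadratic subfields generate the subgroup in which the exponents of the last four
generators are even, so the index is `2⁴` (`relIndex_expGroup`). -/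

theorem sqrtField_le {S : Set ℕ} {L : IntermediateField ℚ ℝ} :
    sqrtField S ≤ L ↔ ∀ d ∈ S, √(d : ℝ) ∈ L := by
  simp [sqrtField, IntermediateField.adjoin_le_iff, Set.subset_def]

theorem sqrt_mem_sqrtField {S : Set ℕ} {d : ℕ} (h : d ∈ S) : √(d : ℝ) ∈ sqrtField S :=
  sqrtField_le.1 le_rfl d h

theorem sqrtField_mono {S T : Set ℕ} (h : S ⊆ T) : sqrtField S ≤ sqrtField T :=
  sqrtField_le.2 fun _ hd => sqrt_mem_sqrtField (h hd)

theorem isIntegral_sqrt_natCast (R : Type*) [CommRing R] [Algebra R ℝ] (d : ℕ) :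
    IsIntegral R √(d : ℝ) := by
  refine IsIntegral.of_pow (n := 2) two_pos ?_
  rw [Real.sq_sqrt (Nat.cast_nonneg d)]
  simpa using isIntegral_algebraMap (R := R) (A := ℝ) (x := (d : R))

instance finiteDimensional_sqrtField (S : Set ℕ) [Finite S] :
    FiniteDimensional ℚ (sqrtField S) := by
  have : Finite ((fun d : ℕ => √(d : ℝ)) '' S) := (Set.toFinite S).image _
  refine IntermediateField.finiteDimensional_adjoin ?_
  rintro _ ⟨d, -, rfl⟩
  exact isIntegral_sqrt_natCast ℚ d

/-- Normality: the conjugates of each generator `√d` are among `±√d`, so its minimal polynomial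
splits in the field. Separability is automatic in characteristic 0. -/
instance isGalois_sqrtField (S : Set ℕ) : IsGalois ℚ (sqrtField S) := by
  have halg : Algebra.IsAlgebraic ℚ (sqrtField S) := by
    refine IntermediateField.isAlgebraic_adjoin ?_
    rintro _ ⟨d, -, rfl⟩
    exact isIntegral_sqrt_natCast ℚ d
  have hn : Normal ℚ (sqrtField S) := by
    refine ⟨fun x => ?_⟩
    have key := IntermediateField.splits_of_mem_adjoin (F := ℚ) (K := ℝ) (L := sqrtField S)
      (S := (fun d : ℕ => √(d : ℝ)) '' S) ?_ x.2
    · rwa [← IntermediateField.minpoly_eq] at key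
    rintro _ ⟨d, hd, rfl⟩
    refine ⟨isIntegral_sqrt_natCast ℚ d, ?_⟩
    have hdvd : minpoly ℚ √(d : ℝ) ∣ (Polynomial.X ^ 2 - Polynomial.C (d : ℚ)) := by
      apply minpoly.dvd
      simp
    have hsp : ((Polynomial.X ^ 2 - Polynomial.C (d : ℚ)).map
        (algebraMap ℚ (sqrtField S))).Splits := by
      have : (Polynomial.X ^ 2 - Polynomial.C (d : ℚ)).map (algebraMap ℚ (sqrtField S)) =
          (Polynomial.X - Polynomial.C ⟨√(d : ℝ), sqrt_mem_sqrtField hd⟩) *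
          (Polynomial.X + Polynomial.C ⟨√(d : ℝ), sqrt_mem_sqrtField hd⟩) := by
        have h2 : (⟨√(d : ℝ), sqrt_mem_sqrtField hd⟩ : sqrtField S) ^ 2 = d := by
          ext; simp
        have : (Polynomial.C (d : sqrtField S)) =
          Polynomial.C (⟨√(d : ℝ), sqrt_mem_sqrtField hd⟩ : sqrtField S) ^ 2 := by
          rw [← Polynomial.C_pow, h2]
        rw [Polynomial.map_sub, Polynomial.map_pow, Polynomial.map_X, Polynomial.map_C,
          map_natCast, this]
        ring
      rw [this]
      exact (Polynomial.Splits.X_sub_C _).mul (Polynomial.Splits.X_add_C _)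
    refine hsp.of_dvd ?_ (Polynomial.map_dvd _ hdvd)
    exact (Polynomial.map_ne_zero (Polynomial.X_pow_sub_C_ne_zero two_pos _))
  exact isGalois_iff.2 ⟨inferInstance, hn⟩

/-- `Sends σ x y`: the real number `x` lies in `K` and `σ` maps it to `y`. -/
def Sends {K : IntermediateField ℚ ℝ} (σ : K ≃ₐ[ℚ] K) (x y : ℝ) : Prop :=
  ∃ h : x ∈ K, (σ ⟨x, h⟩ : ℝ) = y

namespace Sends

variable {K : IntermediateField ℚ ℝ} {σ τ : K ≃ₐ[ℚ] K} {x y x' y' : ℝ}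

theorem mem (h : Sends σ x y) : x ∈ K := h.1

theorem exists_of_mem (σ : K ≃ₐ[ℚ] K) (h : x ∈ K) : ∃ y, Sends σ x y := ⟨_, h, rfl⟩

theorem mem_right (h : Sends σ x y) : y ∈ K := by
  obtain ⟨h, rfl⟩ := h
  exact SetLike.coe_mem _

theorem unique (h : Sends σ x y) (h' : Sends σ x y') : y = y' := by
  obtain ⟨_, rfl⟩ := h
  obtain ⟨_, rfl⟩ := h'
  rfl

theorem injective (h : Sends σ x y) (h' : Sends σ x' y) : x = x' := by
  obtain ⟨_, e⟩ := h
  obtain ⟨_, e'⟩ := h'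
  have := σ.injective (Subtype.ext (e.trans e'.symm))
  exact congrArg Subtype.val this

theorem mul (h : Sends σ x y) (h' : Sends σ x' y') : Sends σ (x * x') (y * y') := by
  obtain ⟨m, rfl⟩ := h
  obtain ⟨m', rfl⟩ := h'
  exact ⟨mul_mem m m', congrArg Subtype.val (map_mul σ ⟨x, m⟩ ⟨x', m'⟩)⟩

theorem add (h : Sends σ x y) (h' : Sends σ x' y') : Sends σ (x + x') (y + y') := by
  obtain ⟨m, rfl⟩ := h
  obtain ⟨m', rfl⟩ := h'
  exact ⟨add_mem m m', congrArg Subtype.val (map_add σ ⟨x, m⟩ ⟨x', m'⟩)⟩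

theorem sub (h : Sends σ x y) (h' : Sends σ x' y') : Sends σ (x - x') (y - y') := by
  obtain ⟨m, rfl⟩ := h
  obtain ⟨m', rfl⟩ := h'
  exact ⟨sub_mem m m', congrArg Subtype.val (map_sub σ ⟨x, m⟩ ⟨x', m'⟩)⟩

theorem neg (h : Sends σ x y) : Sends σ (-x) (-y) := by
  obtain ⟨m, rfl⟩ := h
  exact ⟨neg_mem m, congrArg Subtype.val (map_neg σ ⟨x, m⟩)⟩

theorem inv (h : Sends σ x y) : Sends σ x⁻¹ y⁻¹ := by
  obtain ⟨m, rfl⟩ := h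
  exact ⟨inv_mem m, congrArg Subtype.val (map_inv₀ σ ⟨x, m⟩)⟩

theorem div (h : Sends σ x y) (h' : Sends σ x' y') : Sends σ (x / x') (y / y') := by
  simpa only [div_eq_mul_inv] using h.mul h'.inv

theorem pow (h : Sends σ x y) (n : ℕ) : Sends σ (x ^ n) (y ^ n) := by
  obtain ⟨m, rfl⟩ := h
  exact ⟨pow_mem m n, congrArg Subtype.val (map_pow σ ⟨x, m⟩ n)⟩

theorem zpow (h : Sends σ x y) (n : ℤ) : Sends σ (x ^ n) (y ^ n) := by
  obtain ⟨m, rfl⟩ := h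
  exact ⟨zpow_mem m n, congrArg Subtype.val (map_zpow₀ σ ⟨x, m⟩ n)⟩

theorem ratCast (σ : K ≃ₐ[ℚ] K) (a : ℚ) : Sends σ (a : ℝ) a :=
  ⟨K.algebraMap_mem a, congrArg Subtype.val (σ.commutes a)⟩

theorem intCast (σ : K ≃ₐ[ℚ] K) (a : ℤ) : Sends σ (a : ℝ) a := by
  simpa using ratCast σ a

theorem natCast (σ : K ≃ₐ[ℚ] K) (a : ℕ) : Sends σ (a : ℝ) a := by
  simpa using ratCast σ a

theorem one (σ : K ≃ₐ[ℚ] K) : Sends σ 1 1 := by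
  simpa using ratCast σ 1

theorem mul_aut (h : Sends τ x x') (h' : Sends σ x' y) : Sends (σ * τ) x y := by
  obtain ⟨m, rfl⟩ := h
  obtain ⟨m', rfl⟩ := h'
  exact ⟨m, rfl⟩

theorem ne_zero (h : Sends σ x y) (hx : x ≠ 0) : y ≠ 0 := by
  rintro rfl
  exact hx (h.injective (by simpa using ratCast σ 0))

theorem isIntegral (h : Sends σ x y) (hx : IsIntegral ℤ x) : IsIntegral ℤ y := by
  obtain ⟨m, rfl⟩ := h
  have h1 : IsIntegral ℤ (⟨x, m⟩ : K) :=
    (isIntegral_algHom_iff (K.val.restrictScalars ℤ) Subtype.val_injective).1 hx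
  have h2 := h1.map (σ : K →ₐ[ℚ] K)
  exact (isIntegral_algHom_iff (K.val.restrictScalars ℤ) Subtype.val_injective).2 h2

/-- The image of `√x` is a real square root of `y`. This gives the choice of sign and, for free, `0
≤ y`. -/
theorem sqrt_or (h : Sends σ x y) (hx : 0 ≤ x) (hm : √x ∈ K) :
    0 ≤ y ∧ (Sends σ √x √y ∨ Sends σ √x (-√y)) := by
  obtain ⟨z, hz⟩ := exists_of_mem σ hm
  have h2 : z ^ 2 = y := by
    have := hz.pow 2
    rw [Real.sq_sqrt hx] at this
    exact this.unique h
  have hy : 0 ≤ y := h2 ▸ sq_nonneg z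
  refine ⟨hy, ?_⟩
  rcases sq_eq_sq_iff_eq_or_eq_neg.1 (h2.trans (Real.sq_sqrt hy).symm) with rfl | rfl
  · exact Or.inl hz
  · exact Or.inr hz

end Sends

/-- The Galois correspondence for `K`, carried over to subfields of `ℝ` contained in `K`. -/
theorem mem_of_fixed {K F : IntermediateField ℚ ℝ} [FiniteDimensional ℚ K] [IsGalois ℚ K]
    (hFK : F ≤ K) {x : ℝ} (hx : x ∈ K)
    (h : ∀ σ : K ≃ₐ[ℚ] K, (∀ y ∈ F, Sends σ y y) → Sends σ x x) : x ∈ F := by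
  let F' : IntermediateField ℚ K :=
    Subfield.toIntermediateField (F.toSubfield.comap (algebraMap K ℝ))
      fun a => show (((algebraMap ℚ K a : K)) : ℝ) ∈ F by
        rw [eq_ratCast, SubfieldClass.coe_ratCast]
        exact F.algebraMap_mem a
  have hF' : ∀ y : K, y ∈ F' ↔ (y : ℝ) ∈ F := fun y => Iff.rfl
  have key := IsGalois.fixedField_fixingSubgroup F'
  have : (⟨x, hx⟩ : K) ∈ IntermediateField.fixedField F'.fixingSubgroup := by
    rw [IntermediateField.mem_fixedField_iff]
    intro σ hσ
    rw [IntermediateField.mem_fixingSubgroup_iff] at hσ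
    obtain ⟨_, e⟩ := h σ fun y hy => ⟨hFK hy, congrArg Subtype.val (hσ ⟨y, hFK hy⟩ hy)⟩
    exact Subtype.ext e
  rwa [key] at this

theorem sends_of_sends_sqrt {K : IntermediateField ℚ ℝ} (σ : K ≃ₐ[ℚ] K) {S : Set ℕ}
    (h : ∀ d ∈ S, Sends σ √(d : ℝ) √(d : ℝ)) : ∀ y ∈ sqrtField S, Sends σ y y := by
  intro y hy
  induction hy using IntermediateField.adjoin_induction with
  | mem x hx => obtain ⟨d, hd, rfl⟩ := hx; exact h d hd
  | algebraMap x => exact Sends.ratCast σ x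
  | add x y _ _ hx hy => exact hx.add hy
  | inv x _ hx => exact hx.inv
  | mul x y _ _ hx hy => exact hx.mul hy

theorem sends_sqrt_or {K : IntermediateField ℚ ℝ} (σ : K ≃ₐ[ℚ] K) {d : ℕ}
    (h : √(d : ℝ) ∈ K) : Sends σ √(d : ℝ) √(d : ℝ) ∨ Sends σ √(d : ℝ) (-√(d : ℝ)) :=
  ((Sends.natCast σ d).sqrt_or (Nat.cast_nonneg d) h).2

theorem exists_sends_neg {K F : IntermediateField ℚ ℝ} [FiniteDimensional ℚ K] [IsGalois ℚ K]
    (hFK : F ≤ K) {x : ℝ} (hx : 0 ≤ x) (hxF : x ∈ F) (hxK : √x ∈ K) (h : √x ∉ F) :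
    ∃ σ : K ≃ₐ[ℚ] K, (∀ y ∈ F, Sends σ y y) ∧ Sends σ √x (-√x) := by
  by_contra! hc
  refine h (mem_of_fixed hFK hxK fun σ hσ => ?_)
  exact ((hσ x hxF).sqrt_or hx hxK).2.resolve_right (hc σ hσ)

/-- Two automorphisms that agree on the generating square roots are equal. -/
theorem aut_ext {S : Set ℕ} {σ τ : sqrtField S ≃ₐ[ℚ] sqrtField S}
    (h : ∀ d ∈ S, ∃ y, Sends σ √(d : ℝ) y ∧ Sends τ √(d : ℝ) y) : σ = τ := by
  have h1 : ∀ y ∈ sqrtField S, Sends (τ⁻¹ * σ) y y := by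
    refine sends_of_sends_sqrt _ fun d hd => ?_
    obtain ⟨y, ⟨h1, e1⟩, ⟨h2, e2⟩⟩ := h d hd
    refine ⟨h1, ?_⟩
    have : σ ⟨_, h1⟩ = τ ⟨_, h1⟩ := Subtype.ext (e1.trans e2.symm)
    rw [AlgEquiv.mul_apply, this]
    simp
  ext x
  obtain ⟨_, e⟩ := h1 x.1 x.2
  have : (τ⁻¹ * σ) x = x := Subtype.ext e
  have := congrArg τ this
  rw [AlgEquiv.mul_apply] at this
  simpa using congrArg Subtype.val this

/-- Kummer theory in degree 2: over the field of `S` the only nontrivial automorphism negates `√m`.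
Either it fixes `√a`, or it negates `√a` and then fixes `√a √m`. -/
theorem sqrt_mem_or_of_mem_insert {S : Set ℕ} [Finite S] {m a : ℕ}
    (h : √(a : ℝ) ∈ sqrtField (insert m S)) :
    √(a : ℝ) ∈ sqrtField S ∨ √((a * m : ℕ) : ℝ) ∈ sqrtField S := by
  have hle : sqrtField S ≤ sqrtField (insert m S) := sqrtField_mono (Set.subset_insert m S)
  have hmK : √(m : ℝ) ∈ sqrtField (insert m S) := sqrt_mem_sqrtField (Set.mem_insert m S)
  have hMul : √((a * m : ℕ) : ℝ) = √(a : ℝ) * √(m : ℝ) := by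
    push_cast; exact Real.sqrt_mul (Nat.cast_nonneg a) _
  by_cases hm : √(m : ℝ) ∈ sqrtField S
  · left
    have : sqrtField (insert m S) ≤ sqrtField S := sqrtField_le.2 fun d hd => by
      rcases hd with rfl | hd
      · exact hm
      · exact sqrt_mem_sqrtField hd
    exact this h
  obtain ⟨σ, hσ, hσm⟩ := exists_sends_neg hle (Nat.cast_nonneg m) (natCast_mem _ m) hmK hm
  have huniq : ∀ τ : sqrtField (insert m S) ≃ₐ[ℚ] sqrtField (insert m S),
      (∀ y ∈ sqrtField S, Sends τ y y) → τ = 1 ∨ τ = σ := by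
    intro τ hτ
    rcases sends_sqrt_or τ hmK with h1 | h1
    · left
      refine aut_ext fun d hd => ⟨√(d : ℝ), ?_, sqrt_mem_sqrtField hd, rfl⟩
      rcases hd with rfl | hd
      · exact h1
      · exact hτ _ (sqrt_mem_sqrtField hd)
    · right
      refine aut_ext fun d hd => ?_
      rcases hd with rfl | hd
      · exact ⟨_, h1, hσm⟩
      · exact ⟨_, hτ _ (sqrt_mem_sqrtField hd), hσ _ (sqrt_mem_sqrtField hd)⟩
  have hfix : ∀ x ∈ sqrtField (insert m S), Sends σ x x → x ∈ sqrtField S := by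
    intro x hx hs
    refine mem_of_fixed hle hx fun τ hτ => ?_
    rcases huniq τ hτ with rfl | rfl
    · exact ⟨hx, rfl⟩
    · exact hs
  rcases sends_sqrt_or σ h with h1 | h1
  · exact Or.inl (hfix _ h h1)
  · right
    rw [hMul]
    refine hfix _ (mul_mem h hmK) ?_
    simpa using h1.mul hσm

theorem sqrt_natCast_mem_sqrtField_empty {a : ℕ} (h : √(a : ℝ) ∈ sqrtField ∅) : IsSquare a := by
  have h1 : √(a : ℝ) ∈ (⊥ : IntermediateField ℚ ℝ) := by
    simpa [sqrtField] using h
  rw [IntermediateField.mem_bot] at h1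
  by_contra hc
  have := (irrational_sqrt_natCast_iff).2 hc
  exact this h1

/-! ### Units as real numbers -/

/-- `x` is a unit of the ring of integers of `K ⊆ ℝ`. -/
def IsUnitOf (K : IntermediateField ℚ ℝ) (x : ℝ) : Prop :=
  x ≠ 0 ∧ x ∈ K ∧ IsIntegral ℤ x ∧ IsIntegral ℤ x⁻¹

namespace IsUnitOf

variable {K L : IntermediateField ℚ ℝ} {x y : ℝ}

theorem mul (h : IsUnitOf K x) (h' : IsUnitOf K y) : IsUnitOf K (x * y) :=
  ⟨mul_ne_zero h.1 h'.1, mul_mem h.2.1 h'.2.1, h.2.2.1.mul h'.2.2.1,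
    by rw [mul_inv]; exact h.2.2.2.mul h'.2.2.2⟩

theorem one : IsUnitOf K 1 :=
  ⟨one_ne_zero, one_mem _, isIntegral_one, by simpa using isIntegral_one⟩

theorem neg (h : IsUnitOf K x) : IsUnitOf K (-x) :=
  ⟨neg_ne_zero.2 h.1, neg_mem h.2.1, h.2.2.1.neg, by rw [inv_neg]; exact h.2.2.2.neg⟩

theorem mono (h : IsUnitOf K x) (hle : K ≤ L) : IsUnitOf L x :=
  ⟨h.1, hle h.2.1, h.2.2⟩

theorem of_pow {n : ℕ} (hn : n ≠ 0) (h : IsUnitOf K (x ^ n)) (hx : x ∈ L) : IsUnitOf L x :=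
  ⟨fun h0 => h.1 (by rw [h0, zero_pow hn]), hx, h.2.2.1.of_pow (Nat.pos_of_ne_zero hn),
    IsIntegral.of_pow (Nat.pos_of_ne_zero hn) (by rw [inv_pow]; exact h.2.2.2)⟩

theorem sqrt (h : IsUnitOf K x) (h0 : 0 ≤ x) (hx : √x ∈ L) : IsUnitOf L √x :=
  of_pow two_ne_zero (by rwa [Real.sq_sqrt h0]) hx

theorem sends {σ : K ≃ₐ[ℚ] K} (h : IsUnitOf K x) (hs : Sends σ x y) : IsUnitOf K y :=
  ⟨hs.ne_zero h.1, hs.mem_right, hs.isIntegral h.2.2.1, hs.inv.isIntegral h.2.2.2⟩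

end IsUnitOf

theorem isIntegral_coe_iff {K : IntermediateField ℚ ℝ} {x : K} :
    IsIntegral ℤ (x : ℝ) ↔ IsIntegral ℤ x :=
  isIntegral_algHom_iff (K.val.restrictScalars ℤ) Subtype.val_injective

theorem unitVal_mul {K : IntermediateField ℚ ℝ} (u v : (𝓞 K)ˣ) :
    unitVal (u * v) = unitVal u * unitVal v := by
  simp [unitVal]

theorem unitVal_one {K : IntermediateField ℚ ℝ} : unitVal (1 : (𝓞 K)ˣ) = 1 := by
  simp [unitVal]

theorem unitVal_neg {K : IntermediateField ℚ ℝ} (u : (𝓞 K)ˣ) : unitVal (-u) = -unitVal u := by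
  simp [unitVal]

theorem unitVal_injective {K : IntermediateField ℚ ℝ} :
    Function.Injective (unitVal : (𝓞 K)ˣ → ℝ) := fun u v h => by
  apply Units.ext
  apply NumberField.RingOfIntegers.ext
  exact Subtype.ext h

/-- `unitVal` as a monoid homomorphism. -/
def unitValHom (K : IntermediateField ℚ ℝ) : (𝓞 K)ˣ →* ℝ where
  toFun := unitVal
  map_one' := unitVal_one
  map_mul' := unitVal_mul

theorem unitVal_zpow {K : IntermediateField ℚ ℝ} (u : (𝓞 K)ˣ) (n : ℤ) :
    unitVal (u ^ n) = unitVal u ^ n := by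
  exact map_zpow' (unitValHom K) (fun u => by
    refine eq_inv_of_mul_eq_one_left ?_
    rw [← map_mul, inv_mul_cancel, map_one]) u n

theorem unitVal_ne_zero {K : IntermediateField ℚ ℝ} (u : (𝓞 K)ˣ) : unitVal u ≠ 0 := by
  intro h
  have := unitVal_mul u u⁻¹
  rw [mul_inv_cancel, unitVal_one, h, zero_mul] at this
  exact one_ne_zero this

theorem isUnitOf_unitVal {K : IntermediateField ℚ ℝ} (u : (𝓞 K)ˣ) : IsUnitOf K (unitVal u) := by
  refine ⟨unitVal_ne_zero u, SetLike.coe_mem _, isIntegral_coe_iff.2 (u : 𝓞 K).2, ?_⟩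
  have : (unitVal u)⁻¹ = unitVal u⁻¹ := by simpa using (unitVal_zpow u (-1)).symm
  rw [this]
  exact isIntegral_coe_iff.2 ((u⁻¹ : (𝓞 K)ˣ) : 𝓞 K).2

theorem IsUnitOf.exists_unitVal {K : IntermediateField ℚ ℝ} {x : ℝ} (h : IsUnitOf K x) :
    ∃ u : (𝓞 K)ˣ, unitVal u = x := by
  obtain ⟨h0, hK, hi, hi'⟩ := h
  let a : 𝓞 K := ⟨⟨x, hK⟩, isIntegral_coe_iff.1 hi⟩
  let b : 𝓞 K := ⟨⟨x⁻¹, inv_mem hK⟩, isIntegral_coe_iff.1 hi'⟩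
  have hab : a * b = 1 := by
    apply NumberField.RingOfIntegers.ext
    apply Subtype.ext
    exact mul_inv_cancel₀ h0
  exact ⟨⟨a, b, hab, by rw [mul_comm, hab]⟩, rfl⟩

theorem mem_unitGroup {K : IntermediateField ℚ ℝ} {u : ℝˣ} :
    u ∈ unitGroup K ↔ IsUnitOf K u := by
  constructor
  · rintro ⟨v, rfl⟩
    exact isUnitOf_unitVal v
  · intro h
    obtain ⟨v, hv⟩ := h.exists_unitVal
    exact ⟨v, Units.ext hv⟩

theorem exists_int_of_isIntegral (c : ℚ) (hc : IsIntegral ℤ (c : ℝ)) : ∃ n : ℤ, c = n := by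
  have hc' : IsIntegral ℤ c :=
    (isIntegral_algebraMap_iff (algebraMap ℚ ℝ).injective).1 (by simpa using hc)
  obtain ⟨n, hn⟩ := IsIntegrallyClosed.isIntegral_iff.1 hc'
  exact ⟨n, by rw [← hn]; simp⟩

theorem exists_rat_of_fixed {K : IntermediateField ℚ ℝ} [FiniteDimensional ℚ K] [IsGalois ℚ K]
    {x : ℝ} (hx : x ∈ K) (h : ∀ σ : K ≃ₐ[ℚ] K, Sends σ x x) : ∃ a : ℚ, x = a := by
  have : x ∈ (⊥ : IntermediateField ℚ ℝ) := mem_of_fixed bot_le hx fun σ _ => h σ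
  rw [IntermediateField.mem_bot] at this
  obtain ⟨a, ha⟩ := this
  exact ⟨a, by rw [← ha]; simp⟩

/-! ### Real quadratic fields and their fundamental units -/

section Quadratic

variable {d : ℕ}

theorem sqrt_mem_singleton (d : ℕ) : √(d : ℝ) ∈ sqrtField {d} :=
  sqrt_mem_sqrtField (Set.mem_singleton d)

theorem sqrt_notMem_bot (hd : ¬IsSquare d) : √(d : ℝ) ∉ (⊥ : IntermediateField ℚ ℝ) := fun h =>
  hd (sqrt_natCast_mem_sqrtField_empty (by simpa [sqrtField] using h))

theorem exists_conj (hd : ¬IsSquare d) : ∃ σ : sqrtField {d} ≃ₐ[ℚ] sqrtField {d},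
    σ ≠ 1 ∧ Sends σ √(d : ℝ) (-√(d : ℝ)) ∧ ∀ τ, τ = 1 ∨ τ = σ := by
  have hd0 : √(d : ℝ) ≠ 0 := fun h => sqrt_notMem_bot hd (h ▸ zero_mem _)
  obtain ⟨σ, -, hσ⟩ := exists_sends_neg bot_le (Nat.cast_nonneg d) (natCast_mem _ d)
    (sqrt_mem_singleton d) (sqrt_notMem_bot hd)
  refine ⟨σ, ?_, hσ, fun τ => ?_⟩
  · rintro rfl
    have : √(d : ℝ) = -√(d : ℝ) := Sends.unique ⟨sqrt_mem_singleton d, rfl⟩ hσ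
    exact hd0 (self_eq_neg.1 this)
  · rcases sends_sqrt_or τ (sqrt_mem_singleton d) with h | h
    · left
      refine aut_ext fun e he => ?_
      obtain rfl := he
      exact ⟨_, h, sqrt_mem_singleton _, rfl⟩
    · right
      refine aut_ext fun e he => ?_
      obtain rfl := he
      exact ⟨_, h, hσ⟩

theorem finrank_sqrtField_singleton (hd : ¬IsSquare d) :
    Module.finrank ℚ (sqrtField {d}) = 2 := by
  obtain ⟨σ, h1, -, h2⟩ := exists_conj hd
  rw [← IsGalois.card_aut_eq_finrank, Nat.card_eq_two_iff]
  exact ⟨1, σ, h1.symm, Set.eq_univ_of_forall fun τ => h2 τ⟩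

theorem norm_eq_mul_conj {σ : sqrtField {d} ≃ₐ[ℚ] sqrtField {d}} (h1 : σ ≠ 1)
    (h2 : ∀ τ, τ = 1 ∨ τ = σ) (x : sqrtField {d}) :
    ((Algebra.norm ℚ x : ℚ) : ℝ) = x * (σ x : sqrtField {d}) := by
  classical
  have h := Algebra.norm_eq_prod_automorphisms ℚ x
  have huniv : (Finset.univ : Finset (sqrtField {d} ≃ₐ[ℚ] sqrtField {d})) = {1, σ} := by
    ext τ
    simpa using h2 τ
  rw [huniv, Finset.prod_pair h1.symm] at h
  have := congrArg (Subtype.val) h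
  rw [eq_ratCast, SubfieldClass.coe_ratCast] at this
  exact this

theorem exists_rat_of_mem_sqrtField_singleton (hd : ¬IsSquare d) {x : ℝ}
    (hx : x ∈ sqrtField {d}) : ∃ a b : ℚ, x = a + b * √(d : ℝ) := by
  obtain ⟨σ, h1, hσ, h2⟩ := exists_conj hd
  have hd0 : √(d : ℝ) ≠ 0 := fun h => sqrt_notMem_bot hd (h ▸ zero_mem _)
  obtain ⟨y, hy⟩ := Sends.exists_of_mem σ hx
  have hyx : Sends σ y x := by
    have hss : σ * σ = 1 := by
      rcases h2 (σ * σ) with h | h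
      · exact h
      · exact absurd (mul_eq_left.1 h) h1
    obtain ⟨z, hz⟩ := Sends.exists_of_mem σ hy.mem_right
    have := hy.mul_aut hz
    rw [hss] at this
    have hxz : x = z := Sends.unique ⟨hx, rfl⟩ this
    rwa [← hxz] at hz
  have hfix : ∀ z, Sends σ z z → ∃ a : ℚ, z = a := by
    intro z hz
    refine exists_rat_of_fixed (K := sqrtField {d}) hz.mem fun τ => ?_
    rcases h2 τ with rfl | rfl
    · exact ⟨hz.mem, rfl⟩
    · exact hz
  obtain ⟨a, ha⟩ := hfix (x + y) (by simpa [add_comm] using hy.add hyx)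
  obtain ⟨b, hb⟩ := hfix ((x - y) / √(d : ℝ)) (by
    have := (hy.sub hyx).div hσ
    rwa [div_neg, ← neg_div, neg_sub] at this)
  refine ⟨a / 2, b / 2, ?_⟩
  push_cast
  rw [← ha, ← hb]
  field_simp
  ring

-- The inclusion into `ℝ` is a real place, and `r₁ + 2 r₂ = 2` then forces `r₁ = 2` and `r₂ = 0`.
open NumberField in
theorem rank_sqrtField_singleton (hd : ¬IsSquare d) [NumberField (sqrtField {d})] :
    Units.rank (sqrtField {d}) = 1 := by
  have h1 := InfinitePlace.card_add_two_mul_card_eq_rank (sqrtField {d})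
  rw [finrank_sqrtField_singleton hd] at h1
  have h2 : 0 < InfinitePlace.nrRealPlaces (sqrtField {d}) := by
    classical
    refine Fintype.card_pos_iff.2 ⟨⟨InfinitePlace.mk
      (Complex.ofRealHom.comp (algebraMap (sqrtField {d}) ℝ)), ?_⟩⟩
    rw [InfinitePlace.isReal_iff]
    rw [InfinitePlace.embedding_mk_eq_of_isReal] <;> rw [ComplexEmbedding.isReal_iff] <;> ext x <;>
      simp [ComplexEmbedding.conjugate]
  rw [Units.rank, InfinitePlace.card_eq_nrRealPlaces_add_nrComplexPlaces]
  omega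

/-- Dirichlet's theorem in rank 1, with torsion `±1` because the field is real. One of `u`, `-u`,
`u⁻¹`, `-u⁻¹` exceeds 1 for the Dirichlet generator `u`. -/
theorem exists_isFundamentalUnit (hd : ¬IsSquare d) : ∃ u, IsFundamentalUnit d u := by
  have : NumberField (sqrtField {d}) := ⟨⟩
  have hr := rank_sqrtField_singleton hd
  let i : Fin (NumberField.Units.rank (sqrtField {d})) := ⟨0, by omega⟩
  have huniv : ∀ j, j = i := fun j => Fin.ext (by have := j.2; simp [i]; omega)
  have hprod : ∀ e : Fin (NumberField.Units.rank (sqrtField {d})) → ℤ,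
      ∏ j, NumberField.Units.fundSystem (sqrtField {d}) j ^ e j =
        NumberField.Units.fundSystem (sqrtField {d}) i ^ e i := fun e =>
    Finset.prod_eq_single_of_mem i (Finset.mem_univ i) fun j _ hj => absurd (huniv j) hj
  set u := NumberField.Units.fundSystem (sqrtField {d}) i
  have htor : ∀ ζ ∈ NumberField.Units.torsion (sqrtField {d}), ζ = 1 ∨ ζ = -1 := by
    intro ζ hζ
    obtain ⟨n, hn, h1⟩ := isOfFinOrder_iff_pow_eq_one.1 hζ
    have h2 : unitVal ζ ^ n = 1 := by
      have := congrArg (unitValHom _) h1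
      rwa [map_pow, map_one] at this
    have h3 : |unitVal ζ| = 1 := by
      have : |unitVal ζ| ^ n = 1 := by rw [← abs_pow, h2, abs_one]
      exact (pow_eq_one_iff_of_nonneg (abs_nonneg _) hn.ne').1 this
    rcases eq_or_eq_neg_of_abs_eq h3 with h | h
    · exact Or.inl (unitVal_injective (h.trans unitVal_one.symm))
    · exact Or.inr (unitVal_injective (by rw [h, unitVal_neg, unitVal_one]))
  have hall : ∀ v : (𝓞 (sqrtField {d}))ˣ, ∃ n : ℤ, v = u ^ n ∨ v = -u ^ n := by
    intro v
    obtain ⟨⟨⟨ζ, hζ⟩, e⟩, h, -⟩ := NumberField.Units.exist_unique_eq_mul_prod (sqrtField {d}) v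
    simp only [hprod] at h
    refine ⟨e i, ?_⟩
    rcases htor ζ hζ with rfl | rfl
    · left; rw [h, one_mul]
    · right; rw [h, neg_mul, one_mul]
  -- Otherwise `u² = 1`, and the unit 1 would have two different exponents in Dirichlet's
  -- representation.
  have hne : |unitVal u| ≠ 1 := by
    intro h
    have h2 : u ^ (2 : ℤ) = 1 := by
      apply unitVal_injective
      rw [unitVal_zpow, unitVal_one, show (2 : ℤ) = (2 : ℕ) from rfl, zpow_natCast, ← sq_abs, h,
        one_pow]
    obtain ⟨x, -, hx⟩ := NumberField.Units.exist_unique_eq_mul_prod (sqrtField {d}) 1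
    have e1 := hx (1, fun _ => 2) (by simp only [hprod]; rw [h2]; simp)
    have e2 := hx (1, fun _ => 0) (by simp)
    have := congrFun (congrArg Prod.snd (e1.trans e2.symm)) i
    simp at this
  have hu0 := unitVal_ne_zero u
  rcases lt_or_gt_of_ne hne with h | h
  · have hinv : 1 < |(unitVal u)⁻¹| := by
      rw [abs_inv]; exact (one_lt_inv₀ (abs_pos.2 hu0)).2 h
    rcases le_total 0 (unitVal u)⁻¹ with h0 | h0
    · refine ⟨u⁻¹, ?_, fun v => ?_⟩
      · rw [abs_of_nonneg h0] at hinv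
        have := unitVal_zpow u (-1)
        rw [zpow_neg_one, zpow_neg_one] at this
        rwa [this]
      · obtain ⟨n, hn⟩ := hall v
        exact ⟨-n, by simpa using hn⟩
    · refine ⟨-u⁻¹, ?_, fun v => ?_⟩
      · rw [abs_of_nonpos h0] at hinv
        have := unitVal_zpow u (-1)
        rw [zpow_neg_one, zpow_neg_one] at this
        rwa [unitVal_neg, this]
      · obtain ⟨n, hn⟩ := hall v
        refine ⟨-n, ?_⟩
        rcases Int.even_or_odd n with he | he
        · simpa [he.neg.neg_zpow] using hn
        · simpa [he.neg.neg_zpow] using hn.symm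
  · rcases le_total 0 (unitVal u) with h0 | h0
    · exact ⟨u, by rwa [abs_of_nonneg h0] at h, hall⟩
    · refine ⟨-u, ?_, fun v => ?_⟩
      · rwa [abs_of_nonpos h0, ← unitVal_neg] at h
      · obtain ⟨n, hn⟩ := hall v
        refine ⟨n, ?_⟩
        rcases Int.even_or_odd n with he | he
        · simpa [he.neg_zpow] using hn
        · simpa [he.neg_zpow] using hn.symm

theorem isFundamentalUnit_fundUnit (hd : ¬IsSquare d) : IsFundamentalUnit d (fundUnit d) :=
  Classical.epsilon_spec (exists_isFundamentalUnit hd)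

theorem one_lt_eps (hd : ¬IsSquare d) : 1 < eps d := (isFundamentalUnit_fundUnit hd).1

theorem eps_pos (hd : ¬IsSquare d) : 0 < eps d := one_pos.trans (one_lt_eps hd)

theorem isUnitOf_eps (d : ℕ) : IsUnitOf (sqrtField {d}) (eps d) := isUnitOf_unitVal _

theorem IsUnitOf.eq_eps_zpow (hd : ¬IsSquare d) {x : ℝ} (hx : IsUnitOf (sqrtField {d}) x) :
    ∃ n : ℤ, x = eps d ^ n ∨ x = -eps d ^ n := by
  obtain ⟨u, rfl⟩ := hx.exists_unitVal
  obtain ⟨n, h⟩ := (isFundamentalUnit_fundUnit hd).2 u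
  refine ⟨n, ?_⟩
  rw [eps, ← unitVal_zpow, ← unitVal_neg]
  exact h.imp (congrArg _) (congrArg _)

theorem sqrt_eps_notMem (hd : ¬IsSquare d) : √(eps d) ∉ sqrtField {d} := by
  intro h
  have h1 := one_lt_eps hd
  obtain ⟨n, hn⟩ := ((isUnitOf_eps d).sqrt (eps_pos hd).le h).eq_eps_zpow hd
  have h2 : eps d = eps d ^ (2 * n) := by
    have := Real.sq_sqrt (eps_pos hd).le
    rcases hn with hn | hn <;> rw [hn] at this <;> rw [mul_comm, zpow_mul] <;>
      simpa [neg_sq] using this.symm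
  have h3 : eps d ^ (1 : ℤ) = eps d ^ (2 * n) := by simpa using h2
  have := zpow_right_injective₀ (eps_pos hd) h1.ne' h3
  omega

theorem normEps_eq_or (d : ℕ) : normEps d = 1 ∨ normEps d = -1 := by
  have : NumberField (sqrtField {d}) := ⟨⟩
  have h := NumberField.isUnit_iff_norm.1 (fundUnit d).isUnit
  rcases eq_or_eq_neg_of_abs_eq h with h | h
  · exact Or.inl h
  · exact Or.inr h

/-- The coordinates of `ε_d`: half-integers whose norm form is `N(ε_d)`. -/
theorem exists_eps_eq (hd : ¬IsSquare d) (hsq : Squarefree d) :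
    ∃ T Y : ℤ, eps d = (T + Y * √(d : ℝ)) / 2 ∧ ((T : ℚ) ^ 2 - d * Y ^ 2 = 4 * normEps d) := by
  obtain ⟨σ, h1, hσ, h2⟩ := exists_conj hd
  have hd0 : √(d : ℝ) ≠ 0 := fun h => sqrt_notMem_bot hd (h ▸ zero_mem _)
  obtain ⟨a, b, hab⟩ := exists_rat_of_mem_sqrtField_singleton hd (isUnitOf_eps d).2.1
  have hs : Sends σ (eps d) (a - b * √(d : ℝ)) := by
    rw [hab]
    have := (Sends.ratCast σ a).add ((Sends.ratCast σ b).mul hσ)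
    rwa [mul_neg, ← sub_eq_add_neg] at this
  have hint : IsIntegral ℤ (a - b * √(d : ℝ)) := hs.isIntegral (isUnitOf_eps d).2.2.1
  have hint' : IsIntegral ℤ (a + b * √(d : ℝ)) := hab ▸ (isUnitOf_eps d).2.2.1
  have hnorm : ((normEps d : ℚ) : ℝ) = (a + b * √(d : ℝ)) * (a - b * √(d : ℝ)) := by
    rw [← hab, normEps, norm_eq_mul_conj h1 h2]
    obtain ⟨_, e⟩ := hs
    rw [← e]
    rfl
  have hsqrt : √(d : ℝ) ^ 2 = d := Real.sq_sqrt (Nat.cast_nonneg d)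
  have hnorm' : normEps d = a ^ 2 - d * b ^ 2 := by
    have : ((normEps d : ℚ) : ℝ) = ((a ^ 2 - d * b ^ 2 : ℚ) : ℝ) := by
      rw [hnorm]
      push_cast
      linear_combination -(b : ℝ) ^ 2 * hsqrt
    exact_mod_cast this
  obtain ⟨T, hT⟩ := exists_int_of_isIntegral (2 * a) (by
    rw [show ((2 * a : ℚ) : ℝ) = (a + b * √(d : ℝ)) + (a - b * √(d : ℝ)) by push_cast; ring]
    exact hint'.add hint)
  have hN : ∃ N : ℤ, normEps d = N := by
    rcases normEps_eq_or d with h | h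
    · exact ⟨1, by simp [h]⟩
    · exact ⟨-1, by simp [h]⟩
  obtain ⟨N, hN⟩ := hN
  have hY : ((2 * b) ^ 2 * d : ℚ) = (T ^ 2 - 4 * N : ℤ) := by
    push_cast
    rw [← hN, ← hT, hnorm']
    ring
  -- Since `(2b)² d` is an integer, the square of the denominator of `2b` divides the squarefree
  -- number `d`.
  have hY' : ∃ Y : ℤ, 2 * b = Y := by
    set c := 2 * b with hc
    have hden : c.num ^ 2 * d = (T ^ 2 - 4 * N) * (c.den : ℤ) ^ 2 := by
      have h0 : (c.den : ℚ) ≠ 0 := by exact_mod_cast c.den_ne_zero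
      have : (c.num : ℚ) ^ 2 * d = ((T ^ 2 - 4 * N : ℤ) : ℚ) * (c.den : ℚ) ^ 2 := by
        rw [← hY]
        nth_rewrite 2 [← Rat.num_div_den c]
        field_simp
      exact_mod_cast this
    have hdvd : (c.den : ℤ) ^ 2 ∣ (d : ℤ) := by
      have hcop : IsCoprime ((c.den : ℤ) ^ 2) (c.num ^ 2) := by
        refine IsCoprime.pow ?_
        rw [Int.isCoprime_iff_gcd_eq_one, Int.gcd_comm]
        exact c.reduced
      exact hcop.dvd_of_dvd_mul_left (Dvd.intro_left _ hden.symm)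
    have hone : c.den = 1 := by
      have : c.den * c.den ∣ d := by rw [← sq]; exact_mod_cast hdvd
      exact Nat.isUnit_iff.1 (hsq _ this)
    exact ⟨c.num, by rw [Rat.coe_int_num_of_den_eq_one hone]⟩
  obtain ⟨Y, hY'⟩ := hY'
  refine ⟨T, Y, ?_, ?_⟩
  · have h3 : (T : ℝ) = 2 * a := by exact_mod_cast hT.symm
    have h4 : (Y : ℝ) = 2 * b := by exact_mod_cast hY'.symm
    rw [hab, h3, h4]
    ring
  · rw [← hT, ← hY', hnorm']
    ring

end Quadratic

theorem Nat.Prime.not_isSquare_of_dvd_squarefree {d p : ℕ} (hsq : Squarefree d) (hp : p.Prime)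
    (hpd : p ∣ d) : ¬IsSquare d := by
  rintro ⟨a, rfl⟩
  have ha : a = 1 := Nat.isUnit_iff.1 (hsq a dvd_rfl)
  subst ha
  exact hp.one_lt.ne' (Nat.dvd_one.1 (by simpa using hpd))

/-! ### The square class of a unit of norm 1 -/

section

variable {d : ℕ}

theorem sends_eps_self {K : IntermediateField ℚ ℝ} {σ : K ≃ₐ[ℚ] K}
    (h : Sends σ √(d : ℝ) √(d : ℝ)) : Sends σ (eps d) (eps d) :=
  sends_of_sends_sqrt σ (S := {d}) (fun e he => by obtain rfl := he; exact h) _ (isUnitOf_eps d).2.1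

theorem eps_inv_eq (hd : ¬IsSquare d) {T Y : ℤ} (h : eps d = (T + Y * √(d : ℝ)) / 2)
    (hN : (T : ℚ) ^ 2 - d * Y ^ 2 = 4 * normEps d) :
    normEps d / eps d = (T - Y * √(d : ℝ)) / 2 := by
  rw [div_eq_iff (eps_pos hd).ne', h]
  have hsqrt : √(d : ℝ) ^ 2 = d := Real.sq_sqrt (Nat.cast_nonneg d)
  have hN' : (T : ℝ) ^ 2 - d * Y ^ 2 = 4 * (normEps d : ℚ) := by exact_mod_cast hN
  linear_combination (-1 / 4 : ℝ) * hN' + (Y : ℝ) ^ 2 / 4 * hsqrt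

theorem sends_eps_conj (hd : ¬IsSquare d) (hsq : Squarefree d) {K : IntermediateField ℚ ℝ}
    {σ : K ≃ₐ[ℚ] K} (h : Sends σ √(d : ℝ) (-√(d : ℝ))) :
    Sends σ (eps d) (normEps d / eps d) := by
  obtain ⟨T, Y, h1, h2⟩ := exists_eps_eq hd hsq
  rw [eps_inv_eq hd h1 h2, h1]
  have := ((Sends.intCast σ T).add ((Sends.intCast σ Y).mul h)).div (Sends.natCast σ 2)
  simpa [sub_eq_add_neg] using this

/-- `t` is the class of `ε_d` (of norm `1`) modulo squares. -/
structure IsSquareClass (d t : ℕ) : Prop where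
  squarefree : Squarefree t
  mem : √(t : ℝ) * √(eps d) ∈ sqrtField {d}
  notMem : √(t : ℝ) ∉ sqrtField {d}
  dvd : ∀ p : ℕ, p.Prime → p ≠ 2 → p ∣ t → p ∣ d
  coprime_sym : ∀ (p : ℕ) [Fact p.Prime], p ≠ 2 → p ∣ d → ¬p ∣ t → legendreSym p t = 1
  dvd_sym : ∀ (p : ℕ) [Fact p.Prime], p ≠ 2 → ∀ d' t' : ℕ, d = p * d' → t = p * t' →
    legendreSym p (-(d' * t')) = 1
  coeff : ∃ T Y m z : ℤ, eps d = (T + Y * √(d : ℝ)) / 2 ∧ T + 2 = t * m ^ 2 ∧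
    d * t * (T - 2) = z ^ 2

theorem legendreSym_eq_one_of_sq {p : ℕ} [Fact p.Prime] {a x y : ℤ} (hx : ¬(p : ℤ) ∣ x)
    (hy : ¬(p : ℤ) ∣ y) (h : (p : ℤ) ∣ a * x ^ 2 - y ^ 2) : legendreSym p a = 1 := by
  have hx' : (x : ZMod p) ≠ 0 := fun h0 => hx ((ZMod.intCast_zmod_eq_zero_iff_dvd _ _).1 h0)
  have hy' : (y : ZMod p) ≠ 0 := fun h0 => hy ((ZMod.intCast_zmod_eq_zero_iff_dvd _ _).1 h0)
  have h' : (a : ZMod p) * x ^ 2 = y ^ 2 := by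
    have := (ZMod.intCast_zmod_eq_zero_iff_dvd _ p).2 h
    push_cast at this
    exact sub_eq_zero.1 this
  have ha : (a : ZMod p) ≠ 0 := by
    intro h0
    rw [h0, zero_mul] at h'
    exact pow_ne_zero 2 hy' h'.symm
  rw [legendreSym.eq_one_iff p ha]
  refine ⟨y / x, ?_⟩
  field_simp
  exact h'

/-- With `T = ε + ε⁻¹` one has `(ε + 1)² = ε (T + 2)`, so the squarefree part `t` of `T + 2` is the
class sought. From `(T + 2)(T - 2) = dY²` it follows that `d t (T - 2)` is a square. The Legendre
symbol conditions come from reducing these two relations modulo odd primes. -/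
theorem exists_isSquareClass (hd : ¬IsSquare d) (hsq : Squarefree d) (hN : normEps d = 1) :
    ∃ t, IsSquareClass d t := by
  obtain ⟨T, Y, h1, h2⟩ := exists_eps_eq hd hsq
  have h3 := eps_inv_eq hd h1 h2
  rw [hN] at h2 h3
  have h2' : T ^ 2 - d * Y ^ 2 = 4 := by exact_mod_cast h2
  have he := one_lt_eps hd
  have he0 := eps_pos hd
  have hTsum : (T : ℝ) = eps d + 1 / eps d := by
    rw [show (1 : ℝ) / eps d = ((1 : ℚ) : ℝ) / eps d by simp, h3]
    nth_rewrite 1 [h1]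
    ring
  have hsqr : (eps d + 1) ^ 2 = eps d * (T + 2) := by
    rw [hTsum]
    field_simp
    ring
  have hTpos : 0 < T + 2 := by
    have : (0 : ℝ) < T + 2 := by rw [hTsum]; positivity
    exact_mod_cast this
  obtain ⟨t, m, htm, ht⟩ := Nat.sq_mul_squarefree (T + 2).toNat
  have hT2 : T + 2 = t * (m : ℤ) ^ 2 := by
    have := Int.toNat_of_nonneg hTpos.le
    rw [← htm] at this
    rw [← this]
    push_cast
    ring
  have hm0 : (m : ℤ) ≠ 0 := by
    rintro h0
    rw [h0] at hT2
    simp at hT2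
    omega
  obtain ⟨z, hz⟩ : (m : ℤ) ∣ d * Y := by
    rw [← Int.pow_dvd_pow_iff two_ne_zero]
    refine ⟨d * t * (T - 2), ?_⟩
    linear_combination -(d : ℤ) * h2' + d * (T - 2) * hT2
  have hz' : d * t * (T - 2) = z ^ 2 := by
    have : (m : ℤ) ^ 2 * (d * t * (T - 2)) = (m : ℤ) ^ 2 * z ^ 2 := by
      linear_combination (d : ℤ) * h2' - d * (T - 2) * hT2 + (d * Y + m * z) * hz
    exact mul_left_cancel₀ (pow_ne_zero 2 hm0) this
  have hmR : (m : ℝ) ≠ 0 := by exact_mod_cast hm0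
  have hroot : √(t : ℝ) * √(eps d) = (eps d + 1) / m := by
    rw [← Real.sqrt_mul (Nat.cast_nonneg t), Real.sqrt_eq_iff_mul_self_eq (by positivity)
      (by positivity)]
    have hT2' : (T : ℝ) + 2 = t * (m : ℝ) ^ 2 := by exact_mod_cast hT2
    rw [hT2'] at hsqr
    field_simp
    linear_combination -hsqr
  have hmem : √(t : ℝ) * √(eps d) ∈ sqrtField {d} := by
    rw [hroot]
    exact div_mem (add_mem (isUnitOf_eps d).2.1 (one_mem _)) (natCast_mem _ m)
  have hodd : ∀ p : ℕ, p.Prime → p ≠ 2 → ¬(p : ℤ) ∣ 2 := fun p hp h2 h => by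
    have : p ∣ 2 := by exact_mod_cast h
    exact h2 ((Nat.prime_dvd_prime_iff_eq hp Nat.prime_two).1 this)
  have hodd4 : ∀ p : ℕ, p.Prime → p ≠ 2 → ¬(p : ℤ) ∣ 4 := fun p hp h2 h =>
    hodd p hp h2 ((Nat.prime_iff_prime_int.1 hp).dvd_of_dvd_pow (n := 2) (by norm_num; exact h))
  have hsqf : ∀ {n : ℕ}, Squarefree n → ∀ p : ℕ, p.Prime → ∀ n' : ℕ, n = p * n' →
      ¬(p : ℤ) ∣ n' := fun hn p hp n' h hd => by
    have : p ∣ n' := by exact_mod_cast hd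
    exact hp.one_lt.ne' (Nat.isUnit_iff.1 (hn p (h ▸ mul_dvd_mul_left p this)))
  refine ⟨t, ht, hmem, ?_, ?_, ?_, ?_, ⟨T, Y, m, z, h1, hT2, hz'⟩⟩
  · intro hmem'
    have ht0 : √(t : ℝ) ≠ 0 := by
      have := ht.ne_zero
      positivity
    refine sqrt_eps_notMem hd ?_
    have := div_mem hmem hmem'
    rwa [mul_div_cancel_left₀ _ ht0] at this
  -- If an odd `p` divides `t` but not `d`, then `d t (T - 2) = z²` puts `p` into `T - 2` as well as
  -- `T + 2`, hence into 4.
  · intro p hp hp2 hpt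
    by_contra hpd
    have hpi := Nat.prime_iff_prime_int.1 hp
    obtain ⟨t', rfl⟩ := hpt
    have hpz : (p : ℤ) ∣ z := hpi.dvd_of_dvd_pow (n := 2) (by
      rw [← hz']; push_cast
      exact ⟨d * t' * (T - 2), by ring⟩)
    obtain ⟨z', rfl⟩ := hpz
    have e : d * t' * (T - 2) = p * z' ^ 2 := by
      have h0 : (p : ℤ) ≠ 0 := hpi.ne_zero
      apply mul_left_cancel₀ h0
      push_cast at hz'
      linear_combination hz'
    rcases hpi.dvd_or_dvd (Dvd.intro _ e.symm) with h | h
    · rcases hpi.dvd_or_dvd h with h | h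
      · exact hpd (by exact_mod_cast h)
      · exact hsqf ht p hp t' rfl h
    · refine hodd4 p hp hp2 ?_
      have : (4 : ℤ) = (T + 2) - (T - 2) := by ring
      rw [this]
      refine dvd_sub ?_ h
      rw [hT2]; push_cast
      exact ⟨t' * m ^ 2, by ring⟩
  -- Here `T ≡ 2` modulo `p`, so `t m² = T + 2 ≡ 4`.
  · intro p hp hp2 hpd hpt
    have hpi := Nat.prime_iff_prime_int.1 hp.out
    have hpt' : ¬(p : ℤ) ∣ t := fun h => hpt (by exact_mod_cast h)
    obtain ⟨d', hd'⟩ := hpd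
    have hpz : (p : ℤ) ∣ z := hpi.dvd_of_dvd_pow (n := 2) (by
      rw [← hz', hd']; push_cast
      exact ⟨d' * t * (T - 2), by ring⟩)
    obtain ⟨z', rfl⟩ := hpz
    have e : d' * t * (T - 2) = p * z' ^ 2 := by
      have h0 : (p : ℤ) ≠ 0 := hpi.ne_zero
      apply mul_left_cancel₀ h0
      rw [hd'] at hz'
      push_cast at hz'
      linear_combination hz'
    have hT : (p : ℤ) ∣ T - 2 := by
      rcases hpi.dvd_or_dvd (Dvd.intro _ e.symm) with h | h
      · rcases hpi.dvd_or_dvd h with h | h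
        · exact absurd h (hsqf hsq p hp.out d' hd')
        · exact absurd h hpt'
      · exact h
    have h4 : (p : ℤ) ∣ (t : ℤ) * (m : ℤ) ^ 2 - 2 ^ 2 := by
      rwa [← hT2, show T + 2 - 2 ^ 2 = T - 2 by ring]
    refine legendreSym_eq_one_of_sq (x := m) (y := 2) ?_ (hodd p hp.out hp2) h4
    intro h
    refine hodd4 p hp.out hp2 ?_
    have h5 : (p : ℤ) ∣ (t : ℤ) * (m : ℤ) ^ 2 := (dvd_pow h two_ne_zero).mul_left _
    have := dvd_sub h5 h4
    rwa [show (t : ℤ) * (m : ℤ) ^ 2 - (t * (m : ℤ) ^ 2 - 2 ^ 2) = 4 by ring] at this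
  -- Here `T ≡ -2` modulo `p`, so cancelling `p²` from `d t (T - 2) = z²` leaves `-4 d' t' ≡ z'²`.
  · intro p hp hp2 d' t' hd' ht'
    have hpi := Nat.prime_iff_prime_int.1 hp.out
    have h0 : (p : ℤ) ≠ 0 := hpi.ne_zero
    have hpz : (p : ℤ) ∣ z := hpi.dvd_of_dvd_pow (n := 2) (by
      rw [← hz', hd']; push_cast
      exact ⟨d' * t * (T - 2), by ring⟩)
    obtain ⟨z', rfl⟩ := hpz
    have e : d' * t' * (T - 2) = z' ^ 2 := by
      apply mul_left_cancel₀ (pow_ne_zero 2 h0)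
      rw [hd', ht'] at hz'
      push_cast at hz'
      linear_combination hz'
    have hT : (p : ℤ) ∣ T + 2 := by
      rw [hT2, ht']; push_cast
      exact ⟨t' * m ^ 2, by ring⟩
    have hdt : ¬(p : ℤ) ∣ d' * t' := fun h => by
      rcases hpi.dvd_or_dvd h with h | h
      · exact hsqf hsq p hp.out d' hd' h
      · exact hsqf ht p hp.out t' ht' h
    have h4 : (p : ℤ) ∣ -((d' : ℤ) * t') * 2 ^ 2 - z' ^ 2 := by
      rw [← e]
      have := hT.mul_left (-((d' : ℤ) * t'))
      rwa [show -((d' : ℤ) * t') * (T + 2) = -(d' * t') * 2 ^ 2 - d' * t' * (T - 2) by ring] at this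
    refine legendreSym_eq_one_of_sq (hodd p hp.out hp2) ?_ h4
    intro h
    have h5 := dvd_add h4 (dvd_pow h two_ne_zero)
    rw [sub_add_cancel, neg_mul, dvd_neg] at h5
    rcases hpi.dvd_or_dvd h5 with h | h
    · exact hdt h
    · exact hodd p hp.out hp2 (hpi.dvd_of_dvd_pow h)

/-- If a prime `q ≡ 3 mod 4` divides `d`, then `N(ε_d) = 1`. -/
theorem normEps_eq_one_of_dvd (hd : ¬IsSquare d) (hsq : Squarefree d) {q : ℕ} [hq : Fact q.Prime]
    (hq4 : q % 4 = 3) (hqd : q ∣ d) : normEps d = 1 := by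
  refine (normEps_eq_or d).resolve_right fun hN => ?_
  obtain ⟨T, Y, -, h2⟩ := exists_eps_eq hd hsq
  rw [hN] at h2
  have h2' : T ^ 2 - d * Y ^ 2 = -4 := by
    have : ((T ^ 2 - d * Y ^ 2 : ℤ) : ℚ) = ((-4 : ℤ) : ℚ) := by push_cast; rw [h2]; norm_num
    exact_mod_cast this
  obtain ⟨e, rfl⟩ := hqd
  have hq2 : q ≠ 2 := by omega
  have h4 : ((T : ZMod q)) ^ 2 = -4 := by
    have := congrArg (Int.cast : ℤ → ZMod q) h2'
    push_cast at this
    simpa using this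
  have h2ne : (2 : ZMod q) ≠ 0 := by
    intro h
    have : q ∣ 2 := (ZMod.natCast_eq_zero_iff 2 q).1 (by exact_mod_cast h)
    exact hq2 ((Nat.prime_dvd_prime_iff_eq hq.out Nat.prime_two).1 this)
  have : IsSquare (-1 : ZMod q) := ⟨T / 2, by field_simp; linear_combination -h4⟩
  exact (ZMod.exists_sq_eq_neg_one_iff.1 this) hq4

end

/-! ### Possible square classes for the primes 2, q, r, s -/

theorem Squarefree.exists_eq_pow_mul {t p : ℕ} (ht : Squarefree t) (hp : p.Prime) :
    ∃ i < 2, ∃ c, t = p ^ i * c ∧ ¬p ∣ c ∧ Squarefree c := by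
  by_cases h : p ∣ t
  · obtain ⟨c, rfl⟩ := h
    refine ⟨1, one_lt_two, c, by rw [pow_one], fun hc => ?_, ht.of_mul_right⟩
    exact hp.one_lt.ne' (Nat.isUnit_iff.1 (ht p (mul_dvd_mul_left p hc)))
  · exact ⟨0, two_pos, t, by simp, h, ht⟩

theorem Squarefree.exists_eq_prod_pow {t p₁ p₂ p₃ p₄ : ℕ} (ht : Squarefree t) (h₁ : p₁.Prime)
    (h₂ : p₂.Prime) (h₃ : p₃.Prime) (h₄ : p₄.Prime)
    (h : ∀ p : ℕ, p.Prime → p ∣ t → p = p₁ ∨ p = p₂ ∨ p = p₃ ∨ p = p₄) :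
    ∃ i < 2, ∃ j < 2, ∃ k < 2, ∃ l < 2, t = p₁ ^ i * p₂ ^ j * p₃ ^ k * p₄ ^ l := by
  obtain ⟨i, hi, c₁, rfl, n₁, s₁⟩ := ht.exists_eq_pow_mul h₁
  obtain ⟨j, hj, c₂, rfl, n₂, s₂⟩ := s₁.exists_eq_pow_mul h₂
  obtain ⟨k, hk, c₃, rfl, n₃, s₃⟩ := s₂.exists_eq_pow_mul h₃
  obtain ⟨l, hl, c₄, rfl, n₄, s₄⟩ := s₃.exists_eq_pow_mul h₄
  have hc : c₄ = 1 := by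
    by_contra hc
    obtain ⟨p, hp, hpc⟩ := Nat.exists_prime_and_dvd hc
    have hp3 : p ∣ p₄ ^ l * c₄ := hpc.mul_left _
    have hp2 : p ∣ p₃ ^ k * (p₄ ^ l * c₄) := hp3.mul_left _
    have hp1 : p ∣ p₂ ^ j * (p₃ ^ k * (p₄ ^ l * c₄)) := hp2.mul_left _
    rcases h p hp (hp1.mul_left _) with rfl | rfl | rfl | rfl
    exacts [n₁ hp1, n₂ hp2, n₃ hp3, n₄ hpc]
  refine ⟨i, hi, j, hj, k, hk, l, hl, ?_⟩
  rw [hc]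
  ring

theorem IsSquareClass.sym {d t p : ℕ} [hp : Fact p.Prime] (h : IsSquareClass d t) (hp2 : p ≠ 2)
    {k c d' : ℕ} (hk : k < 2) (hc : ¬p ∣ c) (ht : t = p ^ k * c) (hd : d = p * d') :
    (k = 0 ∧ legendreSym p c = 1) ∨
      (k = 1 ∧ legendreSym p (-1) * (legendreSym p d' * legendreSym p c) = 1) := by
  interval_cases k
  · rw [pow_zero, one_mul] at ht
    exact Or.inl ⟨rfl, ht ▸ h.coprime_sym p hp2 ⟨d', hd⟩ (ht ▸ hc)⟩
  · rw [pow_one] at ht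
    refine Or.inr ⟨rfl, ?_⟩
    have := h.dvd_sym p hp2 d' c hd ht
    rwa [← neg_one_mul, legendreSym.mul, legendreSym.mul] at this

theorem IsSquareClass.ne_one {d t : ℕ} (h : IsSquareClass d t) : t ≠ 1 := by
  rintro rfl
  exact h.notMem (by simp)

theorem IsSquareClass.ne_self {d t : ℕ} (h : IsSquareClass d t) : t ≠ d := by
  rintro rfl
  exact h.notMem (sqrt_mem_singleton _)

theorem IsSquareClass.prime_dvd {d t : ℕ} (h : IsSquareClass d t) {p : ℕ} (hp : p.Prime)
    (hpt : p ∣ t) : p = 2 ∨ p ∣ d :=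
  or_iff_not_imp_left.2 fun h2 => h.dvd p hp h2 hpt

/-- The arithmetic hypotheses on the primes `q`, `r`, `s`, where `χ` is the common value of the
Legendre symbols `(q/r)` and `(q/s)`. -/
structure PrimeData (q r s : ℕ) [Fact q.Prime] [Fact r.Prime] [Fact s.Prime] (χ : ℤ) : Prop where
  hq : q % 4 = 3
  hr : r % 8 = 5
  hs : s % 8 = 5
  chi : χ = 1 ∨ χ = -1
  qr : legendreSym r q = χ
  qs : legendreSym s q = χ
  rs : legendreSym s r = 1

theorem legendreSym_two_of_mod_eight {r : ℕ} [Fact r.Prime] (hr : r % 8 = 5) :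
    legendreSym r 2 = -1 := by
  rw [legendreSym.at_two (by omega), ZMod.χ₈_nat_eq_if_mod_eight]
  rw [if_neg (by omega), if_neg (by omega)]

theorem legendreSym_neg_one_of_mod_four {r : ℕ} [Fact r.Prime] (hr : r % 4 = 1) :
    legendreSym r (-1) = 1 := by
  rw [legendreSym.at_neg_one (by omega), ZMod.χ₄_nat_one_mod_four hr]

theorem not_dvd_pow_mul_pow_mul_pow {p a b c : ℕ} (hp : p.Prime) (ha : a.Prime) (hb : b.Prime)
    (hc : c.Prime) (h1 : p ≠ a) (h2 : p ≠ b) (h3 : p ≠ c) (i j k : ℕ) :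
    ¬p ∣ a ^ i * b ^ j * c ^ k := by
  intro h
  rcases hp.dvd_mul.1 h with h | h
  · rcases hp.dvd_mul.1 h with h | h
    · exact h1 ((Nat.prime_dvd_prime_iff_eq hp ha).1 (hp.dvd_of_dvd_pow h))
    · exact h2 ((Nat.prime_dvd_prime_iff_eq hp hb).1 (hp.dvd_of_dvd_pow h))
  · exact h3 ((Nat.prime_dvd_prime_iff_eq hp hc).1 (hp.dvd_of_dvd_pow h))

namespace PrimeData

variable {q r s : ℕ} [hqp : Fact q.Prime] [hrp : Fact r.Prime] [hsp : Fact s.Prime] {χ : ℤ}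

theorem q_ne_two (D : PrimeData q r s χ) : q ≠ 2 := by have := D.hq; omega
theorem r_ne_two (D : PrimeData q r s χ) : r ≠ 2 := by have := D.hr; omega
theorem s_ne_two (D : PrimeData q r s χ) : s ≠ 2 := by have := D.hs; omega
theorem q_ne_r (D : PrimeData q r s χ) : q ≠ r := by have := D.hr; have := D.hq; omega
theorem q_ne_s (D : PrimeData q r s χ) : q ≠ s := by have := D.hs; have := D.hq; omega
theorem r_ne_s (D : PrimeData q r s χ) : r ≠ s := by
  intro h
  have h1 := D.rs
  have : legendreSym s (r : ℤ) = 0 := by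
    rw [legendreSym.eq_zero_iff, h]
    simp
  omega

theorem sr (D : PrimeData q r s χ) : legendreSym r s = 1 := by
  have := D.hs
  rw [legendreSym.quadratic_reciprocity_one_mod_four (by omega) D.r_ne_two, D.rs]

theorem rq (D : PrimeData q r s χ) : legendreSym q r = χ := by
  have := D.hr
  rw [legendreSym.quadratic_reciprocity_one_mod_four (by omega) D.q_ne_two, D.qr]

theorem sq (D : PrimeData q r s χ) : legendreSym q s = χ := by
  have := D.hs
  rw [legendreSym.quadratic_reciprocity_one_mod_four (by omega) D.q_ne_two, D.qs]

theorem neg_one_q (D : PrimeData q r s χ) : legendreSym q (-1) = -1 := by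
  rw [legendreSym.at_neg_one D.q_ne_two, ZMod.χ₄_nat_three_mod_four D.hq]

theorem two_q (D : PrimeData q r s χ) : legendreSym q 2 = 1 ∨ legendreSym q 2 = -1 := by
  refine legendreSym.eq_one_or_neg_one q fun h => ?_
  have h' : q ∣ 2 := (ZMod.natCast_eq_zero_iff 2 q).1 (by exact_mod_cast h)
  exact D.q_ne_two ((Nat.prime_dvd_prime_iff_eq hqp.out Nat.prime_two).1 h')

theorem symm (D : PrimeData q r s χ) : PrimeData q s r χ :=
  ⟨D.hq, D.hs, D.hr, D.chi, D.qs, D.qr, D.sr⟩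

/-- The conditions at `r` for the class `t = 2^i q^j r^k s^l` of `ε_d`, `d = 2^a q^b r s`. -/
theorem cond_r (D : PrimeData q r s χ) {a b i j k l t : ℕ} (hk : k < 2)
    (h : IsSquareClass (2 ^ a * q ^ b * r * s) t) (ht : t = 2 ^ i * q ^ j * r ^ k * s ^ l) :
    (k = 0 ∧ (-1) ^ i * χ ^ j = 1) ∨ (k = 1 ∧ (-1) ^ a * χ ^ b * ((-1) ^ i * χ ^ j) = 1) := by
  have hr4 : r % 4 = 1 := by have := D.hr; omega
  have := h.sym (p := r) (k := k) (c := 2 ^ i * q ^ j * s ^ l) (d' := 2 ^ a * q ^ b * s)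
    D.r_ne_two hk (not_dvd_pow_mul_pow_mul_pow hrp.out Nat.prime_two hqp.out hsp.out D.r_ne_two
      D.q_ne_r.symm D.r_ne_s i j l) (by rw [ht]; ring) (by ring)
  have hpow : ∀ (x : ℤ) (n : ℕ), legendreSym r (x ^ n) = legendreSym r x ^ n :=
    fun x n => map_pow (legendreSym.hom r) x n
  push_cast at this
  simpa only [legendreSym.mul, hpow, legendreSym_two_of_mod_eight D.hr, D.qr, D.sr,
    legendreSym_neg_one_of_mod_four hr4, one_pow, mul_one, one_mul] using this

theorem cond_s (D : PrimeData q r s χ) {a b i j k l t : ℕ} (hl : l < 2)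
    (h : IsSquareClass (2 ^ a * q ^ b * r * s) t) (ht : t = 2 ^ i * q ^ j * r ^ k * s ^ l) :
    (l = 0 ∧ (-1) ^ i * χ ^ j = 1) ∨ (l = 1 ∧ (-1) ^ a * χ ^ b * ((-1) ^ i * χ ^ j) = 1) := by
  refine D.symm.cond_r (b := b) (a := a) (t := t) (l := k) hl ?_ (by rw [ht]; ring)
  rwa [mul_right_comm _ s r]

theorem cond_q (D : PrimeData q r s χ) {a i j k l t : ℕ} (hj : j < 2)
    (h : IsSquareClass (2 ^ a * q * r * s) t) (ht : t = 2 ^ i * q ^ j * r ^ k * s ^ l) :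
    (j = 0 ∧ legendreSym q 2 ^ i * χ ^ k * χ ^ l = 1) ∨
      (j = 1 ∧ -(legendreSym q 2 ^ a * χ * χ * (legendreSym q 2 ^ i * χ ^ k * χ ^ l)) = 1) := by
  have := h.sym (p := q) (k := j) (c := 2 ^ i * r ^ k * s ^ l) (d' := 2 ^ a * r * s)
    D.q_ne_two hj (not_dvd_pow_mul_pow_mul_pow hqp.out Nat.prime_two hrp.out hsp.out D.q_ne_two
      D.q_ne_r D.q_ne_s i k l) (by rw [ht]; ring) (by ring)
  have hpow : ∀ (x : ℤ) (n : ℕ), legendreSym q (x ^ n) = legendreSym q x ^ n :=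
    fun x n => map_pow (legendreSym.hom q) x n
  push_cast at this
  simpa only [legendreSym.mul, hpow, D.rq, D.sq, D.neg_one_q, neg_one_mul] using this

theorem squarefree (D : PrimeData q r s χ) {a b c e : ℕ} (ha : a < 2) (hb : b < 2) (hc : c < 2)
    (he : e < 2) : Squarefree (2 ^ a * q ^ b * r ^ c * s ^ e) := by
  have hone : ∀ {p n : ℕ}, p.Prime → n < 2 → Squarefree (p ^ n) := by
    intro p n hp hn
    interval_cases n
    · simp
    · simpa using hp.prime.squarefree
  have cop : ∀ {p p' : ℕ} (n n' : ℕ), p.Prime → p'.Prime → p ≠ p' → Nat.Coprime (p ^ n) (p' ^ n') :=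
    fun n n' hp hp' h => Nat.Coprime.pow n n' ((Nat.coprime_primes hp hp').2 h)
  have h2q := cop a b Nat.prime_two hqp.out D.q_ne_two.symm
  have h2r := cop a c Nat.prime_two hrp.out D.r_ne_two.symm
  have h2s := cop a e Nat.prime_two hsp.out D.s_ne_two.symm
  have hqr := cop b c hqp.out hrp.out D.q_ne_r
  have hqs := cop b e hqp.out hsp.out D.q_ne_s
  have hrs := cop c e hrp.out hsp.out D.r_ne_s
  rw [Nat.squarefree_mul ((h2s.mul_left hqs).mul_left hrs),
    Nat.squarefree_mul (h2r.mul_left hqr), Nat.squarefree_mul h2q]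
  exact ⟨⟨⟨hone Nat.prime_two ha, hone hqp.out hb⟩, hone hrp.out hc⟩, hone hsp.out he⟩

theorem exists_form (_ : PrimeData q r s χ) {a b c e t : ℕ}
    (h : IsSquareClass (2 ^ a * q ^ b * r ^ c * s ^ e) t) :
    ∃ i < 2, ∃ j < 2, ∃ k < 2, ∃ l < 2, t = 2 ^ i * q ^ j * r ^ k * s ^ l := by
  refine h.squarefree.exists_eq_prod_pow Nat.prime_two hqp.out hrp.out hsp.out fun p hp hpt => ?_
  rcases h.prime_dvd hp hpt with h | h
  · exact Or.inl h
  · by_contra! hne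
    rcases hp.dvd_mul.1 h with h | h
    · exact not_dvd_pow_mul_pow_mul_pow hp Nat.prime_two hqp.out hrp.out hne.1 hne.2.1 hne.2.2.1
        _ _ _ h
    · exact hne.2.2.2 ((Nat.prime_dvd_prime_iff_eq hp hsp.out).1 (hp.dvd_of_dvd_pow h))

end PrimeData

theorem int_coeff_unique {d : ℕ} (hd : ¬IsSquare d) {a b c e : ℤ}
    (h : (a : ℝ) + b * √(d : ℝ) = c + e * √(d : ℝ)) : a = c := by
  by_cases hbe : b = e
  · subst hbe
    exact_mod_cast add_right_cancel h
  · exfalso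
    have hne : ((b : ℝ) - e) ≠ 0 := sub_ne_zero.2 (by exact_mod_cast hbe)
    have : √(d : ℝ) = (((c - a : ℤ) / (b - e : ℤ) : ℚ) : ℝ) := by
      push_cast
      rw [eq_div_iff hne]
      linear_combination h
    exact irrational_sqrt_natCast_iff.2 hd ⟨_, this.symm⟩

namespace PrimeData

variable {q r s : ℕ} [hqp : Fact q.Prime] [hrp : Fact r.Prime] [hsp : Fact s.Prime] {χ : ℤ}

/-- The case `(2^a q / r) = (2^a q / s) = -1`. The symbol of `2^i q^j` is the same at `r` and at
`s`. At each of them it is 1 or -1 according as the prime is absent from `t` or divides it, so `r`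
and `s` divide `t` together. -/
theorem class_eq_of_sign_neg (D : PrimeData q r s χ) {a i j k l t : ℕ} (hk : k < 2) (hl : l < 2)
    (h : IsSquareClass (2 ^ a * q * r * s) t) (ht : t = 2 ^ i * q ^ j * r ^ k * s ^ l)
    (hsign : (-1) ^ a * χ = -1) : k = l := by
  have h' : IsSquareClass (2 ^ a * q ^ 1 * r * s) t := by simpa using h
  have h1 := D.cond_r hk h' ht
  have h2 := D.cond_s hl h' ht
  rw [pow_one, hsign] at h1 h2
  rcases h1 with ⟨rfl, h1⟩ | ⟨rfl, h1⟩ <;> rcases h2 with ⟨rfl, h2⟩ | ⟨rfl, h2⟩ <;>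
    first | rfl | (rw [h1] at h2; norm_num at h2) | (rw [h2] at h1; norm_num at h1)

/-- The case `(2^a q / r) = (2^a q / s) = 1`. If `k = l`, the conditions at `r` leave only the
classes `1`, `2^a q`, `rs` and `d`. The first and last are trivial in `ℚ(√d)`, the second fails at
`q`, and `rs` is excluded by assumption. -/
theorem class_ne_of_sign_pos (D : PrimeData q r s χ) {a i j k l t : ℕ} (ha : a < 2) (hi : i < 2)
    (hj : j < 2) (hk : k < 2) (h : IsSquareClass (2 ^ a * q * r * s) t)
    (ht : t = 2 ^ i * q ^ j * r ^ k * s ^ l) (hsign : (-1) ^ a * χ = 1) (hrs : t ≠ r * s) :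
    k ≠ l := by
  rintro rfl
  have h' : IsSquareClass (2 ^ a * q ^ 1 * r * s) t := by simpa using h
  have h1 := D.cond_r hk h' ht
  rw [pow_one, hsign, one_mul] at h1
  have hE : (-1) ^ i * χ ^ j = 1 := by rcases h1 with h1 | h1 <;> exact h1.2
  -- The sign condition reads `χ = (-1)^a`, so `(-1)^i χ^j = 1` says `i ≡ aj` modulo 2.
  have hij : i = a * j := by
    rcases D.chi with hχ | hχ <;> subst hχ <;> interval_cases a <;> interval_cases i <;>
      interval_cases j <;> simp_all
  have h2 := D.cond_q hj h ht
  have hne1 := h.ne_one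
  have hned := h.ne_self
  interval_cases k
  · interval_cases j
    · simp [hij] at ht
      exact hne1 ht
    -- The candidate `t = 2^a q`: the condition at `q` asks that `-rs` times a square be a residue,
    -- but `(rs/q) = χ² = 1` and `(-1/q) = -1`.
    · rw [mul_one] at hij
      subst hij
      have hχ2 : χ * χ = 1 := by rcases D.chi with h | h <;> rw [h] <;> norm_num
      have h22 : legendreSym q 2 * legendreSym q 2 = 1 := by
        rcases D.two_q with h | h <;> rw [h] <;> norm_num
      rcases h2 with h2 | h2
      · omega
      · have : (legendreSym q 2 ^ i * legendreSym q 2 ^ i) = 1 := by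
          rw [← mul_pow, h22, one_pow]
        have h3 : -(legendreSym q 2 ^ i * legendreSym q 2 ^ i * (χ * χ)) = 1 := by
          rw [← h2.2]; ring
        rw [this, hχ2] at h3
        norm_num at h3
  · interval_cases j
    · simp [hij] at ht
      exact hrs ht
    · rw [mul_one] at hij
      subst hij
      exact hned (by rw [ht]; ring)

theorem q_exp_eq_zero (D : PrimeData q r s χ) {a i j k l t : ℕ} (hj : j < 2)
    (h : IsSquareClass (2 ^ a * q ^ 0 * r * s) t) (ht : t = 2 ^ i * q ^ j * r ^ k * s ^ l) :
    j = 0 := by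
  interval_cases j
  · rfl
  exfalso
  have hq : q ∣ t := ⟨2 ^ i * r ^ k * s ^ l, by rw [ht]; ring⟩
  have h1 := h.dvd q hqp.out D.q_ne_two hq
  refine not_dvd_pow_mul_pow_mul_pow hqp.out Nat.prime_two hrp.out hsp.out D.q_ne_two
      D.q_ne_r D.q_ne_s a 1 1 ?_
  simpa using h1

/-- For `d = rs` the prime `q` cannot occur, and `(2/r) = -1` excludes the factor 2. Only `r` and
`s` survive, since `1` and `rs` are trivial classes. -/
theorem class_rs_ne (D : PrimeData q r s χ) {i j k l t : ℕ} (hi : i < 2) (hj : j < 2) (hk : k < 2)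
    (h : IsSquareClass (r * s) t) (ht : t = 2 ^ i * q ^ j * r ^ k * s ^ l) : j = 0 ∧ k ≠ l := by
  have h' : IsSquareClass (2 ^ 0 * q ^ 0 * r * s) t := by simpa using h
  have hj0 := D.q_exp_eq_zero hj h' ht
  refine ⟨hj0, ?_⟩
  rintro rfl
  have h1 := D.cond_r hk h' ht
  subst hj0
  have hi0 : i = 0 := by
    interval_cases i
    · rfl
    · simp at h1
  subst hi0
  interval_cases k
  · exact h.ne_one (by simpa using ht)
  · exact h.ne_self (by simpa using ht)

/-- Because `(2/r) = (2/s) = -1`, the conditions at `r` and `s` tie both exponents to that of 2.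
Only the trivial classes `1` and `2rs` remain, so `ε_{2rs}` cannot have norm 1. -/
theorem not_class_two_rs (D : PrimeData q r s χ) {t : ℕ} : ¬IsSquareClass (2 * r * s) t := by
  intro h
  have h' : IsSquareClass (2 ^ 1 * q ^ 0 * r * s) t := by simpa using h
  obtain ⟨i, hi, j, hj, k, hk, l, hl, ht⟩ := D.exists_form (a := 1) (b := 0) (c := 1) (e := 1)
    (by simpa using h)
  have hj0 := D.q_exp_eq_zero hj h' ht
  subst hj0
  have h1 := D.cond_r hk h' ht
  have h2 := D.cond_s hl h' ht
  rcases h1 with ⟨rfl, h1⟩ | ⟨rfl, h1⟩ <;> rcases h2 with ⟨rfl, h2⟩ | ⟨rfl, h2⟩ <;>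
    interval_cases i <;> simp at h1 h2
  · exact h.ne_one (by simpa using ht)
  · exact h.ne_self (by simpa using ht)

theorem class_q_or (_ : PrimeData q r s χ) {a t : ℕ} (h : IsSquareClass (2 ^ a * q) t) :
    t = 2 ∨ t = q ∨ t = 2 * q := by
  obtain ⟨i, hi, c, hc, hc2, hsq⟩ := h.squarefree.exists_eq_pow_mul Nat.prime_two
  obtain ⟨j, hj, e, he, hqe, hsq'⟩ := hsq.exists_eq_pow_mul hqp.out
  have he1 : e = 1 := by
    by_contra hne
    obtain ⟨p, hp, hpe⟩ := Nat.exists_prime_and_dvd hne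
    have hpt : p ∣ t := by rw [hc, he]; exact (hpe.mul_left _).mul_left _
    rcases h.prime_dvd hp hpt with h2 | h2
    · subst h2
      exact absurd (he ▸ hpe.mul_left _) hc2
    · rcases hp.dvd_mul.1 h2 with h2 | h2
      · have := (Nat.prime_dvd_prime_iff_eq hp Nat.prime_two).1 (hp.dvd_of_dvd_pow h2)
        subst this
        exact absurd (he ▸ hpe.mul_left _) hc2
      · rw [(Nat.prime_dvd_prime_iff_eq hp hqp.out).1 h2] at hpe
        exact hqe hpe
  subst he1 he hc
  have h1 := h.ne_one
  interval_cases i <;> interval_cases j <;> simp at h1 ⊢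

theorem class_q (D : PrimeData q r s χ) {t : ℕ} (h : IsSquareClass q t) : t = 2 ∨ t = 2 * q := by
  have h1 := D.class_q_or (a := 0) (t := t) (by simpa using h)
  have h2 := h.ne_self
  tauto

theorem class_two_q (D : PrimeData q r s χ) {t : ℕ} (h : IsSquareClass (2 * q) t) :
    t = 2 ∨ t = q := by
  have h1 := D.class_q_or (a := 1) (t := t) (by simpa using h)
  have h2 := h.ne_self
  tauto

end PrimeData

/-- The class `t = rs` is what the assumption on `γ` rules out. Here `T = 2γ`, and cancelling
`(rs)²` from `d t (T - 2) = z²` makes `2^a q · 2(γ - 1)` a square. For `a = 1` a further factor 4 is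
removed. -/
theorem exists_sq_of_isSquareClass_mul {a q r s : ℕ} (ha : a < 2) (hr : r ≠ 0) (hs : s ≠ 0)
    (hd : ¬IsSquare (2 ^ a * q * r * s)) (h : IsSquareClass (2 ^ a * q * r * s) (r * s))
    {γ γ' : ℤ} (hγ : eps (2 ^ a * q * r * s) = γ + γ' * √((2 ^ a * q * r * s : ℕ) : ℝ)) :
    ∃ n : ℕ, (2 : ℤ) ^ (1 - a) * q * (γ - 1) = (n : ℤ) ^ 2 := by
  obtain ⟨T, Y, m, z, h1, h2, h3⟩ := h.coeff
  have hT : T = 2 * γ := by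
    refine int_coeff_unique hd (b := Y) (e := 2 * γ') ?_
    have := h1.symm.trans hγ
    push_cast
    push_cast at this
    linear_combination 2 * this
  have h0 : ((r * s : ℕ) : ℤ) ≠ 0 := by
    positivity
  subst hT
  have hd' : ((2 ^ a * q * r * s : ℕ) : ℤ) = 2 ^ a * q * (r * s : ℕ) := by push_cast; ring
  rw [hd'] at h3
  obtain ⟨z', rfl⟩ : ((r * s : ℕ) : ℤ) ∣ z := by
    rw [← Int.pow_dvd_pow_iff two_ne_zero, ← h3]
    exact ⟨2 ^ a * q * (2 * γ - 2), by ring⟩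
  have h4 : 2 ^ a * q * (2 * γ - 2) = z' ^ 2 := by
    apply mul_left_cancel₀ (pow_ne_zero 2 h0)
    linear_combination h3
  interval_cases a
  · exact ⟨z'.natAbs, by rw [Int.natCast_natAbs, sq_abs, ← h4]; ring⟩
  · obtain ⟨w, rfl⟩ : (2 : ℤ) ∣ z' := by
      rw [← Int.pow_dvd_pow_iff two_ne_zero, ← h4]
      exact ⟨q * (γ - 1), by ring⟩
    exact ⟨w.natAbs, by rw [Int.natCast_natAbs, sq_abs, Nat.sub_self, pow_zero]; linarith⟩

/-! ### Square roots of natural numbers in multiquadratic fields -/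

theorem even_factorization_of_isSquare {n : ℕ} (h : IsSquare n) (p : ℕ) :
    Even (n.factorization p) := by
  obtain ⟨a, rfl⟩ := h
  rcases eq_or_ne a 0 with rfl | ha
  · simp
  · rw [Nat.factorization_mul ha ha]
    exact ⟨_, rfl⟩

theorem even_of_isSquare_pow_mul {p i c : ℕ} (hp : p.Prime) (hc : ¬p ∣ c)
    (h : IsSquare (p ^ i * c)) : Even i := by
  have h1 := even_factorization_of_isSquare h p
  have hc0 : c ≠ 0 := fun h0 => hc (h0 ▸ dvd_zero p)
  rwa [Nat.factorization_mul (pow_ne_zero _ hp.ne_zero) hc0, Finsupp.add_apply,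
    hp.factorization_pow, Finsupp.single_eq_same, Nat.factorization_eq_zero_of_not_dvd hc,
    add_zero] at h1

theorem exists_isSquare_of_sqrt_mem {x y z a : ℕ} (h : √(a : ℝ) ∈ sqrtField {x, y, z}) :
    ∃ i < 2, ∃ j < 2, ∃ k < 2, IsSquare (a * x ^ i * y ^ j * z ^ k) := by
  have step : ∀ {S : Set ℕ} [Finite S] {m a : ℕ}, √(a : ℝ) ∈ sqrtField (insert m S) →
      ∃ i < 2, √((a * m ^ i : ℕ) : ℝ) ∈ sqrtField S := by
    intro S _ m a h
    rcases sqrt_mem_or_of_mem_insert h with h | h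
    · exact ⟨0, two_pos, by simpa using h⟩
    · exact ⟨1, one_lt_two, by simpa using h⟩
  obtain ⟨i, hi, h1⟩ := step h
  obtain ⟨j, hj, h2⟩ := step h1
  have hz : ({z} : Set ℕ) = insert z ∅ := by simp
  rw [hz] at h2
  obtain ⟨k, hk, h3⟩ := step h2
  exact ⟨i, hi, j, hj, k, hk, sqrt_natCast_mem_sqrtField_empty h3⟩

theorem sqrt_mem_of_prod_form {L : IntermediateField ℚ ℝ} {x y : ℕ} (hx : √(x : ℝ) ∈ L)
    (hy : √(y : ℝ) ∈ L) : √((x * y : ℕ) : ℝ) ∈ L := by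
  rw [Nat.cast_mul, Real.sqrt_mul (Nat.cast_nonneg x)]
  exact mul_mem hx hy

theorem sqrt_pow_mem {L : IntermediateField ℚ ℝ} {x : ℕ} (hx : √(x : ℝ) ∈ L) (n : ℕ) :
    √((x ^ n : ℕ) : ℝ) ∈ L := by
  induction n with
  | zero => simp
  | succ n ih => rw [pow_succ]; exact sqrt_mem_of_prod_form ih hx

theorem sqrt_natCast_mul (x y : ℕ) : √((x * y : ℕ) : ℝ) = √(x : ℝ) * √(y : ℝ) := by
  rw [Nat.cast_mul, Real.sqrt_mul (Nat.cast_nonneg x)]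

/-! ### Triquadratic fields and relative norms -/

section Triquadratic

/-- The square roots `√x`, `√y`, `√z` are independent modulo squares. -/
structure IndepRoots (x y z : ℕ) : Prop where
  isSquare : ∀ i < 2, ∀ j < 2, ∀ k < 2, IsSquare (x ^ i * y ^ j * z ^ k) → i = 0 ∧ j = 0 ∧ k = 0

variable {x y z : ℕ}

theorem IndepRoots.rotate (h : IndepRoots x y z) : IndepRoots y z x :=
  ⟨fun i hi j hj k hk hs => by
    have := h.isSquare k hk i hi j hj (by rwa [mul_assoc, mul_comm])
    exact ⟨this.2.1, this.2.2, this.1⟩⟩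

theorem IndepRoots.notMem (h : IndepRoots x y z) : √(x : ℝ) ∉ sqrtField {y, z} := by
  intro hm
  -- Listing `y` twice makes the three-generator criterion applicable to `{y, z}`. The two exponents
  -- of `y` are then merged modulo 2.
  have hm' : √(x : ℝ) ∈ sqrtField {y, y, z} := by
    rwa [Set.insert_eq_of_mem (Set.mem_insert y _)]
  obtain ⟨i, hi, j, hj, k, hk, hs⟩ := exists_isSquare_of_sqrt_mem hm'
  have : ∃ e < 2, IsSquare (x ^ 1 * y ^ e * z ^ k) := by
    interval_cases i
    · exact ⟨j, hj, by simpa using hs⟩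
    · interval_cases j
      · exact ⟨1, one_lt_two, by simpa using hs⟩
      · refine ⟨0, two_pos, ?_⟩
        obtain ⟨c, hc⟩ := hs
        simp only [pow_one, pow_zero, mul_one] at hc ⊢
        have hy : y ∣ c := by
          rw [← Nat.pow_dvd_pow_iff two_ne_zero, sq c, ← hc]
          exact ⟨x * z ^ k, by ring⟩
        obtain ⟨c', rfl⟩ := hy
        rcases eq_or_ne y 0 with rfl | hy0
        · have := h.isSquare 0 two_pos 1 one_lt_two 0 two_pos (by simp)
          omega
        · refine ⟨c', mul_left_cancel₀ (pow_ne_zero 2 hy0) ?_⟩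
          linarith [hc]
  obtain ⟨e, he, hs⟩ := this
  exact absurd (h.isSquare 1 one_lt_two e he k hk hs).1 one_ne_zero

theorem IndepRoots.exists_flip (h : IndepRoots x y z) {L : IntermediateField ℚ ℝ}
    (hL : L = sqrtField {x, y, z}) (u : ℝ) (hu : u = 1 ∨ u = -1) :
    ∃ σ : L ≃ₐ[ℚ] L, Sends σ √(x : ℝ) (u * √(x : ℝ)) ∧ Sends σ √(y : ℝ) √(y : ℝ) ∧
      Sends σ √(z : ℝ) √(z : ℝ) := by
  subst hL
  have hx : √(x : ℝ) ∈ sqrtField {x, y, z} := sqrt_mem_sqrtField (by simp)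
  rcases hu with rfl | rfl
  · exact ⟨1, ⟨hx, (one_mul _).symm⟩, ⟨sqrt_mem_sqrtField (by simp), rfl⟩,
      ⟨sqrt_mem_sqrtField (by simp), rfl⟩⟩
  · obtain ⟨σ, h1, h2⟩ := exists_sends_neg (K := sqrtField {x, y, z})
      (sqrtField_mono (Set.subset_insert x _)) (Nat.cast_nonneg x) (natCast_mem _ x) hx h.notMem
    exact ⟨σ, by simpa using h2, h1 _ (sqrt_mem_sqrtField (by simp)),
      h1 _ (sqrt_mem_sqrtField (by simp))⟩

theorem IndepRoots.exists_aut (h : IndepRoots x y z) {u v w : ℝ} (hu : u = 1 ∨ u = -1)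
    (hv : v = 1 ∨ v = -1) (hw : w = 1 ∨ w = -1) :
    ∃ σ : sqrtField {x, y, z} ≃ₐ[ℚ] sqrtField {x, y, z}, Sends σ √(x : ℝ) (u * √(x : ℝ)) ∧
      Sends σ √(y : ℝ) (v * √(y : ℝ)) ∧ Sends σ √(z : ℝ) (w * √(z : ℝ)) := by
  have e1 : sqrtField {x, y, z} = sqrtField {y, z, x} := by
    congr 1; ext; simp; tauto
  have e2 : sqrtField {x, y, z} = sqrtField {z, x, y} := by
    congr 1; ext; simp; tauto
  obtain ⟨a, ax, ay, az⟩ := h.exists_flip rfl u hu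
  obtain ⟨b, bY, bz, bx⟩ := h.rotate.exists_flip e1 v hv
  obtain ⟨c, cz, cx, cy⟩ := h.rotate.rotate.exists_flip e2 w hw
  have key : ∀ {σ : sqrtField {x, y, z} ≃ₐ[ℚ] sqrtField {x, y, z}} {e m : ℝ},
      (e = 1 ∨ e = -1) → Sends σ m m → Sends σ (e * m) (e * m) := by
    rintro σ e m (rfl | rfl) hm
    · simpa using hm
    · simpa using hm.neg
  exact ⟨c * (b * a), (ax.mul_aut (key hu bx)).mul_aut (key hu cx),
    (ay.mul_aut bY).mul_aut (key hv cy), (az.mul_aut bz).mul_aut cz⟩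

theorem aut_eq_one {σ : sqrtField {x, y, z} ≃ₐ[ℚ] sqrtField {x, y, z}}
    (hx : Sends σ √(x : ℝ) √(x : ℝ)) (hy : Sends σ √(y : ℝ) √(y : ℝ))
    (hz : Sends σ √(z : ℝ) √(z : ℝ)) : σ = 1 := by
  refine aut_ext fun d hd => ⟨√(d : ℝ), ?_, sqrt_mem_sqrtField hd, rfl⟩
  rcases hd with rfl | rfl | rfl <;> assumption

theorem aut_involutive (σ : sqrtField {x, y, z} ≃ₐ[ℚ] sqrtField {x, y, z}) {a b : ℝ}
    (h : Sends σ a b) : Sends σ b a := by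
  have h1 : σ * σ = 1 := by
    have key : ∀ d : ℕ, √(d : ℝ) ∈ sqrtField {x, y, z} →
        Sends (σ * σ) √(d : ℝ) √(d : ℝ) := by
      intro d hd
      rcases sends_sqrt_or σ hd with h | h
      · exact h.mul_aut h
      · have := h.mul_aut h.neg
        rwa [neg_neg] at this
    exact aut_eq_one (key x (sqrt_mem_sqrtField (by simp))) (key y (sqrt_mem_sqrtField (by simp)))
      (key z (sqrt_mem_sqrtField (by simp)))
  obtain ⟨c, hc⟩ := Sends.exists_of_mem σ h.mem_right
  have h2 := h.mul_aut hc
  rw [h1] at h2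
  have : a = c := Sends.unique ⟨h.mem, rfl⟩ h2
  rwa [← this] at hc

variable {K : IntermediateField ℚ ℝ} [FiniteDimensional ℚ K]

open Classical in
/-- The product of the conjugates of `a` under the automorphisms that fix `t`; this is the
relative norm to `ℚ(t)`. -/
def normFixing (t a : K) : K := ∏ g : K ≃ₐ[ℚ] K with g t = t, g a

theorem map_normFixing {t a : K} {σ : K ≃ₐ[ℚ] K} (h : σ t = t) :
    σ (normFixing t a) = normFixing t a := by
  classical
  rw [normFixing, map_prod]
  refine Finset.prod_nbij' (fun g => σ * g) (fun g => σ⁻¹ * g) ?_ ?_ ?_ ?_ ?_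
  · intro g hg
    simp only [Finset.mem_filter, Finset.mem_univ, true_and, AlgEquiv.mul_apply] at hg ⊢
    rw [hg, h]
  · intro g hg
    simp only [Finset.mem_filter, Finset.mem_univ, true_and, AlgEquiv.mul_apply] at hg ⊢
    rw [hg]
    nth_rewrite 1 [← h]
    exact σ.symm_apply_apply t
  · intro g _; simp
  · intro g _; simp
  · intro g _; rfl

theorem isUnitOf_normFixing {t a : K} (ha : IsUnitOf K a) :
    IsUnitOf K (normFixing t a) := by
  classical
  refine Finset.prod_induction (fun g : K ≃ₐ[ℚ] K => g a) (fun y : K => IsUnitOf K y)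
    (fun y y' h h' => ?_) ?_ fun g _ => ?_
  · have := h.mul h'
    simpa using this
  · simpa using IsUnitOf.one
  · exact ha.sends ⟨ha.2.1, rfl⟩

theorem isUnitOf_sqrtField_normFixing [IsGalois ℚ K] {d : ℕ} {t a : K} (ht : (t : ℝ) = √(d : ℝ))
    (ha : IsUnitOf K a) : IsUnitOf (sqrtField {d}) (normFixing t a) := by
  have h1 := isUnitOf_normFixing (t := t) ha
  refine ⟨h1.1, ?_, h1.2.2⟩
  have hle : sqrtField {d} ≤ K := sqrtField_le.2 fun e he => by
    obtain rfl := he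
    exact ht ▸ t.2
  refine mem_of_fixed hle (SetLike.coe_mem _) fun σ hσ => ⟨SetLike.coe_mem _, ?_⟩
  have h2 : σ t = t := by
    obtain ⟨h3, h4⟩ := hσ _ (sqrt_mem_singleton d)
    have : (⟨√(d : ℝ), h3⟩ : K) = t := Subtype.ext ht.symm
    rw [this] at h4
    exact Subtype.ext (h4.trans ht.symm)
  exact congrArg Subtype.val (map_normFixing (a := a) h2)

/-- The full norm is `normFixing` at `t = 1`, which every automorphism fixes. It therefore lies in
`ℚ(√1) = ℚ`. -/
theorem isUnitOf_prod_conj [IsGalois ℚ K] {d : ℕ} {a : K} (ha : IsUnitOf K a) :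
    IsUnitOf (sqrtField {d}) ((∏ g : K ≃ₐ[ℚ] K, g a : K) : ℝ) := by
  classical
  have h1 : normFixing 1 a = ∏ g : K ≃ₐ[ℚ] K, g a := by
    simp [normFixing]
  rw [← h1]
  have hle : sqrtField {1} ≤ sqrtField {d} := sqrtField_le.2 fun e he => by
    obtain rfl := he
    simp
  exact (isUnitOf_sqrtField_normFixing (d := 1) (by simp) ha).mono hle

/-- The fourth power of a unit of a triquadratic field is a product of units of the
quadratic subfields. -/
theorem pow_four_mem {a : ℝ} (ha : IsUnitOf (sqrtField {x, y, z}) a) {H : Subgroup ℝˣ}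
    (hx0 : x ≠ 0) (hy0 : y ≠ 0) (hz0 : z ≠ 0)
    (hH : ∀ d ∈ ({x, y, x * y, z, x * z, y * z, x * y * z} : Set ℕ), unitGroup (sqrtField {d}) ≤ H)
    {u : ℝˣ} (hu : (u : ℝ) = a) : u ^ 4 ∈ H := by
  classical
  set L := sqrtField {x, y, z} with hL
  have hx : √(x : ℝ) ∈ L := sqrt_mem_sqrtField (by simp)
  have hy : √(y : ℝ) ∈ L := sqrt_mem_sqrtField (by simp)
  have hz : √(z : ℝ) ∈ L := sqrt_mem_sqrtField (by simp)
  let X : L := ⟨_, hx⟩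
  let Y : L := ⟨_, hy⟩
  let Z : L := ⟨_, hz⟩
  let A : L := ⟨a, ha.2.1⟩
  have hX0 : X ≠ 0 := fun h => by
    have : √(x : ℝ) = 0 := congrArg Subtype.val h
    rw [Real.sqrt_eq_zero (Nat.cast_nonneg x)] at this
    exact hx0 (by exact_mod_cast this)
  have hY0 : Y ≠ 0 := fun h => by
    have : √(y : ℝ) = 0 := congrArg Subtype.val h
    rw [Real.sqrt_eq_zero (Nat.cast_nonneg y)] at this
    exact hy0 (by exact_mod_cast this)
  have hZ0 : Z ≠ 0 := fun h => by
    have : √(z : ℝ) = 0 := congrArg Subtype.val h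
    rw [Real.sqrt_eq_zero (Nat.cast_nonneg z)] at this
    exact hz0 (by exact_mod_cast this)
  have hsign : ∀ (σ : L ≃ₐ[ℚ] L) (d : ℕ) (h : √(d : ℝ) ∈ L),
      σ ⟨√(d : ℝ), h⟩ = ⟨√(d : ℝ), h⟩ ∨ σ ⟨√(d : ℝ), h⟩ = -⟨√(d : ℝ), h⟩ := by
    intro σ d h
    rcases sends_sqrt_or σ h with ⟨_, e⟩ | ⟨_, e⟩
    · exact Or.inl (Subtype.ext e)
    · exact Or.inr (Subtype.ext e)
  have hA : IsUnitOf L A := ha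
  -- The identity automorphism fixes all seven square roots and any other one fixes exactly three.
  -- On the right, `A` thus occurs 7 = 4 + 3 times and each other conjugate 3 times.
  have key : A ^ 4 * (∏ g : L ≃ₐ[ℚ] L, g A) ^ 3 = normFixing X A * normFixing Y A *
      normFixing (X * Y) A * normFixing Z A * normFixing (X * Z) A * normFixing (Y * Z) A *
      normFixing (X * Y * Z) A := by
    simp only [normFixing, Finset.prod_filter, ← Finset.prod_mul_distrib]
    rw [← Finset.prod_pow]
    have h1 : A ^ 4 = ∏ g : L ≃ₐ[ℚ] L, if g = 1 then (g A) ^ 4 else 1 := by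
      rw [Finset.prod_ite_eq' Finset.univ (1 : L ≃ₐ[ℚ] L) (fun g => (g A) ^ 4)]
      simp
    rw [h1, ← Finset.prod_mul_distrib]
    refine Finset.prod_congr rfl fun g _ => ?_
    have hg1 : g = 1 ↔ g X = X ∧ g Y = Y ∧ g Z = Z := by
      constructor
      · rintro rfl; exact ⟨rfl, rfl, rfl⟩
      · rintro ⟨e1, e2, e3⟩
        exact aut_eq_one ⟨hx, congrArg Subtype.val e1⟩ ⟨hy, congrArg Subtype.val e2⟩
          ⟨hz, congrArg Subtype.val e3⟩
    have hne : ∀ {B : L}, B ≠ 0 → ¬ (-B = B) := fun h h' => h (self_eq_neg.1 h'.symm)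
    have hXY := mul_ne_zero hX0 hY0
    have hXZ := mul_ne_zero hX0 hZ0
    have hYZ := mul_ne_zero hY0 hZ0
    have hXYZ := mul_ne_zero hXY hZ0
    rw [if_congr hg1 rfl rfl]
    simp only [map_mul]
    rcases hsign g x hx with e1 | e1 <;> rcases hsign g y hy with e2 | e2 <;>
      rcases hsign g z hz with e3 | e3 <;>
      simp only [X, Y, Z] at hne hX0 hY0 hZ0 hXY hXZ hYZ hXYZ ⊢ <;>
      simp only [e1, e2, e3, neg_mul, mul_neg, neg_neg, hne hX0, hne hY0, hne hZ0, hne hXY,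
        hne hXZ, hne hYZ, hne hXYZ, if_true, if_false, and_true, and_false,
        one_mul, mul_one] <;> ring
  have hxy : ((X * Y : L) : ℝ) = √((x * y : ℕ) : ℝ) := (sqrt_natCast_mul x y).symm
  have hxz : ((X * Z : L) : ℝ) = √((x * z : ℕ) : ℝ) := (sqrt_natCast_mul x z).symm
  have hyz : ((Y * Z : L) : ℝ) = √((y * z : ℕ) : ℝ) := (sqrt_natCast_mul y z).symm
  have hxyz : ((X * Y * Z : L) : ℝ) = √((x * y * z : ℕ) : ℝ) := by
    rw [sqrt_natCast_mul, sqrt_natCast_mul]; rfl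
  have hmem : ∀ {d : ℕ} {b : ℝ}, d ∈ ({x, y, x * y, z, x * z, y * z, x * y * z} : Set ℕ) →
      ∀ h : IsUnitOf (sqrtField {d}) b, Units.mk0 b h.1 ∈ H := fun hd h =>
    hH _ hd (mem_unitGroup.2 h)
  have m0 := hmem (by simp) (isUnitOf_prod_conj (d := x) hA)
  have m1 := hmem (by simp) (isUnitOf_sqrtField_normFixing (t := X) (d := x) rfl hA)
  have m2 := hmem (by simp) (isUnitOf_sqrtField_normFixing (t := Y) (d := y) rfl hA)
  have m3 := hmem (by simp) (isUnitOf_sqrtField_normFixing hxy hA)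
  have m4 := hmem (by simp) (isUnitOf_sqrtField_normFixing (t := Z) (d := z) rfl hA)
  have m5 := hmem (by simp) (isUnitOf_sqrtField_normFixing hxz hA)
  have m6 := hmem (by simp) (isUnitOf_sqrtField_normFixing hyz hA)
  have m7 := hmem (by simp) (isUnitOf_sqrtField_normFixing hxyz hA)
  have hprod := H.mul_mem (H.mul_mem (H.mul_mem (H.mul_mem (H.mul_mem (H.mul_mem (H.mul_mem m1 m2)
    m3) m4) m5) m6) m7) (H.inv_mem (H.pow_mem m0 3))
  convert hprod using 1
  rw [eq_mul_inv_iff_mul_eq]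
  apply Units.ext
  have key' := congrArg (Subtype.val) key
  simp only [Units.val_mul, Units.val_pow_eq_pow_val, Units.val_mk0, hu]
  exact key'

end Triquadratic

/-! ### Quadratic subfields and their radicands -/

/-- Completing the square: if `c₀ + c₁α + c₂α² = 0`, then `w = 2c₂α + c₁` is irrational and `w²` is
the rational discriminant. Multiplying `w` by the denominator of the discriminant turns the radicand
into the natural number numerator times denominator. -/
theorem exists_natCast_sqrt_mem_of_finrank_eq_two {k : IntermediateField ℚ ℝ}
    (h : Module.finrank ℚ k = 2) : ∃ n : ℕ, √(n : ℝ) ∈ k ∧ ¬IsSquare n := by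
  have hfin : FiniteDimensional ℚ k := Module.finite_of_finrank_pos (by omega)
  have hne : ¬k ≤ ⊥ := by
    intro hle
    have h1 := le_bot_iff.1 hle
    have h2 := (IntermediateField.finrank_eq_one_iff (K := k)).2 h1
    have : Module.finrank ℚ k = 1 := by convert h2
    omega
  obtain ⟨α, hα, hαn⟩ := Set.not_subset.1 hne
  have hrat : ∀ c : ℚ, α ≠ c := fun c hc => hαn (hc ▸ (⊥ : IntermediateField ℚ ℝ).algebraMap_mem c)
  set p := minpoly ℚ (⟨α, hα⟩ : k) with hp
  have hp0 : p ≠ 0 := minpoly.ne_zero (Algebra.IsIntegral.isIntegral _)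
  have hdeg : p.natDegree < 3 := by
    refine lt_of_le_of_lt (minpoly.natDegree_le _) ?_
    have : Module.finrank ℚ k < 3 := by omega
    convert this
  have hev : Polynomial.aeval (⟨α, hα⟩ : k) p = 0 := minpoly.aeval _ _
  rw [Polynomial.aeval_eq_sum_range' hdeg] at hev
  have hev' : (p.coeff 0 : ℝ) + p.coeff 1 * α + p.coeff 2 * α ^ 2 = 0 := by
    have := congrArg Subtype.val hev
    simpa [Finset.sum_range_succ, Algebra.smul_def] using this
  set c0 := p.coeff 0
  set c1 := p.coeff 1
  set c2 := p.coeff 2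
  have hc2 : c2 ≠ 0 := by
    intro h2
    rw [h2] at hev'
    by_cases h1 : c1 = 0
    · have h0 : c0 = 0 := by
        rw [h1] at hev'
        have : (c0 : ℝ) = 0 := by simpa using hev'
        exact_mod_cast this
      apply hp0
      ext n
      rcases lt_or_ge n 3 with hn | hn
      · interval_cases n
        exacts [h0, h1, h2]
      · exact Polynomial.coeff_eq_zero_of_natDegree_lt (by omega)
    · have h1' : (c1 : ℝ) ≠ 0 := by exact_mod_cast h1
      refine hrat (-c0 / c1) ?_
      push_cast
      rw [eq_div_iff h1']
      push_cast at hev'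
      linear_combination hev'
  have hc2' : (c2 : ℝ) ≠ 0 := by exact_mod_cast hc2
  set w := 2 * c2 * α + c1 with hw
  set m := c1 ^ 2 - 4 * c0 * c2 with hm
  have hwm : w ^ 2 = (m : ℝ) := by
    rw [hw, hm]; push_cast
    linear_combination 4 * (c2 : ℝ) * hev'
  have hwk : w ∈ k := by
    have h2 : (2 : ℝ) ∈ k := by simp
    exact add_mem (mul_mem (mul_mem h2 (k.algebraMap_mem c2)) hα) (k.algebraMap_mem c1)
  have hm0 : 0 ≤ m := by
    have : (0 : ℝ) ≤ m := hwm ▸ sq_nonneg w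
    exact_mod_cast this
  have hwrat : ∀ c : ℚ, w ≠ c := by
    intro c hc
    refine hrat ((c - c1) / (2 * c2)) ?_
    push_cast
    rw [eq_div_iff (mul_ne_zero two_ne_zero hc2'), ← hc, hw]
    ring
  have hden : (m.den : ℝ) ≠ 0 := by exact_mod_cast m.den_ne_zero
  have hN : ((m.num.toNat * m.den : ℕ) : ℝ) = (w * m.den) ^ 2 := by
    rw [mul_pow, hwm]
    have h1 : ((m.num.toNat : ℕ) : ℝ) = (m.num : ℝ) := by
      have := Int.toNat_of_nonneg (Rat.num_nonneg.2 hm0)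
      exact_mod_cast this
    have h2 : (m : ℝ) = m.num / m.den := by exact_mod_cast (Rat.num_div_den m).symm
    push_cast
    rw [h1, h2]
    field_simp
  refine ⟨m.num.toNat * m.den, ?_, ?_⟩
  · rw [hN, Real.sqrt_sq_eq_abs]
    have : w * m.den ∈ k := mul_mem hwk (natCast_mem _ _)
    rcases abs_choice (w * m.den) with h | h <;> rw [h]
    · exact this
    · exact neg_mem this
  · rintro ⟨c, hc⟩
    rw [hc] at hN
    push_cast at hN
    rw [← sq, sq_eq_sq_iff_eq_or_eq_neg] at hN
    rcases hN with h | h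
    · refine hwrat (c / m.den) ?_
      push_cast
      rw [eq_div_iff hden, h]
    · refine hwrat (-c / m.den) ?_
      push_cast
      rw [eq_div_iff hden, h, neg_neg]

section Radicands

variable {x y z : ℕ}

/-- The radicands of the seven quadratic subfields of `ℚ(√x, √y, √z)`. -/
def radicands (x y z : ℕ) : Set ℕ := {x, y, x * y, z, x * z, y * z, x * y * z}

theorem mem_radicands {d : ℕ} : d ∈ radicands x y z ↔
    d = x ∨ d = y ∨ d = x * y ∨ d = z ∨ d = x * z ∨ d = y * z ∨ d = x * y * z := by
  simp [radicands]

theorem IndepRoots.not_isSquare_of_mem_radicands (h : IndepRoots x y z) {d : ℕ}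
    (hd : d ∈ radicands x y z) : ¬IsSquare d := by
  intro hs
  have key : ∀ i < 2, ∀ j < 2, ∀ k < 2, d = x ^ i * y ^ j * z ^ k → i = 0 ∧ j = 0 ∧ k = 0 :=
    fun i hi j hj k hk e => h.isSquare i hi j hj k hk (e ▸ hs)
  rcases mem_radicands.1 hd with e | e | e | e | e | e | e
  · have := key 1 (by omega) 0 (by omega) 0 (by omega) (by simpa using e); omega
  · have := key 0 (by omega) 1 (by omega) 0 (by omega) (by simpa using e); omega
  · have := key 1 (by omega) 1 (by omega) 0 (by omega) (by simpa using e); omega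
  · have := key 0 (by omega) 0 (by omega) 1 (by omega) (by simpa using e); omega
  · have := key 1 (by omega) 0 (by omega) 1 (by omega) (by simpa using e); omega
  · have := key 0 (by omega) 1 (by omega) 1 (by omega) (by simpa using e); omega
  · have := key 1 (by omega) 1 (by omega) 1 (by omega) (by simpa using e); omega

theorem sqrt_mem_of_mem_radicands {d : ℕ} (hd : d ∈ radicands x y z) :
    √(d : ℝ) ∈ sqrtField {x, y, z} := by
  have hx : √(x : ℝ) ∈ sqrtField {x, y, z} := sqrt_mem_sqrtField (by simp)
  have hy : √(y : ℝ) ∈ sqrtField {x, y, z} := sqrt_mem_sqrtField (by simp)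
  have hz : √(z : ℝ) ∈ sqrtField {x, y, z} := sqrt_mem_sqrtField (by simp)
  rcases mem_radicands.1 hd with rfl | rfl | rfl | rfl | rfl | rfl | rfl <;>
    try simp only [sqrt_natCast_mul]
  exacts [hx, hy, mul_mem hx hy, hz, mul_mem hx hz, mul_mem hy hz, mul_mem (mul_mem hx hy) hz]

theorem sqrtField_singleton_le {d : ℕ} (hd : d ∈ radicands x y z) :
    sqrtField {d} ≤ sqrtField {x, y, z} :=
  sqrtField_le.2 fun e he => by
    obtain rfl := he
    exact sqrt_mem_of_mem_radicands hd

/-- A quadratic subfield contains some irrational `√n`, and `n` agrees with a product of `x`, `y`,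
`z` up to squares. Equality of the two fields then follows by degree. -/
theorem IndepRoots.exists_radicand (h : IndepRoots x y z) {k : IntermediateField ℚ ℝ}
    (hk : k ≤ sqrtField {x, y, z}) (hrank : Module.finrank ℚ k = 2) :
    ∃ d ∈ radicands x y z, k = sqrtField {d} := by
  obtain ⟨n, hn, hns⟩ := exists_natCast_sqrt_mem_of_finrank_eq_two hrank
  obtain ⟨i, hi, j, hj, l, hl, c, hc⟩ := exists_isSquare_of_sqrt_mem (hk hn)
  have hc' : n * (x ^ i * y ^ j * z ^ l) = c * c := by rw [← hc]; ring
  set d := x ^ i * y ^ j * z ^ l with hd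
  have hd1 : d ≠ 1 := by
    intro h1
    rw [h1, mul_one] at hc'
    exact hns ⟨c, hc'⟩
  have hdm : d ∈ radicands x y z := by
    rw [mem_radicands]
    interval_cases i <;> interval_cases j <;> interval_cases l <;>
      simp only [pow_zero, pow_one, one_mul, mul_one] at hd <;> tauto
  refine ⟨d, hdm, ?_⟩
  have hn0 : √(n : ℝ) ≠ 0 := by
    intro h0
    rw [Real.sqrt_eq_zero (Nat.cast_nonneg n)] at h0
    have : n = 0 := by exact_mod_cast h0
    exact hns ⟨0, by simpa using this⟩
  have hdk : √(d : ℝ) ∈ k := by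
    have h1 : √(n : ℝ) * √(d : ℝ) = c := by
      rw [← sqrt_natCast_mul, hc']
      push_cast
      exact Real.sqrt_mul_self (Nat.cast_nonneg c)
    have h2 : √(d : ℝ) = c / √(n : ℝ) := by rw [eq_div_iff hn0, ← h1]; ring
    rw [h2]
    exact div_mem (natCast_mem _ c) hn
  have hle : sqrtField {d} ≤ k := sqrtField_le.2 fun e he => by
    obtain rfl := he
    exact hdk
  have hfin : FiniteDimensional ℚ k := Module.finite_of_finrank_pos (by omega)
  have h3 := finrank_sqrtField_singleton (h.not_isSquare_of_mem_radicands hdm)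
  symm
  refine IntermediateField.eq_of_le_of_finrank_eq hle ?_
  rw [← hrank] at h3
  convert h3

theorem mem_closure_of_isUnitOf {d : ℕ} (hd : ¬IsSquare d) {H : Subgroup ℝˣ}
    (hneg : (-1 : ℝˣ) ∈ H) (he : Units.mk0 (eps d) (isUnitOf_eps d).1 ∈ H) :
    unitGroup (sqrtField {d}) ≤ H := by
  intro u hu
  obtain ⟨n, hn⟩ := (mem_unitGroup.1 hu).eq_eps_zpow hd
  have hz := H.zpow_mem he n
  rcases hn with hn | hn
  · convert hz using 1
    ext
    simp [hn]
  · convert H.mul_mem hneg hz using 1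
    ext
    simp [hn]

theorem IndepRoots.quadraticUnits_eq (h : IndepRoots x y z) :
    quadraticUnits (sqrtField {x, y, z}) = ⨆ d ∈ radicands x y z, unitGroup (sqrtField {d}) := by
  apply le_antisymm
  · refine iSup₂_le fun k hk => ?_
    obtain ⟨d, hd, rfl⟩ := h.exists_radicand hk.1 hk.2
    exact le_iSup₂_of_le d hd le_rfl
  · refine iSup₂_le fun d hd => ?_
    exact le_iSup₂_of_le (sqrtField {d}) ⟨sqrtField_singleton_le hd,
      finrank_sqrtField_singleton (h.not_isSquare_of_mem_radicands hd)⟩ le_rfl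

end Radicands

/-! ### The square class of a product of three units of norm -1 -/

theorem exists_int_of_fixed {K : IntermediateField ℚ ℝ} [FiniteDimensional ℚ K] [IsGalois ℚ K]
    {x : ℝ} (hx : x ∈ K) (hi : IsIntegral ℤ x) (h : ∀ σ : K ≃ₐ[ℚ] K, Sends σ x x) :
    ∃ a : ℤ, x = a := by
  obtain ⟨c, rfl⟩ := exists_rat_of_fixed hx h
  obtain ⟨n, rfl⟩ := exists_int_of_isIntegral c hi
  exact ⟨n, by simp⟩

/-- If `2n t₁ t₀` is a square up to a square factor, then a prime dividing the squarefree number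
`t₀` but not `N` divides `t₁`. -/
theorem dvd_of_mul_sq_eq_sq {p N t₀ : ℕ} {t₁ m m₁ : ℤ} (hp : p.Prime) (ht₀ : Squarefree t₀)
    (hpt : p ∣ t₀) (hpN : ¬p ∣ N) (hm : m ≠ 0) (h : N * t₁ * (t₀ * m ^ 2) = m₁ ^ 2) :
    (p : ℤ) ∣ t₁ := by
  have hpi := Nat.prime_iff_prime_int.1 hp
  obtain ⟨k, rfl⟩ : m ∣ m₁ := by
    rw [← Int.pow_dvd_pow_iff two_ne_zero, ← h]
    exact ⟨N * t₁ * t₀, by ring⟩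
  obtain ⟨c, rfl⟩ := hpt
  have h1 : N * t₁ * ((p * c : ℕ) : ℤ) = k ^ 2 := by
    apply mul_left_cancel₀ (pow_ne_zero 2 hm)
    linear_combination h
  push_cast at h1
  obtain ⟨k', rfl⟩ : (p : ℤ) ∣ k := hpi.dvd_of_dvd_pow (n := 2) (by
    rw [← h1]; exact ⟨N * t₁ * c, by ring⟩)
  have h2 : N * t₁ * c = p * k' ^ 2 := by
    apply mul_left_cancel₀ hpi.ne_zero
    linear_combination h1
  rcases hpi.dvd_or_dvd (Dvd.intro _ h2.symm) with h | h
  · rcases hpi.dvd_or_dvd h with h | h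
    · exact absurd (by exact_mod_cast h) hpN
    · exact h
  · have : p ∣ c := by exact_mod_cast h
    exact absurd (Nat.isUnit_iff.1 (ht₀ p (mul_dvd_mul_left p this))) hp.one_lt.ne'

-- Write `A`, `B`, `C` for the three units and `ω = ABC`. For suitable signs, `α = 1 ± AC ± BC ± AB`
-- satisfies `α² = Tω` with `T` an integer, so the squarefree part of `T` is a class of `ω`. Four
-- such `α` exist, they agree up to rational factors and square roots of `x`, `n`, `xn`, and they
-- sum to 4. A prime dividing the class but not `2xn` would make every `α/√p` integral, hence also
-- `4/√p`, which is impossible.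
set_option maxHeartbeats 1600000 in
theorem exists_class_of_norms_neg {x n : ℕ} (hx : ¬IsSquare x) (hn : ¬IsSquare n)
    (hxn : ¬IsSquare (x * n)) (hx' : Squarefree x) (hn' : Squarefree n)
    (hxn' : Squarefree (x * n)) (h1 : normEps x = -1) (h2 : normEps n = -1)
    (h3 : normEps (x * n) = -1) :
    ∃ t : ℕ, Squarefree t ∧ (∀ p : ℕ, p.Prime → p ∣ t → p ∣ 2 * (x * n)) ∧
      √(t : ℝ) * √(eps x * eps n * eps (x * n)) ∈ sqrtField {x, n} := by
  set A := eps x with hA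
  set B := eps n with hB
  set C := eps (x * n) with hC
  have hX : √(x : ℝ) ∈ sqrtField {x, n} := sqrt_mem_sqrtField (by simp)
  have hN : √(n : ℝ) ∈ sqrtField {x, n} := sqrt_mem_sqrtField (by simp)
  have hA1 : 1 < A := one_lt_eps hx
  have hB1 : 1 < B := one_lt_eps hn
  have hC1 : 1 < C := one_lt_eps hxn
  have hA0 : A ≠ 0 := by positivity
  have hB0 : B ≠ 0 := by positivity
  have hC0 : C ≠ 0 := by positivity
  set ω := A * B * C with hω
  have hω0 : 0 < ω := by positivity
  have hAi : IsIntegral ℤ A := (isUnitOf_eps x).2.2.1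
  have hBi : IsIntegral ℤ B := (isUnitOf_eps n).2.2.1
  have hCi : IsIntegral ℤ C := (isUnitOf_eps (x * n)).2.2.1
  have hωi : IsIntegral ℤ ω := (hAi.mul hBi).mul hCi
  have hωi' : IsIntegral ℤ ω⁻¹ := by
    rw [hω, mul_inv, mul_inv]
    exact ((isUnitOf_eps x).2.2.2.mul (isUnitOf_eps n).2.2.2).mul (isUnitOf_eps (x * n)).2.2.2
  have hacts : ∀ σ : sqrtField {x, n} ≃ₐ[ℚ] sqrtField {x, n},
      (Sends σ √(x : ℝ) √(x : ℝ) ∧ Sends σ √(n : ℝ) √(n : ℝ) ∧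
        Sends σ A A ∧ Sends σ B B ∧ Sends σ C C) ∨
      (Sends σ √(x : ℝ) (-√(x : ℝ)) ∧ Sends σ √(n : ℝ) √(n : ℝ) ∧
        Sends σ A (-1 / A) ∧ Sends σ B B ∧ Sends σ C (-1 / C)) ∨
      (Sends σ √(x : ℝ) √(x : ℝ) ∧ Sends σ √(n : ℝ) (-√(n : ℝ)) ∧
        Sends σ A A ∧ Sends σ B (-1 / B) ∧ Sends σ C (-1 / C)) ∨
      (Sends σ √(x : ℝ) (-√(x : ℝ)) ∧ Sends σ √(n : ℝ) (-√(n : ℝ)) ∧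
        Sends σ A (-1 / A) ∧ Sends σ B (-1 / B) ∧ Sends σ C C) := by
    intro σ
    have cA : Sends σ √(x : ℝ) (-√(x : ℝ)) → Sends σ A (-1 / A) := fun h => by
      simpa [h1] using sends_eps_conj hx hx' h
    have cB : Sends σ √(n : ℝ) (-√(n : ℝ)) → Sends σ B (-1 / B) := fun h => by
      simpa [h2] using sends_eps_conj hn hn' h
    have cC : Sends σ √((x * n : ℕ) : ℝ) (-√((x * n : ℕ) : ℝ)) → Sends σ C (-1 / C) := fun h => by
      have := sends_eps_conj hxn hxn' h
      rw [h3] at this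
      simpa using this
    rcases sends_sqrt_or σ hX with hx1 | hx1 <;> rcases sends_sqrt_or σ hN with hn1 | hn1
    · exact Or.inl ⟨hx1, hn1, sends_eps_self hx1, sends_eps_self hn1,
        sends_eps_self (by rw [sqrt_natCast_mul]; exact hx1.mul hn1)⟩
    · exact Or.inr (Or.inr (Or.inl ⟨hx1, hn1, sends_eps_self hx1, cB hn1,
        cC (by rw [sqrt_natCast_mul, ← mul_neg]; exact hx1.mul hn1)⟩))
    · exact Or.inr (Or.inl ⟨hx1, hn1, cA hx1, sends_eps_self hn1,
        cC (by rw [sqrt_natCast_mul, ← neg_mul]; exact hx1.mul hn1)⟩)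
    · exact Or.inr (Or.inr (Or.inr ⟨hx1, hn1, cA hx1, cB hn1,
        sends_eps_self (by
          have := hx1.mul hn1
          rwa [neg_mul_neg, ← sqrt_natCast_mul] at this)⟩))
  have hXi := isIntegral_sqrt_natCast ℤ x
  have hNi := isIntegral_sqrt_natCast ℤ n
  have hmA : A ∈ sqrtField {x, n} := sqrtField_mono (by simp) (isUnitOf_eps x).2.1
  have hmB : B ∈ sqrtField {x, n} := sqrtField_mono (by simp) (isUnitOf_eps n).2.1
  have hmC : C ∈ sqrtField {x, n} := by
    refine (sqrtField_le.2 fun e he => ?_) (isUnitOf_eps (x * n)).2.1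
    obtain rfl := he
    rw [sqrt_natCast_mul]
    exact mul_mem hX hN
  have hmω : ω ∈ sqrtField {x, n} := mul_mem (mul_mem hmA hmB) hmC
  -- the four solutions of the cocycle equation attached to `ω`
  let α : ℤ → ℤ → ℤ → ℝ := fun i j k => 1 + i * (A * C) + j * (B * C) + k * (A * B)
  have hαi : ∀ i j k, IsIntegral ℤ (α i j k) := fun i j k =>
    (((isIntegral_one.add ((isIntegral_algebraMap (x := i)).mul (hAi.mul hCi))).add
      ((isIntegral_algebraMap (x := j)).mul (hBi.mul hCi))).add
      ((isIntegral_algebraMap (x := k)).mul (hAi.mul hBi)))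
  have hαm : ∀ i j k, α i j k ∈ sqrtField {x, n} := fun i j k =>
    add_mem (add_mem (add_mem (one_mem _) (mul_mem (intCast_mem _ i) (mul_mem hmA hmC)))
      (mul_mem (intCast_mem _ j) (mul_mem hmB hmC))) (mul_mem (intCast_mem _ k) (mul_mem hmA hmB))
  have hαs : ∀ {σ : sqrtField {x, n} ≃ₐ[ℚ] sqrtField {x, n}} {A' B' C' : ℝ}, Sends σ A A' →
      Sends σ B B' → Sends σ C C' → ∀ i j k, Sends σ (α i j k)
        (1 + i * (A' * C') + j * (B' * C') + k * (A' * B')) := fun a b c i j k =>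
    (((Sends.one _).add ((Sends.intCast _ i).mul (a.mul c))).add
      ((Sends.intCast _ j).mul (b.mul c))).add ((Sends.intCast _ k).mul (a.mul b))
  have hint : ∀ (y : ℝ), IsIntegral ℤ y → y ∈ sqrtField {x, n} →
      (∀ σ : sqrtField {x, n} ≃ₐ[ℚ] sqrtField {x, n}, Sends σ y y) → ∃ a : ℤ, y = a :=
    fun y hi hm hs => exists_int_of_fixed hm hi hs
  -- The product of the signs is -1 in each triple. Then the nontrivial automorphisms send `α` to
  -- `±α/(AC)`, `±α/(BC)`, `±α/(AB)`, while `ω` is divided by the square of the same denominator. So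
  -- `α²/ω` is fixed, and it is integral because `ω` is a unit.
  have hsq : ∀ i j k : ℤ, (i, j, k) ∈ ({(1, 1, -1), (1, -1, 1), (-1, 1, 1), (-1, -1, -1)} :
      Set (ℤ × ℤ × ℤ)) → ∃ t : ℤ, α i j k ^ 2 = t * ω := by
    intro i j k hijk
    obtain ⟨t, ht⟩ := hint (α i j k ^ 2 / ω) (by
        rw [div_eq_mul_inv]; exact ((hαi i j k).pow 2).mul hωi')
      (div_mem (pow_mem (hαm i j k) 2) hmω) (fun σ => by
        simp only [Set.mem_insert_iff, Set.mem_singleton_iff, Prod.mk.injEq] at hijk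
        rcases hacts σ with ⟨-, -, a, b, c⟩ | ⟨-, -, a, b, c⟩ | ⟨-, -, a, b, c⟩ |
            ⟨-, -, a, b, c⟩ <;>
          have h := ((hαs a b c i j k).pow 2).div ((a.mul b).mul c) <;>
          convert h using 1 <;>
          rcases hijk with ⟨rfl, rfl, rfl⟩ | ⟨rfl, rfl, rfl⟩ | ⟨rfl, rfl, rfl⟩ | ⟨rfl, rfl, rfl⟩ <;>
          simp only [α, hω] <;> push_cast <;> field_simp <;> ring)
    exact ⟨t, by rw [← ht]; field_simp⟩
  -- The signs by which the automorphisms act on the product of two different `α`, relative to `ω`,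
  -- are those of `√e`.
  have hcross : ∀ i j k : ℤ, ∀ e : ℕ, (i, j, k, e) ∈ ({(1, 1, -1, x * n), (1, -1, 1, x),
      (-1, 1, 1, n)} : Set (ℤ × ℤ × ℤ × ℕ)) →
      ∃ t : ℤ, √(e : ℝ) * (α i j k * α (-1) (-1) (-1)) = t * ω := by
    intro i j k e hijk
    simp only [Set.mem_insert_iff, Set.mem_singleton_iff, Prod.mk.injEq] at hijk
    obtain ⟨t, ht⟩ := hint (√(e : ℝ) * (α i j k * α (-1) (-1) (-1)) / ω) (by
        rw [div_eq_mul_inv]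
        exact ((isIntegral_sqrt_natCast ℤ e).mul ((hαi i j k).mul (hαi _ _ _))).mul hωi')
      (div_mem (mul_mem (by
        rcases hijk with ⟨-, -, -, rfl⟩ | ⟨-, -, -, rfl⟩ | ⟨-, -, -, rfl⟩
        · rw [sqrt_natCast_mul]; exact mul_mem hX hN
        · exact hX
        · exact hN) (mul_mem (hαm i j k) (hαm _ _ _))) hmω) (fun σ => by
        rcases hijk with ⟨rfl, rfl, rfl, rfl⟩ | ⟨rfl, rfl, rfl, rfl⟩ | ⟨rfl, rfl, rfl, rfl⟩
        · rw [sqrt_natCast_mul]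
          rcases hacts σ with ⟨u, v, a, b, c⟩ | ⟨u, v, a, b, c⟩ | ⟨u, v, a, b, c⟩ |
            ⟨u, v, a, b, c⟩ <;>
          (have h := ((u.mul v).mul ((hαs a b c 1 1 (-1)).mul (hαs a b c (-1) (-1) (-1)))).div
            ((a.mul b).mul c)
           convert h using 1 <;> simp only [α, hω] <;> push_cast <;> field_simp) <;> ring1
        · rcases hacts σ with ⟨u, v, a, b, c⟩ | ⟨u, v, a, b, c⟩ | ⟨u, v, a, b, c⟩ |
            ⟨u, v, a, b, c⟩ <;>
          (have h := ((u).mul ((hαs a b c 1 (-1) 1).mul (hαs a b c (-1) (-1) (-1)))).div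
            ((a.mul b).mul c)
           convert h using 1 <;> simp only [α, hω] <;> push_cast <;> field_simp) <;> ring1
        · rcases hacts σ with ⟨u, v, a, b, c⟩ | ⟨u, v, a, b, c⟩ | ⟨u, v, a, b, c⟩ |
            ⟨u, v, a, b, c⟩ <;>
          (have h := ((v).mul ((hαs a b c (-1) 1 1).mul (hαs a b c (-1) (-1) (-1)))).div
            ((a.mul b).mul c)
           convert h using 1 <;> simp only [α, hω] <;> push_cast <;> field_simp) <;> ring1)
    exact ⟨t, by rw [← ht]; field_simp⟩
  obtain ⟨T, hT⟩ := hsq (-1) (-1) (-1) (by simp)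
  have hneg : α (-1) (-1) (-1) < 0 := by
    have h1 : 1 < A * C := one_lt_mul_of_lt_of_le hA1 hC1.le
    have h2 : 0 < B * C := by positivity
    have h3 : 0 < A * B := by positivity
    -- The all-negative choice is `1 - AC - BC - AB`, negative because `AC > 1`; in particular it is
    -- nonzero.
    simp only [α]; push_cast; linarith
  have hTpos : 0 < T := by
    have : 0 < (T : ℝ) * ω := hT ▸ sq_pos_of_neg hneg
    exact_mod_cast (pos_iff_pos_of_mul_pos this).2 hω0
  obtain ⟨t, m, htm, ht⟩ := Nat.sq_mul_squarefree T.toNat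
  have hTm : T = t * (m : ℤ) ^ 2 := by
    have := Int.toNat_of_nonneg hTpos.le
    rw [← htm] at this
    rw [← this]
    push_cast
    ring
  have hm0 : (m : ℤ) ≠ 0 := by
    rintro h0
    rw [h0] at hTm
    simp at hTm
    omega
  refine ⟨t, ht, fun p hp hpt => ?_, ?_⟩
  · by_contra hpn
    have hp2 : ¬p ∣ 2 := fun h => hpn (h.mul_right _)
    have hpxn : ¬p ∣ x * n := fun h => hpn (h.mul_left _)
    have hpx : ¬p ∣ x := fun h => hpxn (h.mul_right _)
    have hpn' : ¬p ∣ n := fun h => hpxn (h.mul_left _)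
    have hpR : (0 : ℝ) < p := by exact_mod_cast hp.pos
    have hsp : √(p : ℝ) ≠ 0 := (Real.sqrt_pos.2 hpR).ne'
    have hdiv : ∀ (i j k t₁ : ℤ), α i j k ^ 2 = t₁ * ω → (p : ℤ) ∣ t₁ →
        IsIntegral ℤ (α i j k / √(p : ℝ)) := by
      rintro i j k _ h ⟨c, rfl⟩
      refine IsIntegral.of_pow (n := 2) two_pos ?_
      rw [div_pow, h, Real.sq_sqrt hpR.le]
      have : ((p * c : ℤ) : ℝ) * ω / p = (c : ℝ) * ω := by push_cast; field_simp
      rw [this]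
      exact (isIntegral_algebraMap (x := c)).mul hωi
    have hfull : ∀ (i j k : ℤ) (e : ℕ), (i, j, k) ∈ ({(1, 1, -1), (1, -1, 1), (-1, 1, 1),
        (-1, -1, -1)} : Set (ℤ × ℤ × ℤ)) → (i, j, k, e) ∈ ({(1, 1, -1, x * n), (1, -1, 1, x),
        (-1, 1, 1, n)} : Set (ℤ × ℤ × ℤ × ℕ)) → ¬p ∣ e → IsIntegral ℤ (α i j k / √(p : ℝ)) := by
      intro i j k e h1 h2 hpe
      obtain ⟨t₁, ht₁⟩ := hsq i j k h1
      obtain ⟨t₂, ht₂⟩ := hcross i j k e h2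
      refine hdiv i j k t₁ ht₁ (dvd_of_mul_sq_eq_sq (m₁ := t₂) hp ht hpt hpe hm0 ?_)
      rw [← hTm]
      have h3 : (√(e : ℝ) * (α i j k * α (-1) (-1) (-1))) ^ 2 = (t₂ * ω) ^ 2 := by rw [ht₂]
      rw [mul_pow, mul_pow, Real.sq_sqrt (Nat.cast_nonneg e), ht₁, hT] at h3
      have h4 : ((e * t₁ * T : ℤ) : ℝ) * ω ^ 2 = ((t₂ ^ 2 : ℤ) : ℝ) * ω ^ 2 := by
        push_cast; linear_combination h3
      exact_mod_cast mul_right_cancel₀ (pow_ne_zero 2 hω0.ne') h4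
    have i1 := hfull 1 1 (-1) (x * n) (by simp) (by simp) hpxn
    have i2 := hfull 1 (-1) 1 x (by simp) (by simp) hpx
    have i3 := hfull (-1) 1 1 n (by simp) (by simp) hpn'
    have i4 := hdiv (-1) (-1) (-1) T hT (by
      rw [hTm]; exact Dvd.dvd.mul_right (by exact_mod_cast hpt) _)
    have hsum := ((i1.add i2).add i3).add i4
    -- In the sum of the four choices the terms in `AC`, `BC` and `AB` cancel.
    have e : α 1 1 (-1) / √(p : ℝ) + α 1 (-1) 1 / √(p : ℝ) + α (-1) 1 1 / √(p : ℝ) +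
        α (-1) (-1) (-1) / √(p : ℝ) = 4 / √(p : ℝ) := by
      simp only [α]; push_cast; ring
    rw [e] at hsum
    have h16 := hsum.pow 2
    rw [div_pow, Real.sq_sqrt hpR.le] at h16
    obtain ⟨c, hc⟩ := exists_int_of_isIntegral (16 / p) (by
      rwa [show ((16 / p : ℚ) : ℝ) = 4 ^ 2 / p by push_cast; norm_num])
    have hpQ : (p : ℚ) ≠ 0 := by exact_mod_cast hp.ne_zero
    rw [div_eq_iff hpQ] at hc
    have hc' : (2 : ℤ) ^ 4 = c * p := by exact_mod_cast (by norm_num; exact hc : (2 : ℚ) ^ 4 = c * p)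
    have := (Nat.prime_iff_prime_int.1 hp).dvd_of_dvd_pow (Dvd.intro_left _ hc'.symm)
    exact hp2 (by exact_mod_cast this)
  · have hmR : (0 : ℝ) < m := by
      have : m ≠ 0 := by exact_mod_cast hm0
      positivity
    have : √(t : ℝ) * √ω = -α (-1) (-1) (-1) / m := by
      rw [← Real.sqrt_mul (Nat.cast_nonneg t), Real.sqrt_eq_iff_mul_self_eq (by positivity)
        (div_nonneg (by linarith) hmR.le)]
      have hT' : (T : ℝ) = t * (m : ℝ) ^ 2 := by exact_mod_cast hTm
      rw [hT'] at hT
      field_simp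
      linear_combination -hT
    rw [this]
    exact div_mem (neg_mem (hαm _ _ _)) (natCast_mem _ m)

/-! ### Parity of exponents from norms and signs -/

section Parity

variable {K : IntermediateField ℚ ℝ} {σ τ : K ≃ₐ[ℚ] K}

/-- `h σ(h)` is, up to sign, the square of a nonzero element fixed by `σ`. -/
def NormSq (σ : K ≃ₐ[ℚ] K) (h : ℝ) : Prop :=
  ∃ h' w, Sends σ h h' ∧ Sends σ w w ∧ w ≠ 0 ∧ |h * h'| = w ^ 2

theorem NormSq.mul {g h : ℝ} (hg : NormSq σ g) (hh : NormSq σ h) : NormSq σ (g * h) := by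
  obtain ⟨g', w, h1, h2, h3, h4⟩ := hg
  obtain ⟨h', w', h1', h2', h3', h4'⟩ := hh
  refine ⟨_, _, h1.mul h1', h2.mul h2', mul_ne_zero h3 h3', ?_⟩
  rw [mul_mul_mul_comm, abs_mul, h4, h4', mul_pow]

theorem NormSq.zpow {g : ℝ} (hg : NormSq σ g) (n : ℤ) : NormSq σ (g ^ n) := by
  obtain ⟨g', w, h1, h2, h3, h4⟩ := hg
  refine ⟨_, _, h1.zpow n, h2.zpow n, zpow_ne_zero n h3, ?_⟩
  rw [← mul_zpow, abs_zpow, h4, ← zpow_natCast, ← zpow_natCast, zpow_comm]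

/-- If `v² = h kᵉ`, where `NormSq σ h` and `σ k = -k`, then `e` is even. -/
theorem NormSq.even_of_sends_neg (hσ : ∀ {a b}, Sends σ a b → Sends σ b a) {v h k : ℝ} {e : ℤ}
    (hv : v ∈ K) (hh : NormSq σ h) (hk : Sends σ k (-k)) (hk0 : k ≠ 0)
    (hvh : v ^ 2 = h * k ^ e) : Even e := by
  obtain ⟨h', w, h1, h2, h3, h4⟩ := hh
  obtain ⟨v', hv'⟩ := Sends.exists_of_mem σ hv
  -- As `σ` is an involution, `v σ(v)` is fixed by `σ`. Its square equals that of `w k^e`, an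
  -- element that `σ` negates when `e` is odd.
  have hn : Sends σ (v * v') (v * v') := by
    have := hv'.mul (hσ hv')
    rwa [mul_comm v' v] at this
  have hv2 : v' ^ 2 = h' * (-k) ^ e := by
    have := hv'.pow 2
    rw [hvh] at this
    exact this.unique (h1.mul (hk.zpow e))
  have hke : k ^ e ≠ 0 := zpow_ne_zero e hk0
  have hsq : (v * v') ^ 2 = (w * k ^ e) ^ 2 := by
    have h5 : (v * v') ^ 2 = |h * h'| * |k ^ e| * |(-k) ^ e| := by
      rw [← abs_mul, ← abs_mul, ← abs_of_nonneg (sq_nonneg (v * v')), mul_pow, hvh, hv2]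
      congr 1
      ring
    rw [h5, h4, abs_zpow, abs_zpow, abs_neg, mul_assoc, ← sq, ← abs_zpow, sq_abs, mul_pow]
  by_contra hodd
  rw [Int.not_even_iff_odd] at hodd
  have hwk : Sends σ (w * k ^ e) (-(w * k ^ e)) := by
    have := h2.mul (hk.zpow e)
    rwa [hodd.neg_zpow, mul_neg] at this
  have hne : w * k ^ e ≠ 0 := mul_ne_zero h3 hke
  rcases sq_eq_sq_iff_eq_or_eq_neg.1 hsq with h | h
  · rw [h] at hn
    exact hne (self_eq_neg.1 (hn.unique hwk))
  · rw [h] at hn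
    have h' := hn.neg
    rw [neg_neg] at h'
    exact hne (self_eq_neg.1 (h'.unique hwk))

/-- If `v² = h kᵉ`, where `NormSq σ h`, `k σ(k) = ± a` and `e` is odd, then `√a ∈ K`. -/
theorem NormSq.sqrt_mem_of_odd {v h k k' a : ℝ} {e : ℤ} (hv : v ∈ K) (hh : NormSq σ h)
    (hk : Sends σ k k') (ha : a ∈ K) (ha0 : 0 < a) (hka : |k * k'| = a) (he : Odd e)
    (hvh : v ^ 2 = h * k ^ e) : √a ∈ K := by
  obtain ⟨h', w, h1, h2, h3, h4⟩ := hh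
  obtain ⟨v', hv'⟩ := Sends.exists_of_mem σ hv
  have hv2 : v' ^ 2 = h' * k' ^ e := by
    have := hv'.pow 2
    rw [hvh] at this
    exact this.unique (h1.mul (hk.zpow e))
  obtain ⟨m, rfl⟩ := he
  have h5 : (v * v') ^ 2 = w ^ 2 * ((a ^ m) ^ 2 * a) := by
    have : (v * v') ^ 2 = |h * h'| * |k * k'| ^ (2 * m + 1) := by
      rw [← abs_zpow, ← abs_mul, ← abs_of_nonneg (sq_nonneg (v * v')), mul_pow, hvh, hv2, mul_zpow]
      congr 1
      ring
    rw [this, h4, hka, zpow_add₀ ha0.ne', zpow_one, mul_comm 2 m, zpow_mul]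
    norm_cast
  have ham : a ^ m ≠ 0 := zpow_ne_zero m ha0.ne'
  have h6 : a = (v * v' / (w * a ^ m)) ^ 2 := by
    rw [div_pow, h5]
    field_simp
  have hmem : v * v' / (w * a ^ m) ∈ K :=
    div_mem (mul_mem hv hv'.mem_right) (mul_mem h2.mem (zpow_mem ha m))
  rw [h6, Real.sqrt_sq_eq_abs]
  rcases abs_choice (v * v' / (w * a ^ m)) with h | h <;> rw [h]
  · exact hmem
  · exact neg_mem hmem

/-- `σ` maps `h` to a positive number. -/
def PosImage (σ : K ≃ₐ[ℚ] K) (h : ℝ) : Prop := ∃ h', Sends σ h h' ∧ 0 < h'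

theorem PosImage.mul {g h : ℝ} (hg : PosImage σ g) (hh : PosImage σ h) : PosImage σ (g * h) := by
  obtain ⟨g', h1, h2⟩ := hg
  obtain ⟨h', h1', h2'⟩ := hh
  exact ⟨_, h1.mul h1', mul_pos h2 h2'⟩

theorem PosImage.zpow {g : ℝ} (hg : PosImage σ g) (n : ℤ) : PosImage σ (g ^ n) := by
  obtain ⟨g', h1, h2⟩ := hg
  exact ⟨_, h1.zpow n, zpow_pos h2 n⟩

theorem PosImage.zpow_of_even {g : ℝ} (σ : K ≃ₐ[ℚ] K) (hg : g ∈ K) (hg0 : g ≠ 0) {n : ℤ}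
    (hn : Even n) : PosImage σ (g ^ n) := by
  obtain ⟨g', h1⟩ := Sends.exists_of_mem σ hg
  exact ⟨_, h1.zpow n, hn.zpow_pos (h1.ne_zero hg0)⟩

theorem PosImage.even_of_neg {v h k k' : ℝ} {e : ℤ} (hv : v ∈ K) (hh : PosImage σ h)
    (hk : Sends σ k k') (hk0 : k' < 0) (hvh : v ^ 2 = h * k ^ e) : Even e := by
  obtain ⟨h', h1, h2⟩ := hh
  obtain ⟨v', hv'⟩ := Sends.exists_of_mem σ hv
  have hv2 : v' ^ 2 = h' * k' ^ e := by
    have := hv'.pow 2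
    rw [hvh] at this
    exact this.unique (h1.mul (hk.zpow e))
  by_contra hodd
  rw [Int.not_even_iff_odd] at hodd
  have : h' * k' ^ e < 0 := mul_neg_of_pos_of_neg h2 (hodd.zpow_neg hk0)
  linarith [sq_nonneg v']

/-- `c` is the norm of `h` under the group generated by `σ` and `τ`. -/
def HasNorm (σ τ : K ≃ₐ[ℚ] K) (h c : ℝ) : Prop :=
  ∃ h' p, Sends σ h h' ∧ Sends τ (h * h') p ∧ h * h' * p = c

theorem HasNorm.mul {g h c c' : ℝ} (hg : HasNorm σ τ g c) (hh : HasNorm σ τ h c') :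
    HasNorm σ τ (g * h) (c * c') := by
  obtain ⟨g', p, h1, h2, rfl⟩ := hg
  obtain ⟨h', p', h1', h2', rfl⟩ := hh
  refine ⟨_, p * p', h1.mul h1', ?_, by ring⟩
  rw [mul_mul_mul_comm]
  exact h2.mul h2'

theorem HasNorm.zpow {g c : ℝ} (hg : HasNorm σ τ g c) (n : ℤ) : HasNorm σ τ (g ^ n) (c ^ n) := by
  obtain ⟨g', p, h1, h2, rfl⟩ := hg
  refine ⟨_, p ^ n, h1.zpow n, ?_, by rw [mul_zpow, mul_zpow]⟩
  rw [← mul_zpow]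
  exact h2.zpow n

theorem HasNorm.unique {g c c' : ℝ} (h : HasNorm σ τ g c) (h' : HasNorm σ τ g c') : c = c' := by
  obtain ⟨g', p, h1, h2, rfl⟩ := h
  obtain ⟨g'', p', h1', h2', rfl⟩ := h'
  obtain rfl := h1.unique h1'
  rw [h2.unique h2']

/-- The norm of `v²` is the square of the norm of `v`, so it cannot be negative. -/
theorem HasNorm.even_of_neg {v h k c e' : ℝ} {e : ℤ} (hv : v ∈ K) (hh : HasNorm σ τ h c)
    (hc : 0 < c) (hk : HasNorm σ τ k e') (he' : e' < 0) (hvh : v ^ 2 = h * k ^ e) : Even e := by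
  obtain ⟨v', hv'⟩ := Sends.exists_of_mem σ hv
  obtain ⟨p, hp⟩ := Sends.exists_of_mem τ (mul_mem hv hv'.mem_right)
  have h1 : HasNorm σ τ v (v * v' * p) := ⟨v', p, hv', hp, rfl⟩
  have h2 := h1.zpow 2
  have h3 := hh.mul (hk.zpow e)
  rw [← hvh] at h3
  have h4 := h3.unique (by simpa using h2)
  by_contra hodd
  rw [Int.not_even_iff_odd] at hodd
  have : c * e' ^ e < 0 := mul_neg_of_pos_of_neg hc (hodd.zpow_neg he')
  rw [h4] at this
  linarith [sq_nonneg (v * v' * p)]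

end Parity

section Eps

variable {K : IntermediateField ℚ ℝ} {σ τ : K ≃ₐ[ℚ] K} {d : ℕ}

theorem eps_mem (hK : √(d : ℝ) ∈ K) : eps d ∈ K :=
  (sqrtField_le.2 fun e he => by obtain rfl := he; exact hK : sqrtField {d} ≤ K)
    (isUnitOf_eps d).2.1

/-- If `σ` fixes `√d`, the square root is `ε_d` itself; otherwise `ε_d σ(ε_d) = ±1` and it is 1. -/
theorem normSq_eps (σ : K ≃ₐ[ℚ] K) (hd : ¬IsSquare d) (hsq : Squarefree d) (hK : √(d : ℝ) ∈ K) :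
    NormSq σ (eps d) := by
  have he := eps_pos hd
  rcases sends_sqrt_or σ hK with h | h
  · have := sends_eps_self h
    exact ⟨_, _, this, this, he.ne', by rw [← sq, abs_of_nonneg (sq_nonneg _)]⟩
  · refine ⟨_, 1, sends_eps_conj hd hsq h, Sends.one σ, one_ne_zero, ?_⟩
    rw [mul_div_cancel₀ _ he.ne']
    rcases normEps_eq_or d with h | h <;> simp [h]

theorem sends_sqrt_eps_conj (hd : ¬IsSquare d) (hsq : Squarefree d) (hN : normEps d = 1)
    (h : Sends σ √(d : ℝ) (-√(d : ℝ))) (hK : √(eps d) ∈ K) :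
    Sends σ √(eps d) (1 / √(eps d)) ∨ Sends σ √(eps d) (-(1 / √(eps d))) := by
  have h1 := sends_eps_conj hd hsq h
  rw [hN] at h1
  have h2 := (h1.sqrt_or (eps_pos hd).le hK).2
  simpa using h2

theorem normSq_sqrt_eps (hd : ¬IsSquare d) (hsq : Squarefree d) (hN : normEps d = 1)
    (h : Sends σ √(d : ℝ) (-√(d : ℝ))) (hK : √(eps d) ∈ K) : NormSq σ √(eps d) := by
  have he : √(eps d) ≠ 0 := (Real.sqrt_pos.2 (eps_pos hd)).ne'
  rcases sends_sqrt_eps_conj hd hsq hN h hK with h | h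
  · exact ⟨_, 1, h, Sends.one σ, one_ne_zero, by rw [mul_one_div_cancel he]; simp⟩
  · exact ⟨_, 1, h, Sends.one σ, one_ne_zero, by rw [mul_neg, mul_one_div_cancel he]; simp⟩

theorem posImage_eps (σ : K ≃ₐ[ℚ] K) (hd : ¬IsSquare d) (hsq : Squarefree d)
    (hN : normEps d = 1) (hK : √(d : ℝ) ∈ K) : PosImage σ (eps d) := by
  rcases sends_sqrt_or σ hK with h | h
  · exact ⟨_, sends_eps_self h, eps_pos hd⟩
  · refine ⟨_, sends_eps_conj hd hsq h, ?_⟩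
    rw [hN]
    simpa using eps_pos hd

theorem hasNorm_eps (σ τ : K ≃ₐ[ℚ] K) (hd : ¬IsSquare d) (hsq : Squarefree d)
    (hK : √(d : ℝ) ∈ K) : ∃ c, 0 < c ∧ HasNorm σ τ (eps d) c := by
  have he := eps_pos hd
  have hN : ((normEps d : ℚ) : ℝ) ^ 2 = 1 := by
    rcases normEps_eq_or d with h | h <;> simp [h]
  rcases sends_sqrt_or σ hK with h | h
  · obtain ⟨p, hp⟩ := Sends.exists_of_mem τ (eps_mem hK)
    refine ⟨_, ?_, _, _, sends_eps_self h, hp.mul hp, rfl⟩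
    have := mul_self_pos.2 (hp.ne_zero he.ne')
    positivity
  · refine ⟨eps d * (normEps d / eps d) * (normEps d : ℚ), ?_, _, (normEps d : ℚ),
      sends_eps_conj hd hsq h, ?_, rfl⟩
    · rw [mul_div_cancel₀ _ he.ne', ← sq, hN]
      exact one_pos
    · rw [mul_div_cancel₀ _ he.ne']
      exact Sends.ratCast τ _

/-- The product `√ε_d σ(√ε_d)` is `±ε_d` or `±1`. The unknown sign appears again after `τ` and
cancels, and `τ(ε_d) > 0` because the norm is 1. -/
theorem hasNorm_sqrt_eps (σ τ : K ≃ₐ[ℚ] K) (hd : ¬IsSquare d) (hsq : Squarefree d)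
    (hN : normEps d = 1) (hK : √(d : ℝ) ∈ K) (hK' : √(eps d) ∈ K) :
    ∃ c, 0 < c ∧ HasNorm σ τ √(eps d) c := by
  have he := eps_pos hd
  have hs0 : √(eps d) ≠ 0 := (Real.sqrt_pos.2 he).ne'
  have hss : √(eps d) * √(eps d) = eps d := Real.mul_self_sqrt he.le
  obtain ⟨p, hp, hp0⟩ := posImage_eps τ hd hsq hN hK
  rcases sends_sqrt_or σ hK with h | h
  · rcases ((sends_eps_self h).sqrt_or he.le hK').2 with h' | h'
    · exact ⟨eps d * p, by positivity, _, p, h', by rwa [hss], by rw [hss]⟩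
    · exact ⟨eps d * p, by positivity, _, -p, h', by rw [mul_neg, hss]; exact hp.neg,
        by linear_combination p * hss⟩
  · rcases sends_sqrt_eps_conj hd hsq hN h hK' with h' | h'
    · exact ⟨1, one_pos, _, 1, h', by rw [mul_one_div_cancel hs0]; exact Sends.one τ,
        by rw [mul_one_div_cancel hs0]; ring⟩
    · exact ⟨1, one_pos, _, -1, h', by rw [mul_neg, mul_one_div_cancel hs0]; exact (Sends.one τ).neg,
        by field_simp⟩

end Eps

/-! ### Which square roots of units lie in the field -/

theorem Nat.eq_zero_of_even_of_lt_two {i : ℕ} (h : Even i) (hi : i < 2) : i = 0 := by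
  interval_cases i
  · rfl
  · exact absurd h (by decide)

namespace PrimeData

variable {q r s : ℕ} [hqp : Fact q.Prime] [hrp : Fact r.Prime] [hsp : Fact s.Prime] {χ : ℤ}

theorem indepRoots (D : PrimeData q r s χ) : IndepRoots 2 q (r * s) := by
  refine ⟨fun i hi j hj k hk h => ?_⟩
  have h2 := not_dvd_pow_mul_pow_mul_pow Nat.prime_two hqp.out hrp.out hsp.out D.q_ne_two.symm
    D.r_ne_two.symm D.s_ne_two.symm j k k
  have hq := not_dvd_pow_mul_pow_mul_pow hqp.out Nat.prime_two hrp.out hsp.out D.q_ne_two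
    D.q_ne_r D.q_ne_s i k k
  have hr := not_dvd_pow_mul_pow_mul_pow hrp.out Nat.prime_two hqp.out hsp.out D.r_ne_two
    D.q_ne_r.symm D.r_ne_s i j k
  exact ⟨Nat.eq_zero_of_even_of_lt_two
      (even_of_isSquare_pow_mul Nat.prime_two h2 (by convert h using 1; ring)) hi,
    Nat.eq_zero_of_even_of_lt_two
      (even_of_isSquare_pow_mul hqp.out hq (by convert h using 1; ring)) hj,
    Nat.eq_zero_of_even_of_lt_two
      (even_of_isSquare_pow_mul hrp.out hr (by convert h using 1; ring)) hk⟩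

/-- Multiplying `r` by powers of 2, `q` and `rs` always leaves exponents of different parity at `r`
and at `s`. -/
theorem sqrt_r_notMem (D : PrimeData q r s χ) : √(r : ℝ) ∉ sqrtField {2, q, r * s} := by
  intro h
  obtain ⟨i, -, j, -, k, hk, hs⟩ := exists_isSquare_of_sqrt_mem h
  have h1 := not_dvd_pow_mul_pow_mul_pow hsp.out Nat.prime_two hqp.out hrp.out D.s_ne_two
    D.q_ne_s.symm D.r_ne_s.symm i j (k + 1)
  have hk0 := Nat.eq_zero_of_even_of_lt_two
    (even_of_isSquare_pow_mul hsp.out h1 (by convert hs using 1; ring)) hk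
  subst hk0
  have h2 := not_dvd_pow_mul_pow_mul_pow hrp.out Nat.prime_two hqp.out hsp.out D.r_ne_two
    D.q_ne_r.symm D.r_ne_s i j 0
  exact absurd (even_of_isSquare_pow_mul (i := 1) hrp.out h2 (by convert hs using 1; ring))
    (by decide)

theorem squarefree_radicands (D : PrimeData q r s χ) {d : ℕ} (hd : d ∈ radicands 2 q (r * s)) :
    Squarefree d := by
  have key : ∀ {a b c : ℕ}, a < 2 → b < 2 → c < 2 → d = 2 ^ a * q ^ b * (r * s) ^ c →
      Squarefree d := by
    intro a b c ha hb hc h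
    rw [h, mul_pow, ← mul_assoc]
    exact D.squarefree ha hb hc hc
  rcases mem_radicands.1 hd with e | e | e | e | e | e | e
  · exact key (a := 1) (b := 0) (c := 0) (by simp) (by simp) (by simp) (by simpa using e)
  · exact key (a := 0) (b := 1) (c := 0) (by simp) (by simp) (by simp) (by simpa using e)
  · exact key (a := 1) (b := 1) (c := 0) (by simp) (by simp) (by simp) (by simpa using e)
  · exact key (a := 0) (b := 0) (c := 1) (by simp) (by simp) (by simp) (by simpa using e)
  · exact key (a := 1) (b := 0) (c := 1) (by simp) (by simp) (by simp) (by simpa using e)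
  · exact key (a := 0) (b := 1) (c := 1) (by simp) (by simp) (by simp) (by simpa using e)
  · exact key (a := 1) (b := 1) (c := 1) (by simp) (by simp) (by simp) (by simpa using e)

end PrimeData

section SqrtForm

variable {L : IntermediateField ℚ ℝ} {q r s : ℕ}

theorem sqrt_form_mem_of_eq (h2 : √((2 : ℕ) : ℝ) ∈ L) (hq : √(q : ℝ) ∈ L)
    (hrs : √((r * s : ℕ) : ℝ) ∈ L) (i j k : ℕ) :
    √((2 ^ i * q ^ j * r ^ k * s ^ k : ℕ) : ℝ) ∈ L := by
  rw [mul_assoc, ← mul_pow]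
  exact sqrt_mem_of_prod_form (sqrt_mem_of_prod_form (sqrt_pow_mem h2 i) (sqrt_pow_mem hq j))
    (sqrt_pow_mem hrs k)

theorem sqrt_form_mem_of_ne (h2 : √((2 : ℕ) : ℝ) ∈ L) (hq : √(q : ℝ) ∈ L)
    (hrs : √((r * s : ℕ) : ℝ) ∈ L) {i j k l : ℕ} (hk : k < 2) (hl : l < 2) (hkl : k ≠ l) :
    √((2 ^ i * q ^ j * r ^ k * s ^ l : ℕ) : ℝ) * √(r : ℝ) ∈ L := by
  have h1 := sqrt_mem_of_prod_form (sqrt_pow_mem h2 i) (sqrt_pow_mem hq j)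
  interval_cases k <;> interval_cases l <;> first | omega | skip
  · rw [← sqrt_natCast_mul,
      show 2 ^ i * q ^ j * r ^ 0 * s ^ 1 * r = 2 ^ i * q ^ j * (r * s) by ring]
    exact sqrt_mem_of_prod_form h1 hrs
  · rw [pow_zero, mul_one, pow_one, sqrt_natCast_mul, mul_assoc,
      Real.mul_self_sqrt (Nat.cast_nonneg r)]
    exact mul_mem h1 (natCast_mem _ r)

theorem mem_of_sqrt_mul_mem {t : ℕ} {X : ℝ} (ht : t ≠ 0) (h : √(t : ℝ) * X ∈ L)
    (ht' : √(t : ℝ) ∈ L) : X ∈ L := by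
  have h0 : √(t : ℝ) ≠ 0 := (Real.sqrt_pos.2 (by positivity)).ne'
  have := div_mem h ht'
  rwa [mul_div_cancel_left₀ _ h0] at this

theorem sqrt_mul_mem_of_sqrt_mul_mem {t m : ℕ} {X : ℝ} (ht : t ≠ 0) (h : √(t : ℝ) * X ∈ L)
    (ht' : √(t : ℝ) * √(m : ℝ) ∈ L) : √(m : ℝ) * X ∈ L := by
  refine mem_of_sqrt_mul_mem (t := t * t) (mul_ne_zero ht ht) ?_ ?_
  · have := mul_mem h ht'
    rw [sqrt_natCast_mul]
    convert this using 1
    ring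
  · rw [sqrt_natCast_mul, Real.mul_self_sqrt (Nat.cast_nonneg t)]
    exact natCast_mem _ t

end SqrtForm

/-- The square classes of the fundamental units in `ℚ(√2, √q, √n)`: the field `K(√m)` contains the
square root of `ε_{d₁}`, and `K` that of `ε_{d₂}`, where `{d₁, d₂} = {qn, 2qn}`. -/
structure UnitData (q n m d₁ d₂ : ℕ) : Prop where
  indep : IndepRoots 2 q n
  squarefree : ∀ d ∈ radicands 2 q n, Squarefree d
  cases : d₁ = q * n ∧ d₂ = 2 * q * n ∨ d₁ = 2 * q * n ∧ d₂ = q * n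
  notMem : √(m : ℝ) ∉ sqrtField {2, q, n}
  norm_two : normEps 2 = -1
  norm_two_mul : normEps (2 * n) = -1
  norm_q : normEps q = 1
  norm_two_q : normEps (2 * q) = 1
  norm_fst : normEps d₁ = 1
  norm_snd : normEps d₂ = 1
  sqrt_q : √((2 : ℕ) : ℝ) * √(eps q) ∈ sqrtField {q}
  sqrt_two_q : √((2 : ℕ) : ℝ) * √(eps (2 * q)) ∈ sqrtField {2 * q}
  sqrt_fst : √(m : ℝ) * √(eps d₁) ∈ sqrtField {2, q, n}
  sqrt_snd : √(eps d₂) ∈ sqrtField {2, q, n}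
  sqrt_n : normEps n = 1 → √(m : ℝ) * √(eps n) ∈ sqrtField {2, q, n}
  sqrt_triple : normEps n = -1 → √(eps 2 * eps n * eps (2 * n)) ∈ sqrtField {2, n} ∨
    √(m : ℝ) * √(eps 2 * eps n * eps (2 * n)) ∈ sqrtField {2, q, n}

namespace PrimeData

variable {q r s : ℕ} [hqp : Fact q.Prime] [hrp : Fact r.Prime] [hsp : Fact s.Prime] {χ : ℤ}

/-- A class of `ε_2` would be 1 or 2, and both have their square root in `ℚ(√2)`. -/
theorem normEps_two : normEps 2 = -1 := by
  have hsq : Squarefree 2 := Nat.prime_two.prime.squarefree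
  have hns := Nat.prime_two.not_isSquare_of_dvd_squarefree hsq dvd_rfl
  refine (normEps_eq_or 2).resolve_left fun h => ?_
  obtain ⟨t, ht⟩ := exists_isSquareClass hns hsq h
  obtain ⟨i, hi, c, hc, hc2, -⟩ := ht.squarefree.exists_eq_pow_mul Nat.prime_two
  have hc1 : c = 1 := by
    by_contra hne
    obtain ⟨p, hp, hpc⟩ := Nat.exists_prime_and_dvd hne
    have h2 : p = 2 := by
      rcases ht.prime_dvd hp (hc ▸ hpc.mul_left _) with h | h
      · exact h
      · exact (Nat.prime_dvd_prime_iff_eq hp Nat.prime_two).1 h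
    exact hc2 (h2 ▸ hpc)
  subst hc1
  interval_cases i
  · exact ht.ne_one (by simpa using hc)
  · exact ht.ne_self (by simpa using hc)

theorem form_ne_zero (i j k l : ℕ) : 2 ^ i * q ^ j * r ^ k * s ^ l ≠ 0 := by
  have := hqp.out.ne_zero
  have := hrp.out.ne_zero
  have := hsp.out.ne_zero
  positivity

/-- Here `2^a` plays the role of `η` and `2^(1 - a)` that of `ρ`; `hsign` says `(2^a q / r) = (2^a q
/ s) = 1`. A class with equal exponents at `r` and `s` has its root in the triquadratic field. One
with unequal exponents differs from `r` by such a class. -/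
theorem unitData (D : PrimeData q r s χ) {a : ℕ} (ha : a < 2) (hsign : (-1) ^ a * χ = 1)
    (hcl : ¬IsSquareClass (2 ^ a * q * r * s) (r * s)) :
    UnitData q (r * s) r (2 ^ a * q * r * s) (2 ^ (1 - a) * q * r * s) := by
  have hI := D.indepRoots
  have hsf : ∀ d ∈ radicands 2 q (r * s), Squarefree d := fun d hd => D.squarefree_radicands hd
  have hns : ∀ d ∈ radicands 2 q (r * s), ¬IsSquare d := fun d hd =>
    hI.not_isSquare_of_mem_radicands hd
  have hcases : 2 ^ a * q * r * s = q * (r * s) ∧ 2 ^ (1 - a) * q * r * s = 2 * q * (r * s) ∨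
      2 ^ a * q * r * s = 2 * q * (r * s) ∧ 2 ^ (1 - a) * q * r * s = q * (r * s) := by
    interval_cases a
    · left; constructor <;> ring
    · right; constructor <;> ring
  have hd1 : 2 ^ a * q * r * s ∈ radicands 2 q (r * s) := by
    rw [mem_radicands]
    rcases hcases with h | h <;> simp [h.1]
  have hd2 : 2 ^ (1 - a) * q * r * s ∈ radicands 2 q (r * s) := by
    rw [mem_radicands]
    rcases hcases with h | h <;> simp [h.2]
  have hnorm : ∀ d ∈ radicands 2 q (r * s), q ∣ d → normEps d = 1 := fun d hd hqd =>
    normEps_eq_one_of_dvd (hns d hd) (hsf d hd) D.hq hqd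
  have m2 : 2 ∈ radicands 2 q (r * s) := by simp [radicands]
  have mq : q ∈ radicands 2 q (r * s) := by simp [radicands]
  have m2q : 2 * q ∈ radicands 2 q (r * s) := by simp [radicands]
  have mn : r * s ∈ radicands 2 q (r * s) := by simp [radicands]
  have m2n : 2 * (r * s) ∈ radicands 2 q (r * s) := by simp [radicands]
  have hn1 := hnorm _ hd1 ⟨2 ^ a * r * s, by ring⟩
  have hn2 := hnorm _ hd2 ⟨2 ^ (1 - a) * r * s, by ring⟩
  have k2 := sqrt_mem_of_mem_radicands m2
  have kq := sqrt_mem_of_mem_radicands mq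
  have kn := sqrt_mem_of_mem_radicands mn
  have hN2n : normEps (2 * (r * s)) = -1 := by
    refine (normEps_eq_or _).resolve_left fun h => ?_
    obtain ⟨t, ht⟩ := exists_isSquareClass (hns _ m2n) (hsf _ m2n) h
    rw [← mul_assoc] at ht
    exact D.not_class_two_rs ht
  refine ⟨hI, hsf, hcases, D.sqrt_r_notMem, normEps_two, hN2n, hnorm _ mq dvd_rfl,
    hnorm _ m2q (dvd_mul_left _ _), hn1, hn2, ?_, ?_, ?_, ?_, ?_, ?_⟩
  · obtain ⟨t, ht⟩ := exists_isSquareClass (hns _ mq) (hsf _ mq) (hnorm _ mq dvd_rfl)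
    -- The classes 2 and `2q` coincide in `ℚ(√q)`. Likewise 2 and `q` coincide in `ℚ(√(2q))` below.
    rcases D.class_q ht with rfl | rfl
    · exact ht.mem
    · have h := ht.mem
      rw [sqrt_natCast_mul, mul_assoc, mul_left_comm] at h
      exact mem_of_sqrt_mul_mem hqp.out.ne_zero h (sqrt_mem_singleton q)
  · obtain ⟨t, ht⟩ := exists_isSquareClass (hns _ m2q) (hsf _ m2q) (hnorm _ m2q (dvd_mul_left _ _))
    rcases D.class_two_q ht with rfl | rfl
    · exact ht.mem
    · refine sqrt_mul_mem_of_sqrt_mul_mem hqp.out.ne_zero ht.mem ?_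
      rw [← sqrt_natCast_mul, mul_comm]
      exact sqrt_mem_singleton _
  · obtain ⟨t, ht⟩ := exists_isSquareClass (hns _ hd1) (hsf _ hd1) hn1
    obtain ⟨i, hi, j, hj, k, hk, l, hl, rfl⟩ := D.exists_form (a := a) (b := 1) (c := 1) (e := 1)
      (by simpa using ht)
    have hkl := D.class_ne_of_sign_pos ha hi hj hk ht rfl hsign fun h => hcl (h ▸ ht)
    exact sqrt_mul_mem_of_sqrt_mul_mem (form_ne_zero i j k l)
      (sqrtField_singleton_le hd1 ht.mem) (sqrt_form_mem_of_ne k2 kq kn hk hl hkl)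
  · obtain ⟨t, ht⟩ := exists_isSquareClass (hns _ hd2) (hsf _ hd2) hn2
    obtain ⟨i, hi, j, hj, k, hk, l, hl, rfl⟩ := D.exists_form (a := 1 - a) (b := 1) (c := 1) (e := 1)
      (by simpa using ht)
    have hsign' : (-1) ^ (1 - a) * χ = -1 := by
      interval_cases a
      · simp at hsign ⊢; exact hsign
      · simp at hsign ⊢; omega
    have hkl := D.class_eq_of_sign_neg hk hl ht rfl hsign'
    subst hkl
    exact mem_of_sqrt_mul_mem (form_ne_zero i j k k)
      (sqrtField_singleton_le hd2 ht.mem) (sqrt_form_mem_of_eq k2 kq kn i j k)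
  · intro hN
    obtain ⟨t, ht⟩ := exists_isSquareClass (hns _ mn) (hsf _ mn) hN
    obtain ⟨i, hi, j, hj, k, hk, l, hl, rfl⟩ := D.exists_form (a := 0) (b := 0) (c := 1) (e := 1)
      (by simpa using ht)
    have hkl := (D.class_rs_ne hi hj hk ht rfl).2
    exact sqrt_mul_mem_of_sqrt_mul_mem (form_ne_zero i j k l)
      (sqrtField_singleton_le mn ht.mem) (sqrt_form_mem_of_ne k2 kq kn hk hl hkl)
  · intro hN
    obtain ⟨t, hts, htp, htm⟩ := exists_class_of_norms_neg (hns _ m2) (hns _ mn) (hns _ m2n)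
      (hsf _ m2) (hsf _ mn) (hsf _ m2n) normEps_two hN hN2n
    have hform : ∃ i < 2, ∃ k < 2, ∃ l < 2, t = 2 ^ i * q ^ 0 * r ^ k * s ^ l := by
      -- The prime 2 is listed twice to reuse the four-prime factorization; squarefreeness forbids
      -- both exponents from being 1.
      obtain ⟨i, hi, j, hj, k, hk, l, hl, h⟩ := hts.exists_eq_prod_pow Nat.prime_two Nat.prime_two
        hrp.out hsp.out fun p hp hpt => by
          rcases hp.dvd_mul.1 (htp p hp hpt) with h | h
          · exact Or.inl ((Nat.prime_dvd_prime_iff_eq hp Nat.prime_two).1 h)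
          rcases hp.dvd_mul.1 h with h | h
          · exact Or.inl ((Nat.prime_dvd_prime_iff_eq hp Nat.prime_two).1 h)
          rcases hp.dvd_mul.1 h with h | h
          · exact Or.inr (Or.inr (Or.inl ((Nat.prime_dvd_prime_iff_eq hp hrp.out).1 h)))
          · exact Or.inr (Or.inr (Or.inr ((Nat.prime_dvd_prime_iff_eq hp hsp.out).1 h)))
      rcases Nat.lt_or_ge (i + j) 2 with hij | hij
      · exact ⟨i + j, hij, k, hk, l, hl, by rw [h]; ring⟩
      · have hi1 : i = 1 := by omega
        have hj1 : j = 1 := by omega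
        subst hi1 hj1
        have := Nat.isUnit_iff.1 (hts 2 ⟨r ^ k * s ^ l, by rw [h]; ring⟩)
        omega
    obtain ⟨i, -, k, hk, l, hl, rfl⟩ := hform
    have f2 : √((2 : ℕ) : ℝ) ∈ sqrtField {2, r * s} := sqrt_mem_sqrtField (by simp)
    have fn : √((r * s : ℕ) : ℝ) ∈ sqrtField {2, r * s} := sqrt_mem_sqrtField (by simp)
    by_cases hkl : k = l
    · subst hkl
      refine Or.inl (mem_of_sqrt_mul_mem (form_ne_zero (q := q) i 0 k k) htm ?_)
      -- Taking `q := 1` removes the condition on `√q`, which is not available in this biquadratic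
      -- field.
      have := sqrt_form_mem_of_eq (q := 1) f2 (by simp) fn i 0 k
      simpa using this
    · refine Or.inr (sqrt_mul_mem_of_sqrt_mul_mem (form_ne_zero (q := q) i 0 k l)
        (sqrtField_mono ?_ htm) (sqrt_form_mem_of_ne k2 kq kn hk hl hkl))
      intro x hx
      rcases hx with rfl | rfl <;> simp

end PrimeData

/-! ### Squares among products of the generators -/

section

variable {K : IntermediateField ℚ ℝ} {σ τ : K ≃ₐ[ℚ] K}

theorem NormSq.zpow_of_even (hσ : ∀ {a b}, Sends σ a b → Sends σ b a) {g : ℝ} (hg : g ∈ K)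
    (hg0 : g ≠ 0) {n : ℤ} (hn : Even n) : NormSq σ (g ^ n) := by
  obtain ⟨m, rfl⟩ := hn
  obtain ⟨g', h⟩ := Sends.exists_of_mem σ hg
  have h1 := h.zpow m
  refine ⟨_, g ^ m * g' ^ m, h.zpow (m + m), ?_,
    mul_ne_zero (zpow_ne_zero _ hg0) (zpow_ne_zero _ (h.ne_zero hg0)), ?_⟩
  · have := h1.mul (hσ h1)
    rwa [mul_comm (g' ^ m)] at this
  · have h0 := h.ne_zero hg0
    rw [zpow_add₀ hg0, zpow_add₀ h0, ← abs_of_nonneg (sq_nonneg (g ^ m * g' ^ m))]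
    congr 1
    ring

/-- The norm of `h` under the group generated by `σ` and `τ` is positive. -/
def PosNorm (σ τ : K ≃ₐ[ℚ] K) (h : ℝ) : Prop := ∃ c, 0 < c ∧ HasNorm σ τ h c

theorem PosNorm.mul {g h : ℝ} (hg : PosNorm σ τ g) (hh : PosNorm σ τ h) : PosNorm σ τ (g * h) := by
  obtain ⟨c, h1, h2⟩ := hg
  obtain ⟨c', h1', h2'⟩ := hh
  exact ⟨_, mul_pos h1 h1', h2.mul h2'⟩

theorem PosNorm.zpow {g : ℝ} (hg : PosNorm σ τ g) (n : ℤ) : PosNorm σ τ (g ^ n) := by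
  obtain ⟨c, h1, h2⟩ := hg
  exact ⟨_, zpow_pos h1 n, h2.zpow n⟩

/-- The product `√e √ε_d` lies in `ℚ(√d)` and is fixed, so negating one factor negates the other. -/
theorem sends_sqrt_eps_neg {d e : ℕ} (he : e ≠ 0) (h : √(e : ℝ) * √(eps d) ∈ sqrtField {d})
    (h1 : Sends σ √(e : ℝ) (-√(e : ℝ))) (h2 : Sends σ √(d : ℝ) √(d : ℝ)) :
    Sends σ √(eps d) (-√(eps d)) := by
  have h3 := sends_of_sends_sqrt σ (S := {d}) (fun _ hx => by obtain rfl := hx; exact h2) _ h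
  have h0 : √(e : ℝ) ≠ 0 := (Real.sqrt_pos.2 (by positivity)).ne'
  have h4 := h3.div h1
  rwa [div_neg, mul_div_cancel_left₀ _ h0] at h4

theorem sqrt_mem_of_sq_eq {v w a : ℝ} {e : ℤ} (hv : v ∈ K) (hw : w ∈ K) (hw0 : w ≠ 0) (ha : a ∈ K)
    (ha0 : 0 < a) (he : Odd e) (h : v ^ 2 = w ^ 2 * a ^ e) : √a ∈ K := by
  obtain ⟨m, rfl⟩ := he
  have h0 := ha0.ne'
  have ham : a ^ m ≠ 0 := zpow_ne_zero m h0
  have h6 : a = (v / (w * a ^ m)) ^ 2 := by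
    rw [div_pow, h, zpow_add₀ h0, two_mul, zpow_add₀ h0, zpow_one]
    field_simp
  have hmem : v / (w * a ^ m) ∈ K := div_mem hv (mul_mem hw (zpow_mem ha m))
  rw [h6, Real.sqrt_sq_eq_abs]
  rcases abs_choice (v / (w * a ^ m)) with h | h <;> rw [h]
  · exact hmem
  · exact neg_mem hmem

end

namespace UnitData

variable {q n m d₁ d₂ : ℕ}

theorem mem_fst (U : UnitData q n m d₁ d₂) : d₁ ∈ radicands 2 q n := by
  rw [mem_radicands]
  rcases U.cases with h | h <;> simp [h.1]

theorem mem_snd (U : UnitData q n m d₁ d₂) : d₂ ∈ radicands 2 q n := by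
  rw [mem_radicands]
  rcases U.cases with h | h <;> simp [h.2]

theorem not_isSquare (U : UnitData q n m d₁ d₂) {d : ℕ} (h : d ∈ radicands 2 q n) : ¬IsSquare d :=
  U.indep.not_isSquare_of_mem_radicands h

theorem eps_mem (_ : UnitData q n m d₁ d₂) {d : ℕ} (h : d ∈ radicands 2 q n) :
    eps d ∈ sqrtField {2, q, n} :=
  _root_.eps_mem (sqrt_mem_of_mem_radicands h)

theorem eps_pos (U : UnitData q n m d₁ d₂) {d : ℕ} (h : d ∈ radicands 2 q n) : 0 < eps d :=
  _root_.eps_pos (U.not_isSquare h)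

theorem sqrt_eps_q_mem (U : UnitData q n m d₁ d₂) : √(eps q) ∈ sqrtField {2, q, n} :=
  mem_of_sqrt_mul_mem two_ne_zero (sqrtField_singleton_le (by simp [radicands]) U.sqrt_q)
    (sqrt_mem_sqrtField (by simp))

theorem sqrt_eps_two_q_mem (U : UnitData q n m d₁ d₂) : √(eps (2 * q)) ∈ sqrtField {2, q, n} :=
  mem_of_sqrt_mul_mem two_ne_zero (sqrtField_singleton_le (by simp [radicands]) U.sqrt_two_q)
    (sqrt_mem_sqrtField (by simp))

theorem m_ne_zero (U : UnitData q n m d₁ d₂) : m ≠ 0 := by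
  rintro rfl
  exact U.notMem (by simp)

theorem sqrt_notMem (U : UnitData q n m d₁ d₂) {x : ℝ} (hx : 0 < x)
    (h : √(m : ℝ) * √x ∈ sqrtField {2, q, n}) : √x ∉ sqrtField {2, q, n} := fun h' => by
  refine U.notMem ?_
  have := div_mem h h'
  rwa [mul_div_cancel_right₀ _ (Real.sqrt_pos.2 hx).ne'] at this

theorem sqrt_mul_mem (U : UnitData q n m d₁ d₂) {x y : ℝ} (hx : 0 < x)
    (h : √(m : ℝ) * √x ∈ sqrtField {2, q, n}) (h' : √(m : ℝ) * √y ∈ sqrtField {2, q, n}) :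
    √(x * y) ∈ sqrtField {2, q, n} := by
  have h0 : (m : ℝ) ≠ 0 := by exact_mod_cast U.m_ne_zero
  have h1 : √(x * y) = √(m : ℝ) * √x * (√(m : ℝ) * √y) / m := by
    rw [Real.sqrt_mul hx.le, eq_div_iff h0]
    nth_rewrite 1 [← Real.mul_self_sqrt (Nat.cast_nonneg (α := ℝ) m)]
    ring
  rw [h1]
  exact div_mem (mul_mem h h') (natCast_mem _ m)

theorem exists_aut (U : UnitData q n m d₁ d₂) {u v w : ℝ} (hu : u = 1 ∨ u = -1)
    (hv : v = 1 ∨ v = -1) (hw : w = 1 ∨ w = -1) :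
    ∃ σ : sqrtField {2, q, n} ≃ₐ[ℚ] sqrtField {2, q, n},
      Sends σ √((2 : ℕ) : ℝ) (u * √((2 : ℕ) : ℝ)) ∧ Sends σ √(q : ℝ) (v * √(q : ℝ)) ∧
      Sends σ √(n : ℝ) (w * √(n : ℝ)) ∧
      Sends σ √((2 * q : ℕ) : ℝ) (u * v * √((2 * q : ℕ) : ℝ)) ∧
      Sends σ √((2 * n : ℕ) : ℝ) (u * w * √((2 * n : ℕ) : ℝ)) ∧
      Sends σ √((q * n : ℕ) : ℝ) (v * w * √((q * n : ℕ) : ℝ)) ∧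
      Sends σ √((2 * q * n : ℕ) : ℝ) (u * v * w * √((2 * q * n : ℕ) : ℝ)) := by
  obtain ⟨σ, h1, h2, h3⟩ := U.indep.exists_aut hu hv hw
  refine ⟨σ, h1, h2, h3, ?_, ?_, ?_, ?_⟩
  · rw [sqrt_natCast_mul]; convert h1.mul h2 using 1; ring
  · rw [sqrt_natCast_mul]; convert h1.mul h3 using 1; ring
  · rw [sqrt_natCast_mul]; convert h2.mul h3 using 1; ring
  · rw [sqrt_natCast_mul, sqrt_natCast_mul]; convert (h1.mul h2).mul h3 using 1; ring

/-- An automorphism with prescribed action on `√2` and `√q` that moves `√d₂`. -/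
theorem exists_aut_snd (U : UnitData q n m d₁ d₂) {u v : ℝ} (hu : u = 1 ∨ u = -1)
    (hv : v = 1 ∨ v = -1) :
    ∃ σ : sqrtField {2, q, n} ≃ₐ[ℚ] sqrtField {2, q, n},
      Sends σ √((2 : ℕ) : ℝ) (u * √((2 : ℕ) : ℝ)) ∧ Sends σ √(q : ℝ) (v * √(q : ℝ)) ∧
      Sends σ √((2 * q : ℕ) : ℝ) (u * v * √((2 * q : ℕ) : ℝ)) ∧
      Sends σ √(d₂ : ℝ) (-√(d₂ : ℝ)) := by
  have huv : -(u * v) = 1 ∨ -(u * v) = -1 := by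
    rcases hu with rfl | rfl <;> rcases hv with rfl | rfl <;> norm_num
  have hv' : -v = 1 ∨ -v = -1 := by rcases hv with rfl | rfl <;> norm_num
  have hvv : v * v = 1 := by rcases hv with rfl | rfl <;> norm_num
  have huu : u * u = 1 := by rcases hu with rfl | rfl <;> norm_num
  rcases U.cases with h | h
  · obtain ⟨σ, h1, h2, -, h3, -, -, h4⟩ := U.exists_aut hu hv huv
    refine ⟨σ, h1, h2, h3, ?_⟩
    rw [h.2]
    convert h4 using 1
    linear_combination √((2 * q * n : ℕ) : ℝ) * (v * v) * huu + √((2 * q * n : ℕ) : ℝ) * hvv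
  · obtain ⟨σ, h1, h2, -, h3, -, h4, -⟩ := U.exists_aut hu hv hv'
    refine ⟨σ, h1, h2, h3, ?_⟩
    rw [h.2]
    convert h4 using 1
    linear_combination √((q * n : ℕ) : ℝ) * hvv

section Even

variable {b : ℕ} {θ v : ℝ} {k0 k1 k2 k3 k4 k5 k6 : ℤ}

/-- Let `σ` negate `√q` and fix `√2` and `√n`. It fixes `A` and inverts `ε_{d₁}`, so `θ σ(θ) = ±A`
for `θ = √(A ε_{d₁})`. The other factors have relative norm plus or minus a square, so an odd
exponent of `θ` would put `√A` into the field. -/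
theorem even_theta_of_sqrt_notMem (U : UnitData q n m d₁ d₂) (hb : b ∈ radicands 2 q n) {A : ℝ}
    (hA0 : 0 < A) (hA : A ∈ sqrtField {2, n}) (hA' : √A ∉ sqrtField {2, q, n})
    (hθ : √(A * eps d₁) ∈ sqrtField {2, q, n}) (hv : v ∈ sqrtField {2, q, n})
    (h : v ^ 2 = eps 2 ^ k0 * eps b ^ k1 * eps d₁ ^ k2 * √(eps q) ^ k3 * √(eps (2 * q)) ^ k4 *
      √(eps d₂) ^ k5 * √(A * eps d₁) ^ k6) : Even k6 := by
  have m2 : 2 ∈ radicands 2 q n := by simp [radicands]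
  have mq : q ∈ radicands 2 q n := by simp [radicands]
  have m2q : 2 * q ∈ radicands 2 q n := by simp [radicands]
  obtain ⟨σ, s2, sq, sn, s2q, -, sqn, s2qn⟩ := U.exists_aut (Or.inl rfl) (Or.inr rfl) (Or.inl rfl)
  simp only [one_mul, mul_one, neg_one_mul] at s2 sq sn s2q sqn s2qn
  have sd1 : Sends σ √(d₁ : ℝ) (-√(d₁ : ℝ)) := by
    rcases U.cases with h | h <;> rw [h.1] <;> assumption
  have sd2 : Sends σ √(d₂ : ℝ) (-√(d₂ : ℝ)) := by
    rcases U.cases with h | h <;> rw [h.2] <;> assumption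
  have n2 := normSq_eps σ (U.not_isSquare m2) (U.squarefree _ m2) (sqrt_mem_of_mem_radicands m2)
  have nb := normSq_eps σ (U.not_isSquare hb) (U.squarefree _ hb) (sqrt_mem_of_mem_radicands hb)
  have n1 := normSq_eps σ (U.not_isSquare U.mem_fst) (U.squarefree _ U.mem_fst)
    (sqrt_mem_of_mem_radicands U.mem_fst)
  have n3 := normSq_sqrt_eps (U.not_isSquare mq) (U.squarefree _ mq) U.norm_q sq U.sqrt_eps_q_mem
  have n4 := normSq_sqrt_eps (U.not_isSquare m2q) (U.squarefree _ m2q) U.norm_two_q s2q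
    U.sqrt_eps_two_q_mem
  have n5 := normSq_sqrt_eps (U.not_isSquare U.mem_snd) (U.squarefree _ U.mem_snd) U.norm_snd sd2
    U.sqrt_snd
  have hE0 := U.eps_pos U.mem_fst
  have hAK : A ∈ sqrtField {2, q, n} := sqrtField_mono (fun x hx => by
    rcases hx with rfl | rfl <;> simp) hA
  have sA : Sends σ A A := sends_of_sends_sqrt σ (S := {2, n})
    (fun x hx => by rcases hx with rfl | rfl <;> assumption) _ hA
  have sE := sends_eps_conj (U.not_isSquare U.mem_fst) (U.squarefree _ U.mem_fst) sd1
  rw [U.norm_fst, Rat.cast_one] at sE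
  have hmul : √(A * eps d₁) * √(A * (1 / eps d₁)) = A := by
    rw [← Real.sqrt_mul (by positivity), show A * eps d₁ * (A * (1 / eps d₁)) = A * A by
      field_simp, Real.sqrt_mul_self hA0.le]
  by_contra hodd
  rw [Int.not_even_iff_odd] at hodd
  have hh := ((((((n2.zpow k0).mul (nb.zpow k1)).mul (n1.zpow k2)).mul (n3.zpow k3)).mul
    (n4.zpow k4)).mul (n5.zpow k5))
  rcases ((sA.mul sE).sqrt_or (by positivity) hθ).2 with hs | hs
  · exact hA' (hh.sqrt_mem_of_odd hv hs hAK hA0 (by rw [hmul, abs_of_pos hA0]) hodd h)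
  · exact hA' (hh.sqrt_mem_of_odd hv hs hAK hA0
      (by rw [mul_neg, hmul, abs_neg, abs_of_pos hA0]) hodd h)

/-- Let `σ` negate `√2` and `τ` negate `√n`, each fixing the other generating roots. For `θ = √(ε_2
ε_n ε_{2n})`, `θ σ(θ) = ±ε_n`, and the norm of `ε_n` makes the norm of `θ` under both automorphisms
equal to -1. All other factors have positive norm. -/
theorem even_theta_of_mem (U : UnitData q n m d₁ d₂) (hb : b ∈ radicands 2 q n)
    (hn : normEps n = -1)
    (hθ : √(eps 2 * eps n * eps (2 * n)) ∈ sqrtField {2, n}) (hv : v ∈ sqrtField {2, q, n})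
    (h : v ^ 2 = eps 2 ^ k0 * eps b ^ k1 * eps d₁ ^ k2 * √(eps q) ^ k3 * √(eps (2 * q)) ^ k4 *
      √(eps d₂) ^ k5 * √(eps 2 * eps n * eps (2 * n)) ^ k6) : Even k6 := by
  have m2 : 2 ∈ radicands 2 q n := by simp [radicands]
  have mn : n ∈ radicands 2 q n := by simp [radicands]
  have m2n : 2 * n ∈ radicands 2 q n := by simp [radicands]
  have mq : q ∈ radicands 2 q n := by simp [radicands]
  have m2q : 2 * q ∈ radicands 2 q n := by simp [radicands]
  obtain ⟨σ, s2, -, sn, -, s2n, -, -⟩ := U.exists_aut (Or.inr rfl) (Or.inl rfl) (Or.inl rfl)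
  obtain ⟨τ, -, -, tn, -, -, -, -⟩ := U.exists_aut (Or.inl rfl) (Or.inl rfl) (Or.inr rfl)
  simp only [one_mul, mul_one, neg_one_mul] at s2 sn s2n tn
  have pe : ∀ {d : ℕ}, d ∈ radicands 2 q n → PosNorm σ τ (eps d) := fun hd =>
    hasNorm_eps σ τ (U.not_isSquare hd) (U.squarefree _ hd) (sqrt_mem_of_mem_radicands hd)
  have ps : ∀ {d : ℕ}, d ∈ radicands 2 q n → normEps d = 1 → √(eps d) ∈ sqrtField {2, q, n} →
      PosNorm σ τ √(eps d) := fun hd hN hK =>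
    hasNorm_sqrt_eps σ τ (U.not_isSquare hd) (U.squarefree _ hd) hN (sqrt_mem_of_mem_radicands hd)
      hK
  obtain ⟨c, hc, hnorm⟩ := (((((((pe m2).zpow k0).mul ((pe hb).zpow k1)).mul
    ((pe U.mem_fst).zpow k2)).mul ((ps mq U.norm_q U.sqrt_eps_q_mem).zpow k3)).mul
    ((ps m2q U.norm_two_q U.sqrt_eps_two_q_mem).zpow k4)).mul
    ((ps U.mem_snd U.norm_snd U.sqrt_snd).zpow k5))
  have hθK : √(eps 2 * eps n * eps (2 * n)) ∈ sqrtField {2, q, n} := sqrtField_mono (fun x hx => by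
    rcases hx with rfl | rfl <;> simp) hθ
  have eA := sends_eps_conj (U.not_isSquare m2) (U.squarefree _ m2) s2
  have eB := sends_eps_self sn
  have eC := sends_eps_conj (U.not_isSquare m2n) (U.squarefree _ m2n) s2n
  have tB := sends_eps_conj (U.not_isSquare mn) (U.squarefree _ mn) tn
  rw [U.norm_two] at eA
  rw [U.norm_two_mul] at eC
  rw [hn] at tB
  push_cast at eA eC tB
  have hA0 := U.eps_pos m2
  have hB0 := U.eps_pos mn
  have hC0 := U.eps_pos m2n
  set A := eps 2
  set B := eps n
  set C := eps (2 * n)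
  have hmul : √(A * B * C) * √(-1 / A * B * (-1 / C)) = B := by
    rw [← Real.sqrt_mul (by positivity), show A * B * C * (-1 / A * B * (-1 / C)) = B * B by
      field_simp, Real.sqrt_mul_self hB0.le]
  have hk : HasNorm σ τ √(A * B * C) (-1) := by
    rcases (((eA.mul eB).mul eC).sqrt_or (by positivity) hθK).2 with hs | hs
    · exact ⟨_, -1 / B, hs, by rwa [hmul], by rw [hmul]; field_simp⟩
    · refine ⟨_, -(-1 / B), hs, by rw [mul_neg, hmul]; exact tB.neg, ?_⟩
      rw [mul_neg, mul_neg, neg_mul, hmul]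
      field_simp
  exact hnorm.even_of_neg hv hc hk (by norm_num) h

/-- With the exponent of `θ` known to be even, the others follow one after another. Each
automorphism is chosen to detect one exponent; factors whose exponents are already even do no harm
under any automorphism. -/
theorem even_exponents (U : UnitData q n m d₁ d₂) (hb : b = n ∨ b = 2 * n) (hbN : normEps b = -1)
    (hθ : θ ∈ sqrtField {2, q, n}) (hθ0 : θ ≠ 0) (hv : v ∈ sqrtField {2, q, n})
    (h6 : Even k6)
    (h : v ^ 2 = eps 2 ^ k0 * eps b ^ k1 * eps d₁ ^ k2 * √(eps q) ^ k3 * √(eps (2 * q)) ^ k4 *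
      √(eps d₂) ^ k5 * θ ^ k6) :
    Even k0 ∧ Even k1 ∧ Even k2 ∧ Even k3 ∧ Even k4 ∧ Even k5 := by
  have m2 : 2 ∈ radicands 2 q n := by simp [radicands]
  have mb : b ∈ radicands 2 q n := by rcases hb with rfl | rfl <;> simp [radicands]
  have mq : q ∈ radicands 2 q n := by simp [radicands]
  have m2q : 2 * q ∈ radicands 2 q n := by simp [radicands]
  have ne : ∀ (σ : sqrtField {2, q, n} ≃ₐ[ℚ] sqrtField {2, q, n}) {d : ℕ}, d ∈ radicands 2 q n →
      NormSq σ (eps d) := fun σ d hd =>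
    normSq_eps σ (U.not_isSquare hd) (U.squarefree _ hd) (sqrt_mem_of_mem_radicands hd)
  have hx0 : ∀ {d : ℕ}, d ∈ radicands 2 q n → √(eps d) ≠ 0 := fun hd =>
    (Real.sqrt_pos.2 (U.eps_pos hd)).ne'
  have hinv : ∀ (σ : sqrtField {2, q, n} ≃ₐ[ℚ] sqrtField {2, q, n}) {a b}, Sends σ a b →
    Sends σ b a := fun σ {a b} => aut_involutive σ
  -- This `σ` negates `√2` and fixes `√q`, so it negates `√ε_q`. The sign on `√n` is chosen to move
  -- `√d₂`; since `√(2q)` also moves, the remaining roots have norm `±1`.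
  have h3 : Even k3 := by
    obtain ⟨σ, s2, sq, s2q, sd⟩ := U.exists_aut_snd (u := -1) (v := 1) (Or.inr rfl) (Or.inl rfl)
    simp only [one_mul, mul_one, neg_one_mul] at s2 sq s2q
    have n4 := normSq_sqrt_eps (U.not_isSquare m2q) (U.squarefree _ m2q) U.norm_two_q s2q
      U.sqrt_eps_two_q_mem
    have n5 := normSq_sqrt_eps (U.not_isSquare U.mem_snd) (U.squarefree _ U.mem_snd) U.norm_snd sd
      U.sqrt_snd
    refine NormSq.even_of_sends_neg (hinv σ) hv ((((((((ne σ m2).zpow k0).mul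
      ((ne σ mb).zpow k1)).mul ((ne σ U.mem_fst).zpow k2)).mul (n4.zpow k4)).mul (n5.zpow k5))).mul
      (NormSq.zpow_of_even (hinv σ) hθ hθ0 h6))
      (sends_sqrt_eps_neg two_ne_zero U.sqrt_q s2 sq) (hx0 mq) ?_
    rw [h]; ring
  -- Negating both `√2` and `√q` fixes `√(2q)` and hence negates `√ε_{2q}`.
  have h4 : Even k4 := by
    obtain ⟨σ, s2, sq, s2q, sd⟩ := U.exists_aut_snd (u := -1) (v := -1) (Or.inr rfl) (Or.inr rfl)
    simp only [one_mul, neg_one_mul, neg_neg] at s2 sq s2q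
    have n5 := normSq_sqrt_eps (U.not_isSquare U.mem_snd) (U.squarefree _ U.mem_snd) U.norm_snd sd
      U.sqrt_snd
    refine NormSq.even_of_sends_neg (hinv σ) hv (((((((ne σ m2).zpow k0).mul
      ((ne σ mb).zpow k1)).mul ((ne σ U.mem_fst).zpow k2)).mul
      (NormSq.zpow_of_even (hinv σ) U.sqrt_eps_q_mem (hx0 mq) h3)).mul (n5.zpow k5)).mul
      (NormSq.zpow_of_even (hinv σ) hθ hθ0 h6))
      (sends_sqrt_eps_neg two_ne_zero U.sqrt_two_q s2 s2q) (hx0 m2q) ?_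
    rw [h]; ring
  have h5 : Even k5 := by
    obtain ⟨σ, -, sd⟩ := exists_sends_neg (K := sqrtField {2, q, n})
      (sqrtField_singleton_le U.mem_snd) (U.eps_pos U.mem_snd).le (isUnitOf_eps d₂).2.1 U.sqrt_snd
      (sqrt_eps_notMem (U.not_isSquare U.mem_snd))
    refine NormSq.even_of_sends_neg (hinv σ) hv (((((((ne σ m2).zpow k0).mul
      ((ne σ mb).zpow k1)).mul ((ne σ U.mem_fst).zpow k2)).mul
      (NormSq.zpow_of_even (hinv σ) U.sqrt_eps_q_mem (hx0 mq) h3)).mul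
      (NormSq.zpow_of_even (hinv σ) U.sqrt_eps_two_q_mem (hx0 m2q) h4)).mul
      (NormSq.zpow_of_even (hinv σ) hθ hθ0 h6)) sd (hx0 U.mem_snd) ?_
    rw [h]; ring
  have pos1 : ∀ σ : sqrtField {2, q, n} ≃ₐ[ℚ] sqrtField {2, q, n}, PosImage σ
      (eps d₁ ^ k2 * √(eps q) ^ k3 * √(eps (2 * q)) ^ k4 * √(eps d₂) ^ k5 * θ ^ k6) := fun σ =>
    ((((posImage_eps σ (U.not_isSquare U.mem_fst) (U.squarefree _ U.mem_fst) U.norm_fst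
      (sqrt_mem_of_mem_radicands U.mem_fst)).zpow k2).mul
      (PosImage.zpow_of_even σ U.sqrt_eps_q_mem (hx0 mq) h3)).mul
      (PosImage.zpow_of_even σ U.sqrt_eps_two_q_mem (hx0 m2q) h4)).mul
      (PosImage.zpow_of_even σ U.sqrt_snd (hx0 U.mem_snd) h5) |>.mul
      (PosImage.zpow_of_even σ hθ hθ0 h6)
  have hneg : ∀ {σ : sqrtField {2, q, n} ≃ₐ[ℚ] sqrtField {2, q, n}} {d : ℕ},
      d ∈ radicands 2 q n → normEps d = -1 → Sends σ √(d : ℝ) (-√(d : ℝ)) →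
      ∃ y, Sends σ (eps d) y ∧ y < 0 := fun {σ d} hd hN hs => by
    refine ⟨_, sends_eps_conj (U.not_isSquare hd) (U.squarefree _ hd) hs, ?_⟩
    rw [hN]
    exact div_neg_of_neg_of_pos (by norm_num) (U.eps_pos hd)
  -- Negating `√n` alone makes `ε_b` negative. The factor `ε_2` stays fixed and all remaining
  -- factors have positive image.
  have h1 : Even k1 := by
    obtain ⟨σ, s2, -, sn, -, s2n, -, -⟩ := U.exists_aut (Or.inl rfl) (Or.inl rfl) (Or.inr rfl)
    simp only [one_mul, neg_one_mul] at s2 sn s2n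
    have sb : Sends σ √(b : ℝ) (-√(b : ℝ)) := by rcases hb with rfl | rfl <;> assumption
    obtain ⟨y, hy, hy0⟩ := hneg mb hbN sb
    have p2 : PosImage σ (eps 2) := ⟨_, sends_eps_self s2, U.eps_pos m2⟩
    refine PosImage.even_of_neg hv ((p2.zpow k0).mul (pos1 σ)) hy hy0 ?_
    rw [h]; ring
  have h0 : Even k0 := by
    obtain ⟨σ, s2, -⟩ := U.exists_aut (Or.inr rfl) (Or.inl rfl) (Or.inl rfl)
    simp only [neg_one_mul] at s2
    obtain ⟨y, hy, hy0⟩ := hneg m2 U.norm_two s2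
    refine PosImage.even_of_neg hv ((PosImage.zpow_of_even σ (U.eps_mem mb) (U.eps_pos mb).ne'
      h1).mul (pos1 σ)) hy hy0 ?_
    rw [h]; ring
  refine ⟨h0, h1, ?_, h3, h4, h5⟩
  -- All other exponents are now even, so an odd exponent of `ε_{d₁}` would put `√ε_{d₁}` into the
  -- field.
  by_contra hodd
  rw [Int.not_even_iff_odd] at hodd
  have e0 := (U.eps_pos m2).ne'
  have e1 := (U.eps_pos mb).ne'
  have e3 := hx0 mq
  have e4 := hx0 m2q
  have e5 := hx0 U.mem_snd
  have w0 := U.eps_mem m2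
  have w1 := U.eps_mem mb
  have w3 := U.sqrt_eps_q_mem
  have w4 := U.sqrt_eps_two_q_mem
  have w5 := U.sqrt_snd
  obtain ⟨l0, rfl⟩ := h0
  obtain ⟨l1, rfl⟩ := h1
  obtain ⟨l3, rfl⟩ := h3
  obtain ⟨l4, rfl⟩ := h4
  obtain ⟨l5, rfl⟩ := h5
  obtain ⟨l6, rfl⟩ := h6
  refine U.sqrt_notMem (U.eps_pos U.mem_fst) U.sqrt_fst (sqrt_mem_of_sq_eq hv
    (w := eps 2 ^ l0 * eps b ^ l1 * √(eps q) ^ l3 * √(eps (2 * q)) ^ l4 * √(eps d₂) ^ l5 * θ ^ l6)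
    (mul_mem (mul_mem (mul_mem (mul_mem (mul_mem (zpow_mem w0 _) (zpow_mem w1 _)) (zpow_mem w3 _))
      (zpow_mem w4 _)) (zpow_mem w5 _)) (zpow_mem hθ _)) ?_ (U.eps_mem U.mem_fst)
    (U.eps_pos U.mem_fst) hodd ?_)
  · simp only [mul_ne_zero_iff]
    exact ⟨⟨⟨⟨⟨zpow_ne_zero _ e0, zpow_ne_zero _ e1⟩, zpow_ne_zero _ e3⟩, zpow_ne_zero _ e4⟩,
      zpow_ne_zero _ e5⟩, zpow_ne_zero _ hθ0⟩
  · rw [h, zpow_add₀ e0, zpow_add₀ e1, zpow_add₀ e3, zpow_add₀ e4, zpow_add₀ e5, zpow_add₀ hθ0]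
    ring

end Even

end UnitData

/-! ### Groups of signed monomials and their indices -/

section ExpGroup

variable {n : ℕ} {e : Fin n → ℝ}

/-- The group of all `± ∏ eᵢ^{kᵢ}` where `kᵢ` is even for `i ∈ S`. -/
def expGroup (e : Fin n → ℝ) (he : ∀ i, 0 < e i) (S : Finset (Fin n)) : Subgroup ℝˣ where
  carrier := {u | ∃ k : Fin n → ℤ, (∀ i ∈ S, Even (k i)) ∧ |(u : ℝ)| = ∏ i, e i ^ k i}
  one_mem' := ⟨0, by simp, by simp⟩
  mul_mem' := by
    rintro u v ⟨k, hk, h⟩ ⟨l, hl, h'⟩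
    refine ⟨k + l, fun i hi => (hk i hi).add (hl i hi), ?_⟩
    rw [Units.val_mul, abs_mul, h, h', ← Finset.prod_mul_distrib]
    exact Finset.prod_congr rfl fun i _ => (zpow_add₀ (he i).ne' _ _).symm
  inv_mem' := by
    rintro u ⟨k, hk, h⟩
    refine ⟨-k, fun i hi => (hk i hi).neg, ?_⟩
    rw [Units.val_inv_eq_inv_val, abs_inv, h, ← Finset.prod_inv_distrib]
    exact Finset.prod_congr rfl fun i _ => (zpow_neg _ _).symm

theorem neg_one_mem_expGroup (he : ∀ i, 0 < e i) (S : Finset (Fin n)) :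
    (-1 : ℝˣ) ∈ expGroup e he S := ⟨0, by simp, by simp⟩

/-- If all `± ∏ eᵢ^{kᵢ}` with `kᵢ` even for `i ∈ S` have to be in `H`, it suffices that `-1`, the
`eᵢ` with `i ∉ S` and the `eᵢ²` with `i ∈ S` are in `H`. -/
theorem expGroup_le {he : ∀ i, 0 < e i} {S : Finset (Fin n)} {H : Subgroup ℝˣ}
    (hneg : (-1 : ℝˣ) ∈ H) (h1 : ∀ i ∉ S, Units.mk0 (e i) (he i).ne' ∈ H)
    (h2 : ∀ i ∈ S, Units.mk0 (e i) (he i).ne' ^ 2 ∈ H) : expGroup e he S ≤ H := by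
  rintro u ⟨k, hk, h⟩
  have hp : ∏ i, Units.mk0 (e i) (he i).ne' ^ k i ∈ H := by
    refine H.prod_mem fun i _ => ?_
    by_cases hi : i ∈ S
    · obtain ⟨l, hl⟩ := hk i hi
      rw [hl, ← two_mul, zpow_mul]
      exact H.zpow_mem (h2 i hi) l
    · exact H.zpow_mem (h1 i hi) _
  have hval : ((∏ i, Units.mk0 (e i) (he i).ne' ^ k i : ℝˣ) : ℝ) = ∏ i, e i ^ k i := by
    simp [Units.coe_prod]
  rcases abs_choice (u : ℝ) with h' | h'
  · convert hp using 1
    ext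
    rw [hval, ← h, h']
  · convert H.mul_mem hneg hp using 1
    ext
    rw [Units.val_mul, hval, ← h, h']
    simp

theorem generatedBy_eq_expGroup (he : ∀ i, 0 < e i) :
    generatedBy ({-1} ∪ Set.range e) = expGroup e he ∅ := by
  apply le_antisymm
  · refine (Subgroup.closure_le _).2 ?_
    rintro u (h | ⟨i, h⟩)
    · exact ⟨0, by simp, by rw [show (u : ℝ) = -1 from h]; simp⟩
    · classical
      refine ⟨Pi.single i 1, by simp, ?_⟩
      rw [Finset.prod_eq_single i (fun j _ hj => by simp [Pi.single_eq_of_ne hj]) (by simp), ← h,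
        abs_of_pos (he i)]
      simp
  · refine expGroup_le (Subgroup.subset_closure (by simp)) (fun i _ => ?_) (by simp)
    exact Subgroup.subset_closure (Or.inr ⟨i, rfl⟩)

variable {K : IntermediateField ℚ ℝ}

/-- Infinite descent: since `1 = 1²`, the exponents of a relation are even, and halving them gives
another relation because the `eᵢ` are positive. So every power of 2 divides each exponent. -/
theorem eq_zero_of_prod_zpow_eq_one (he : ∀ i, 0 < e i)
    (hsq : ∀ v ∈ K, ∀ k : Fin n → ℤ, v ^ 2 = ∏ i, e i ^ k i → ∀ i, Even (k i))
    {k : Fin n → ℤ} (hk : ∏ i, e i ^ k i = 1) : k = 0 := by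
  have key : ∀ (N : ℕ) (k : Fin n → ℤ), ∏ i, e i ^ k i = 1 → ∀ i, (2 : ℤ) ^ N ∣ k i := by
    intro N
    induction N with
    | zero => simp
    | succ N ih =>
      intro k hk i
      choose l hl using hsq 1 (one_mem _) k (by rw [hk, one_pow])
      have h1 : (∏ i, e i ^ l i) ^ 2 = 1 := by
        rw [← hk, ← Finset.prod_pow]
        refine Finset.prod_congr rfl fun i _ => ?_
        rw [hl, zpow_add₀ (he i).ne', sq]
      have h2 : ∏ i, e i ^ l i = 1 :=
        (pow_eq_one_iff_of_nonneg (Finset.prod_nonneg fun i _ => (zpow_pos (he i) _).le)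
          two_ne_zero).1 h1
      rw [hl, ← two_mul, pow_succ']
      exact mul_dvd_mul_left 2 (ih l h2 i)
  funext i
  refine Int.eq_zero_of_abs_lt_dvd (key (k i).natAbs k hk i) ?_
  rw [Int.abs_eq_natAbs]
  exact_mod_cast Nat.lt_two_pow_self

theorem prod_zpow_injective (he : ∀ i, 0 < e i)
    (h0 : ∀ k : Fin n → ℤ, ∏ i, e i ^ k i = 1 → k = 0)
    {k l : Fin n → ℤ} (h : ∏ i, e i ^ k i = ∏ i, e i ^ l i) : k = l := by
  refine sub_eq_zero.1 (h0 (k - l) ?_)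
  have : ∏ i, e i ^ (k - l) i = (∏ i, e i ^ k i) / ∏ i, e i ^ l i := by
    rw [← Finset.prod_div_distrib]
    exact Finset.prod_congr rfl fun i _ => zpow_sub₀ (he i).ne' _ _
  rw [this, h]
  exact div_self (Finset.prod_ne_zero_iff.2 fun i _ => zpow_ne_zero _ (he i).ne')

/-- By independence the exponents of an element are unique. The parity of the `j`-th one therefore
separates the two cosets, and `eⱼ` represents the nontrivial coset. -/
theorem relIndex_expGroup_insert (he : ∀ i, 0 < e i)
    (h0 : ∀ k : Fin n → ℤ, ∏ i, e i ^ k i = 1 → k = 0) {S : Finset (Fin n)} {j : Fin n}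
    (hj : j ∉ S) : (expGroup e he (insert j S)).relIndex (expGroup e he S) = 2 := by
  have hsingle : ∏ i, e i ^ (Pi.single j 1 : Fin n → ℤ) i = e j := by
    rw [Finset.prod_eq_single j (fun i _ hi => by simp [Pi.single_eq_of_ne hi]) (by simp)]
    simp
  have hmem : Units.mk0 (e j) (he j).ne' ∈ expGroup e he S := by
    refine ⟨Pi.single j 1, fun i hi => ?_, ?_⟩
    · rw [Pi.single_eq_of_ne (by rintro rfl; exact hj hi)]
      exact Even.zero
    · rw [hsingle, Units.val_mk0, abs_of_pos (he j)]
  have key : ∀ b ∈ expGroup e he S, ∀ k : Fin n → ℤ, |(b : ℝ)| = ∏ i, e i ^ k i →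
      (b ∈ expGroup e he (insert j S) ↔ Even (k j)) := by
    rintro b ⟨l, hl, hbl⟩ k hbk
    obtain rfl := prod_zpow_injective he h0 (hbl.symm.trans hbk)
    constructor
    · rintro ⟨l', hl', hbl'⟩
      obtain rfl := prod_zpow_injective he h0 (hbl.symm.trans hbl')
      exact hl' j (Finset.mem_insert_self j S)
    · intro h
      refine ⟨l, fun i hi => ?_, hbl⟩
      rcases Finset.mem_insert.1 hi with rfl | hi
      · exact h
      · exact hl i hi
  rw [Subgroup.relIndex_eq_two_iff]
  refine ⟨Units.mk0 (e j) (he j).ne', hmem, fun b hb => ?_⟩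
  obtain ⟨k, hk, hbk⟩ := id hb
  have hbe : |((b * Units.mk0 (e j) (he j).ne' : ℝˣ) : ℝ)| =
      ∏ i, e i ^ (k + Pi.single j 1 : Fin n → ℤ) i := by
    have : ∏ i, e i ^ (k + Pi.single j 1 : Fin n → ℤ) i =
        (∏ i, e i ^ k i) * ∏ i, e i ^ (Pi.single j 1 : Fin n → ℤ) i := by
      rw [← Finset.prod_mul_distrib]
      exact Finset.prod_congr rfl fun i _ => zpow_add₀ (he i).ne' _ _
    rw [this, hsingle, Units.val_mul, abs_mul, hbk, Units.val_mk0, abs_of_pos (he j)]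
  rw [key b hb k hbk, key _ ((expGroup e he S).mul_mem hb hmem) _ hbe]
  simp only [Pi.add_apply, Pi.single_eq_same, Int.even_add_one]
  rcases em (Even (k j)) with h | h
  · exact Or.inr ⟨h, not_not.2 h⟩
  · exact Or.inl ⟨h, h⟩

theorem expGroup_anti (he : ∀ i, 0 < e i) {S T : Finset (Fin n)} (h : S ⊆ T) :
    expGroup e he T ≤ expGroup e he S := by
  rintro u ⟨k, hk, hu⟩
  exact ⟨k, fun i hi => hk i (h hi), hu⟩

theorem relIndex_expGroup (he : ∀ i, 0 < e i)
    (h0 : ∀ k : Fin n → ℤ, ∏ i, e i ^ k i = 1 → k = 0) (S : Finset (Fin n)) :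
    (expGroup e he S).relIndex (expGroup e he ∅) = 2 ^ S.card := by
  induction S using Finset.induction_on with
  | empty => simp
  | insert j S hj ih =>
    rw [← Subgroup.relIndex_mul_relIndex _ _ _ (expGroup_anti he (Finset.subset_insert j S))
      (expGroup_anti he (Finset.empty_subset S)), ih, relIndex_expGroup_insert he h0 hj,
      Finset.card_insert_of_notMem hj, pow_succ']

/-- The parity hypothesis lets square roots be extracted inside the monomial group. Doing so twice
descends from `u⁴` to `u`. -/
theorem unitGroup_eq_expGroup (he : ∀ i, 0 < e i) (hu : ∀ i, IsUnitOf K (e i))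
    (hsq : ∀ v ∈ K, ∀ k : Fin n → ℤ, v ^ 2 = ∏ i, e i ^ k i → ∀ i, Even (k i))
    (h4 : ∀ u ∈ unitGroup K, u ^ 4 ∈ expGroup e he ∅) : unitGroup K = expGroup e he ∅ := by
  have hneg : (-1 : ℝˣ) ∈ unitGroup K := mem_unitGroup.2 (by simpa using IsUnitOf.one.neg)
  apply le_antisymm
  · have key : ∀ u ∈ unitGroup K, u ^ 2 ∈ expGroup e he ∅ → u ∈ expGroup e he ∅ := by
      rintro u hu ⟨k, -, hk⟩
      have hsq2 : (u : ℝ) ^ 2 = ∏ i, e i ^ k i := by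
        rw [← hk, Units.val_pow_eq_pow_val, abs_of_nonneg (sq_nonneg _)]
      choose l hl using hsq u (mem_unitGroup.1 hu).2.1 k hsq2
      refine ⟨l, by simp, ?_⟩
      have h1 : |(u : ℝ)| ^ 2 = (∏ i, e i ^ l i) ^ 2 := by
        rw [sq_abs, hsq2, ← Finset.prod_pow]
        refine Finset.prod_congr rfl fun i _ => ?_
        rw [hl, zpow_add₀ (he i).ne', sq]
      exact (pow_left_inj₀ (abs_nonneg _) (Finset.prod_nonneg fun i _ => (zpow_pos (he i) _).le)
        two_ne_zero).1 h1
    intro u hu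
    refine key u hu (key _ ((unitGroup K).pow_mem hu 2) ?_)
    rw [← pow_mul]
    exact h4 u hu
  · exact expGroup_le hneg (fun i _ => mem_unitGroup.2 (hu i)) (by simp)

end ExpGroup

/-! ### Fundamental systems and the unit index -/

namespace UnitData

variable {q n m d₁ d₂ b c : ℕ} {θ : ℝ}

/-- Of `ε_n` and `ε_{2n}`, one of norm -1 is kept as the generator `ε_b`. The other, `ε_c`, is
replaced by `θ`, whose square is `ε_c` times a monomial in retained units. This covers all three
cases at once. -/
theorem isFundamentalSystem_and_unitIndex (U : UnitData q n m d₁ d₂)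
    (hbc : b = n ∧ c = 2 * n ∨ b = 2 * n ∧ c = n) (hbN : normEps b = -1)
    (hθ : θ ∈ sqrtField {2, q, n}) (hθ0 : 0 < θ) {i j k : ℤ}
    (hθ2 : θ ^ 2 = eps c * (eps 2 ^ i * eps b ^ j * eps d₁ ^ k))
    (heven : ∀ v ∈ sqrtField {2, q, n}, ∀ k0 k1 k2 k3 k4 k5 k6 : ℤ,
      v ^ 2 = eps 2 ^ k0 * eps b ^ k1 * eps d₁ ^ k2 * √(eps q) ^ k3 * √(eps (2 * q)) ^ k4 *
        √(eps d₂) ^ k5 * θ ^ k6 → Even k6) :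
    IsFundamentalSystem (sqrtField {2, q, n})
      ![eps 2, eps b, eps d₁, √(eps q), √(eps (2 * q)), √(eps d₂), θ] ∧
    unitIndex (sqrtField {2, q, n}) = 2 ^ 4 := by
  have m2 : 2 ∈ radicands 2 q n := by simp [radicands]
  have mb : b ∈ radicands 2 q n := by rcases hbc with ⟨rfl, -⟩ | ⟨rfl, -⟩ <;> simp [radicands]
  have mc : c ∈ radicands 2 q n := by rcases hbc with ⟨-, rfl⟩ | ⟨-, rfl⟩ <;> simp [radicands]
  have mq : q ∈ radicands 2 q n := by simp [radicands]
  have m2q : 2 * q ∈ radicands 2 q n := by simp [radicands]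
  have p2 := U.eps_pos m2
  have pb := U.eps_pos mb
  have pc := U.eps_pos mc
  have p1 := U.eps_pos U.mem_fst
  have pq := U.eps_pos mq
  have p2q := U.eps_pos m2q
  have p5 := U.eps_pos U.mem_snd
  have hunit : ∀ {d}, d ∈ radicands 2 q n → IsUnitOf (sqrtField {2, q, n}) (eps d) := fun hd =>
    (isUnitOf_eps _).mono (sqrtField_singleton_le hd)
  set e : Fin 7 → ℝ := ![eps 2, eps b, eps d₁, √(eps q), √(eps (2 * q)), √(eps d₂), θ] with he_def
  have he : ∀ i, 0 < e i := by
    simp only [Fin.forall_fin_succ, he_def]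
    exact ⟨p2, pb, p1, Real.sqrt_pos.2 pq, Real.sqrt_pos.2 p2q, Real.sqrt_pos.2 p5, hθ0, nofun⟩
  have hprod : ∀ k : Fin 7 → ℤ, ∏ i, e i ^ k i = eps 2 ^ k 0 * eps b ^ k 1 * eps d₁ ^ k 2 *
      √(eps q) ^ k 3 * √(eps (2 * q)) ^ k 4 * √(eps d₂) ^ k 5 * θ ^ k 6 := fun k => by
    rw [Fin.prod_univ_seven]
    rfl
  have hu : ∀ i, IsUnitOf (sqrtField {2, q, n}) (e i) := by
    simp only [Fin.forall_fin_succ, he_def]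
    refine ⟨hunit m2, hunit mb, hunit U.mem_fst, (hunit mq).sqrt pq.le U.sqrt_eps_q_mem,
      (hunit m2q).sqrt p2q.le U.sqrt_eps_two_q_mem, (hunit U.mem_snd).sqrt p5.le U.sqrt_snd,
      IsUnitOf.of_pow two_ne_zero (K := sqrtField {2, q, n}) ?_ hθ, nofun⟩
    have hz : ∀ {x : ℝ} (t : ℤ), IsUnitOf (sqrtField {2, q, n}) x →
        IsUnitOf (sqrtField {2, q, n}) (x ^ t) := fun {x} t hx => by
      have hmem : Units.mk0 x hx.1 ∈ unitGroup (sqrtField {2, q, n}) := mem_unitGroup.2 hx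
      have := (unitGroup (sqrtField {2, q, n})).zpow_mem hmem t
      simpa using mem_unitGroup.1 this
    change IsUnitOf _ (θ ^ 2)
    rw [hθ2]
    exact (hunit mc).mul (((hz i (hunit m2)).mul (hz j (hunit mb))).mul (hz k (hunit U.mem_fst)))
  have hsq : ∀ v ∈ sqrtField {2, q, n}, ∀ k : Fin 7 → ℤ, v ^ 2 = ∏ i, e i ^ k i →
      ∀ i, Even (k i) := by
    intro v hv k hk
    rw [hprod] at hk
    have h6 := heven v hv _ _ _ _ _ _ _ hk
    obtain ⟨h0, h1, h2, h3, h4, h5⟩ := U.even_exponents (hbc.imp And.left And.left) hbN hθ hθ0.ne'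
      hv h6 hk
    simp only [Fin.forall_fin_succ]
    exact ⟨h0, h1, h2, h3, h4, h5, h6, nofun⟩
  have h0 : ∀ k : Fin 7 → ℤ, ∏ i, e i ^ k i = 1 → k = 0 := fun k hk =>
    eq_zero_of_prod_zpow_eq_one he hsq hk
  have hc : eps c = eps 2 ^ (-i) * eps b ^ (-j) * eps d₁ ^ (-k) * θ ^ 2 := by
    rw [hθ2, zpow_neg, zpow_neg, zpow_neg]
    field_simp
  -- Positions 3 to 6 hold `√ε_q`, `√ε_{2q}`, `√ε_{d₂}` and `θ`: only their squares come from the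
  -- quadratic subfields.
  have hS : ∀ k : Fin 7 → ℤ, Even (k 3) → Even (k 4) → Even (k 5) → Even (k 6) →
      ∀ i ∈ ({3, 4, 5, 6} : Finset (Fin 7)), Even (k i) := by
    intro k h3 h4 h5 h6 i hi
    simp only [Finset.mem_insert, Finset.mem_singleton] at hi
    rcases hi with rfl | rfl | rfl | rfl <;> assumption
  have hlist : ∀ d ∈ radicands 2 q n, d = 2 ∨ d = b ∨ d = c ∨ d = d₁ ∨ d = q ∨ d = 2 * q ∨
      d = d₂ := by
    intro d hd
    rw [mem_radicands] at hd
    have h1 := U.cases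
    omega
  have hexp : ∀ d ∈ radicands 2 q n, ∃ l : Fin 7 → ℤ,
      (∀ i ∈ ({3, 4, 5, 6} : Finset (Fin 7)), Even (l i)) ∧ eps d = ∏ i, e i ^ l i := by
    have key : ∀ {x : ℝ} (l : Fin 7 → ℤ), Even (l 3) → Even (l 4) → Even (l 5) → Even (l 6) →
        x = eps 2 ^ l 0 * eps b ^ l 1 * eps d₁ ^ l 2 * √(eps q) ^ l 3 * √(eps (2 * q)) ^ l 4 *
        √(eps d₂) ^ l 5 * θ ^ l 6 → ∃ l : Fin 7 → ℤ,
        (∀ i ∈ ({3, 4, 5, 6} : Finset (Fin 7)), Even (l i)) ∧ x = ∏ i, e i ^ l i :=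
      fun l h3 h4 h5 h6 hx => ⟨l, hS l h3 h4 h5 h6, by rw [hprod, hx]⟩
    intro d hd
    have hs : ∀ {x : ℝ}, 0 < x → √x ^ (2 : ℤ) = x := fun hx => by
      rw [← Nat.cast_ofNat, zpow_natCast, Real.sq_sqrt hx.le]
    have ev2 : Even (2 : ℤ) := even_two
    have ev0 : Even (0 : ℤ) := Even.zero
    rcases hlist d hd with h | h | h | h | h | h | h <;> rw [h]
    · exact key ![1, 0, 0, 0, 0, 0, 0] ev0 ev0 ev0 ev0 (by simp)
    · exact key ![0, 1, 0, 0, 0, 0, 0] ev0 ev0 ev0 ev0 (by simp)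
    -- These exponents solve the defining relation of `θ²` for `ε_c`.
    · refine key ![-i, -j, -k, 0, 0, 0, 2] ev0 ev0 ev0 ev2 ?_
      rw [hc]
      simp only [Matrix.cons_val, zpow_zero, mul_one]
      norm_cast
    · exact key ![0, 0, 1, 0, 0, 0, 0] ev0 ev0 ev0 ev0 (by simp)
    · exact key ![0, 0, 0, 2, 0, 0, 0] ev2 ev0 ev0 ev0 (by simp [hs pq])
    · exact key ![0, 0, 0, 0, 2, 0, 0] ev0 ev2 ev0 ev0 (by simp [hs p2q])
    · exact key ![0, 0, 0, 0, 0, 2, 0] ev0 ev0 ev2 ev0 (by simp [hs p5])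
  have hle : ∀ d ∈ radicands 2 q n,
      unitGroup (sqrtField {d}) ≤ expGroup e he ({3, 4, 5, 6} : Finset (Fin 7)) := by
    intro d hd
    refine mem_closure_of_isUnitOf (U.not_isSquare hd) (neg_one_mem_expGroup he _) ?_
    obtain ⟨l, hl, h⟩ := hexp d hd
    exact ⟨l, hl, by rw [Units.val_mk0, abs_of_pos (U.eps_pos hd), h]⟩
  have hn0 : ∀ {d : ℕ}, d ∈ radicands 2 q n → d ≠ 0 := fun hd h => by
    subst h
    exact U.not_isSquare hd ⟨0, rfl⟩
  have hE : unitGroup (sqrtField {2, q, n}) = expGroup e he ∅ := by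
    refine unitGroup_eq_expGroup he hu hsq fun u hu' => ?_
    exact pow_four_mem (mem_unitGroup.1 hu') (hn0 m2) (hn0 mq) (hn0 (by simp [radicands]))
      (fun d hd => (hle d hd).trans (expGroup_anti he (Finset.empty_subset _))) rfl
  refine ⟨⟨hE.trans (generatedBy_eq_expGroup he).symm, h0⟩, ?_⟩
  have hQ : quadraticUnits (sqrtField {2, q, n}) =
      expGroup e he ({3, 4, 5, 6} : Finset (Fin 7)) := by
    rw [U.indep.quadraticUnits_eq]
    apply le_antisymm (iSup₂_le hle)
    have hmem : ∀ {d : ℕ} {u : ℝˣ}, d ∈ radicands 2 q n → (u : ℝ) = eps d →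
        u ∈ ⨆ d ∈ radicands 2 q n, unitGroup (sqrtField {d}) := fun {d u} hd h =>
      (le_iSup₂_of_le d hd le_rfl : unitGroup (sqrtField {d}) ≤ _)
        (mem_unitGroup.2 (h ▸ isUnitOf_eps d))
    refine expGroup_le ?_ ?_ ?_
    · exact (le_iSup₂_of_le 2 m2 le_rfl : unitGroup (sqrtField {2}) ≤ _)
        (mem_unitGroup.2 (by simpa using IsUnitOf.one.neg))
    · intro i hi
      fin_cases i
      · exact hmem m2 rfl
      · exact hmem mb rfl
      · exact hmem U.mem_fst rfl
      all_goals exact absurd hi (by decide)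
    · intro i hi
      fin_cases i
      iterate 3 exact absurd hi (by decide)
      · exact hmem mq (Real.sq_sqrt pq.le)
      · exact hmem m2q (Real.sq_sqrt p2q.le)
      · exact hmem U.mem_snd (Real.sq_sqrt p5.le)
      · have hx : Units.mk0 θ hθ0.ne' ^ 2 = Units.mk0 _ pc.ne' * (Units.mk0 _ p2.ne' ^ i *
            Units.mk0 _ pb.ne' ^ j * Units.mk0 _ p1.ne' ^ k) := by
          ext
          simp [hθ2]
        change Units.mk0 θ hθ0.ne' ^ 2 ∈ _
        rw [hx]
        exact mul_mem (hmem mc rfl) (mul_mem (mul_mem (zpow_mem (hmem m2 rfl) _)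
          (zpow_mem (hmem mb rfl) _)) (zpow_mem (hmem U.mem_fst rfl) _))
  rw [unitIndex, hE, hQ, relIndex_expGroup he h0]
  rfl

theorem of_norm_eq_one (U : UnitData q n m d₁ d₂) (h : normEps n = 1) :
    IsFundamentalSystem (sqrtField {2, q, n})
      ![eps 2, eps (2 * n), eps d₁, √(eps q), √(eps (2 * q)), √(eps d₂), √(eps n * eps d₁)] ∧
    unitIndex (sqrtField {2, q, n}) = 2 ^ 4 := by
  have mn : n ∈ radicands 2 q n := by simp [radicands]
  have pn := U.eps_pos mn
  have p1 := U.eps_pos U.mem_fst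
  have hθ := U.sqrt_mul_mem pn (U.sqrt_n h) U.sqrt_fst
  refine U.isFundamentalSystem_and_unitIndex (Or.inr ⟨rfl, rfl⟩) U.norm_two_mul hθ
    (Real.sqrt_pos.2 (mul_pos pn p1)) (i := 0) (j := 0) (k := 1) ?_ ?_
  · rw [Real.sq_sqrt (mul_pos pn p1).le]
    simp
  · intro v hv k0 k1 k2 k3 k4 k5 k6 hk
    refine U.even_theta_of_sqrt_notMem (by simp [radicands]) pn ?_
      (U.sqrt_notMem pn (U.sqrt_n h)) hθ hv hk
    exact _root_.eps_mem (sqrt_mem_sqrtField (by simp))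

theorem of_sqrt_mem (U : UnitData q n m d₁ d₂) (h : normEps n = -1)
    (hm : √(eps 2 * eps n * eps (2 * n)) ∈ sqrtField {2, n}) :
    IsFundamentalSystem (sqrtField {2, q, n})
      ![eps 2, eps n, eps d₁, √(eps q), √(eps (2 * q)), √(eps d₂),
        √(eps 2 * eps n * eps (2 * n))] ∧
    unitIndex (sqrtField {2, q, n}) = 2 ^ 4 := by
  have p2 := U.eps_pos (d := 2) (by simp [radicands])
  have mn : n ∈ radicands 2 q n := by simp [radicands]
  have pn := U.eps_pos mn
  have p2n := U.eps_pos (d := 2 * n) (by simp [radicands])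
  have hθ : √(eps 2 * eps n * eps (2 * n)) ∈ sqrtField {2, q, n} := sqrtField_mono (fun x hx => by
    rcases hx with rfl | rfl <;> simp) hm
  refine U.isFundamentalSystem_and_unitIndex (Or.inl ⟨rfl, rfl⟩) h hθ
    (Real.sqrt_pos.2 (by positivity)) (i := 1) (j := 1) (k := 0) ?_ ?_
  · rw [Real.sq_sqrt (by positivity)]
    simp
    ring
  · intro v hv k0 k1 k2 k3 k4 k5 k6 hk
    exact U.even_theta_of_mem mn h hm hv hk

theorem of_sqrt_notMem (U : UnitData q n m d₁ d₂) (h : normEps n = -1)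
    (hm : √(eps 2 * eps n * eps (2 * n)) ∉ sqrtField {2, n}) :
    IsFundamentalSystem (sqrtField {2, q, n})
      ![eps 2, eps n, eps d₁, √(eps q), √(eps (2 * q)), √(eps d₂),
        √(eps 2 * eps n * eps (2 * n) * eps d₁)] ∧
    unitIndex (sqrtField {2, q, n}) = 2 ^ 4 := by
  have p2 := U.eps_pos (d := 2) (by simp [radicands])
  have mn : n ∈ radicands 2 q n := by simp [radicands]
  have pn := U.eps_pos mn
  have p2n := U.eps_pos (d := 2 * n) (by simp [radicands])
  have p1 := U.eps_pos U.mem_fst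
  have pω : 0 < eps 2 * eps n * eps (2 * n) := by positivity
  have hr := (U.sqrt_triple h).resolve_left hm
  have hθ := U.sqrt_mul_mem pω hr U.sqrt_fst
  have f2 : √((2 : ℕ) : ℝ) ∈ sqrtField {2, n} := sqrt_mem_sqrtField (by simp)
  have fn : √(n : ℝ) ∈ sqrtField {2, n} := sqrt_mem_sqrtField (by simp)
  refine U.isFundamentalSystem_and_unitIndex (Or.inl ⟨rfl, rfl⟩) h hθ
    (Real.sqrt_pos.2 (by positivity)) (i := 1) (j := 1) (k := 1) ?_ ?_
  · rw [Real.sq_sqrt (by positivity)]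
    simp only [zpow_one]
    ring
  · intro v hv k0 k1 k2 k3 k4 k5 k6 hk
    refine U.even_theta_of_sqrt_notMem mn pω ?_ (U.sqrt_notMem pω hr) hθ hv hk
    exact mul_mem (mul_mem (_root_.eps_mem f2) (_root_.eps_mem fn))
      (_root_.eps_mem (sqrt_mem_of_prod_form f2 fn))

end UnitData

end
theorem mainTheorem7 (η ρ q r s : ℕ)
    (hη : η = 1 ∨ η = 2) (hρ : ρ = 1 ∨ ρ = 2) (hηρ : η ≠ ρ)
    [Fact q.Prime] [Fact r.Prime] [Fact s.Prime]
    (hq : q % 4 = 3) (hr : r % 8 = 5) (hs : s % 8 = 5)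
    (hqr : legendreSym r q = (-1) ^ kroneckerDelta η 2)
    (hqs : legendreSym s q = (-1) ^ kroneckerDelta η 2)
    (hrs : legendreSym s r = 1)
    (γ γ' : ℤ) (hγ : eps (η * q * r * s) = γ + γ' * √((η * q * r * s : ℕ) : ℝ))
    (hsq : ¬ ∃ n : ℕ, (2 : ℤ) ^ kroneckerDelta η 1 * q * (γ - 1) = (n : ℤ) ^ 2) :
    (normEps (r * s) = 1 →
      IsFundamentalSystem (sqrtField {2, q, r * s})
        ![eps 2, eps (2 * r * s), eps (η * q * r * s), √(eps q), √(eps (2 * q)),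
          √(eps (ρ * q * r * s)), √(eps (r * s) * eps (η * q * r * s))]) ∧
    (normEps (r * s) = -1 →
      √(eps 2 * eps (r * s) * eps (2 * r * s)) ∈ sqrtField {2, r * s} →
      IsFundamentalSystem (sqrtField {2, q, r * s})
        ![eps 2, eps (r * s), eps (η * q * r * s), √(eps q), √(eps (2 * q)),
          √(eps (ρ * q * r * s)), √(eps 2 * eps (r * s) * eps (2 * r * s))]) ∧
    (normEps (r * s) = -1 →
      √(eps 2 * eps (r * s) * eps (2 * r * s)) ∉ sqrtField {2, r * s} →
      IsFundamentalSystem (sqrtField {2, q, r * s})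
        ![eps 2, eps (r * s), eps (η * q * r * s), √(eps q), √(eps (2 * q)),
          √(eps (ρ * q * r * s)),
          √(eps 2 * eps (r * s) * eps (2 * r * s) * eps (η * q * r * s))]) ∧
    unitIndex (sqrtField {2, q, r * s}) = 2 ^ 4 := by
  -- With `η = 2^a`, both Kronecker deltas become powers of 2 or signs in `a`: `δ_{η,2} = a` and
  -- `δ_{η,1} = 1 - a`.
  obtain ⟨a, ha, hsign, hη', hρ', hδ⟩ : ∃ a < 2, (-1 : ℤ) ^ a * (-1) ^ kroneckerDelta η 2 = 1 ∧
      η = 2 ^ a ∧ ρ = 2 ^ (1 - a) ∧ kroneckerDelta η 1 = 1 - a := by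
    rcases hη with rfl | rfl
    · exact ⟨0, by simp, by simp [kroneckerDelta], rfl, by omega, rfl⟩
    · exact ⟨1, by simp, by simp [kroneckerDelta], rfl, by omega, rfl⟩
  have D : PrimeData q r s ((-1) ^ kroneckerDelta η 2) :=
    ⟨hq, hr, hs, neg_one_pow_eq_or ℤ _, hqr, hqs, hrs⟩
  have hd : ¬IsSquare (2 ^ a * q * r * s) :=
    (Fact.out : q.Prime).not_isSquare_of_dvd_squarefree
      (by simpa using D.squarefree ha one_lt_two one_lt_two one_lt_two) ⟨2 ^ a * r * s, by ring⟩
  rw [hδ] at hsq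
  rw [hη'] at hγ
  have U := D.unitData ha hsign fun h => hsq (exists_sq_of_isSquareClass_mul ha
    (Fact.out : r.Prime).ne_zero (Fact.out : s.Prime).ne_zero hd h hγ)
  rw [← hη', ← hρ'] at U
  rw [show 2 * r * s = 2 * (r * s) by ring]
  refine ⟨fun h => (U.of_norm_eq_one h).1, fun h hm => (U.of_sqrt_mem h hm).1,
    fun h hm => (U.of_sqrt_notMem h hm).1, ?_⟩
  rcases normEps_eq_or (r * s) with h | h
  · exact (U.of_norm_eq_one h).2
  · by_cases hm : √(eps 2 * eps (r * s) * eps (2 * (r * s))) ∈ sqrtField {2, r * s}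
    · exact (U.of_sqrt_mem h hm).2
    · exact (U.of_sqrt_notMem h hm).2
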